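/- **Setting.** Rings are commutative with unit. Let $I$ be a finite set and $n_I=(n_i)_{i\in I}\in\mathbb N^I$. For $i\in I$ let $X_i=(X_{i,0},\dots,X_{i,n_i})$ be indeterminates and let $X^*_i$ be the dual $(n_i+1)$-tuple of indeterminates; for $J\subseteq I$ write $X^*_J=(X^*_j)_{j\in J}$. Let $X=(X_0,\dots,X_n)$, let $X^*$ be its dual, and write $X^*\cdot x=\sum_s X^*_s x_s$. **Splittable polynomials.** For $D\ge 0$ let $G_D(X^*)=\prod_{t<D}(X^*\cdot X_t)=\sum_{|\alpha|=D}\sigma_\alpha {X^*}^\alpha$, where $X_0,\dots,X_{D-1}$ are copies of $X$ and $\sigma_\alpha\in\mathbb Z[X_0,\dots,X_{D-1}]$. A homogeneous polynomial $g=\sum_{|\alpha|=D} a_\alpha {X^*}^\alpha$ of degree $D$ over a ring $A$ is *splittable* if $D=0$, or if $(a_\alpha)_\alpha$ satisfies every polynomial relation over $\mathbb Z$ satisfied by $(\sigma_\alpha)_\alpha$. **Wedge.** Let $A$ be a reduced ring, $f\in A[X]$ homogeneous of degree $d$, and $g\in A[X^*]$ splittable of degree $D$. The wedge $f\wedge g$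 is the (necessarily unique) element $w\in A$, if it exists, such that for every ring morphism $\psi\colon A\to K$ to an algebraically closed field and every splitting $\psi(g)=y\prod_{t<D}(X^*\cdot x_t)$ over $K$ one has $\psi(w)=y^d\prod_{t<D}\psi(f)(x_t)$ (with $0^0=1$). For $R\in A[X^*_I]$ splittable in $X^*_i$ and $f\in A[X_i]$ homogeneous, $f\wedge R\in A[X^*_{I\setminus\{i\}}]$ denotes the wedge of $f$ and $R$ with respect to $X_i$ and $X^*_i$, over the coefficient ring $A[X^*_{I\setminus\{i\}}]$. The zero polynomial is homogeneous of every degree; it is always taken with prescribed degrees. If $R$ has degree $D_j$ in $X^*_j$ for each $j$, and $f\in A[X_i]$ has degree $d$, then $f\wedge R$ is taken with degree $dD_j$ in $X^*_j$ for $j\neq i$. **Resultants.** By recursion on $|I|$, a polynomial $R\in A[X^*_I]$ is a *resultant in $X^*_I$ over $A$, of degrees $D_I\in\mathbb N^I$*, if for every $i\in I$: 1. as a polynomial in $X^*_i$, $R$ is splittable of degree $D_i$; 2. for every reduced $A$-algebra $B$ and every homogeneous $f\in B[X_i]$ of degree $d$, the wedge $f\wedge R$ exists and is a resultant in $X^*_{I\setminus\{i\}}$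 over $B$, of degrees $(dD_j)_{j\ne i}$; 3. if moreover $j\in I\setminus\{i\}$ and $g\in B[X_j]$ is homogeneous, then $g\wedge f\wedge R=f\wedge g\wedge R$. It is a *resultant* if it is one for some degrees $D_I$. It is a *weak resultant* if, for some $D_I$ and every $i\in I$, it is splittable of degree $D_i$ as a polynomial in $X^*_i$ and, for every $j\in I\setminus\{i\}$, with $F=\sum_{|\alpha|=n_j}T_\alpha X_i^\alpha$ the form of degree $n_j$ in $X_i$ with indeterminate coefficients $T$, the wedge $F\wedge R$ over $A[T]$ exists and is splittable, of degree $n_jD_j$, in $X^*_j$. **Constrained families.** Let $k$ be a field and let $L\supseteq k$ be an algebraically closed extension of infinite transcendence degree. For a family of points $\xi_I=([x_i])_{i\in I}\in\prod_{i\in I}\mathbb P^{n_i}(L)$, let $V^*(\xi_I)$ be the set of families $\lambda_I$ of linear forms over $L$ with $\lambda_i(x_i)=0$ for all $i$, and let $k(\xi_I)$ be the field generated over $k$ by the ratios of homogeneous coordinates of the $\xi_i$. Let $\lambda_I\in V^*(\xi_I)$ be generic over $k(\xi_I)$, i.e., every polynomial over $k(\xi_I)$ vanishing at (the coefficients of)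 $\lambda_I$ vanishes on $V^*(\xi_I)$. The family $\xi_I$ is *unconstrained* over $k$ if $\lambda_I$ is algebraically free over $k$, and *constrained* otherwise; it is *minimally constrained* if it is constrained and all its proper subfamilies are unconstrained. It is *singly constrained* if $\lambda_I$ satisfies exactly one irreducible polynomial relation over $k$, up to a factor in $k^\times$; this relation is the *resultant* $\mathfrak R^k_{\xi_I}\in k[X^*_I]$, defined up to a factor in $k^\times$. The same definitions apply to subfamilies, with $k[X^*_J]\subseteq k[X^*_I]$ for $J\subseteq I$. **Theorem.** Let $R\in k[X^*_I]$. The following are equivalent: 1. $R$ is a resultant in $X^*_I$ over $k$; 2. $R$ is a weak resultant in $X^*_I$ over $k$; 3. every irreducible factor of $R$ in $k[X^*_I]$ is of the form $\mathfrak R^k_{\xi_J}$, where $J\subseteq I$ and $\xi_J\in\prod_{j\in J}\mathbb P^{n_j}(L)$ is minimally constrained over $k$ (the zero polynomial is considered to have no irreducible factors). Moreover, if $n_i\ne 0$ for all $i\in I$, then every family $\xi_J$ ($J\subseteq I$) that is minimally constrained over $k$, with resultant $\mathfrak R^k_{\xi_J}$, extends to a singly constrained family $\xi_I\in\prod_{i\in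 I}\mathbb P^{n_i}(L)$ with the same resultant over $k$. -/

import Mathlib

open MvPolynomial
open scoped LinearAlgebra.Projectivization

noncomputable section

namespace AbstractResultant

universe u v w

/-! ### Splittable polynomials and the wedge operation -/

/-- The multi-exponents `α ∈ ℕ^{n+1}` with `∑ αₛ = d`. -/
abbrev Expo (n d : ℕ) : Type :=
  {α : Fin (n + 1) →₀ ℕ // α ∈ (Finset.univ : Finset (Fin (n + 1))).finsuppAntidiag d}

/-- `G_D(X^*) = ∏_{t < D} (X^* · X_t)`, a polynomial in `X^*` whose coefficients are polynomials
over `ℤ` in the `D` groups of indeterminates `X_t = (X_{t,0}, …, X_{t,n})`. -/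
def splitGeneric (n D : ℕ) :
    MvPolynomial (Fin (n + 1)) (MvPolynomial (Fin D × Fin (n + 1)) ℤ) :=
  ∏ t : Fin D, ∑ a : Fin (n + 1), C (X (t, a)) * X a

/-- The elementary homogeneous symmetric polynomial `σ_α`: the coefficient of `(X^*)^α` in `G_D`. -/
def elemSymm (n D : ℕ) (α : Expo n D) : MvPolynomial (Fin D × Fin (n + 1)) ℤ :=
  coeff α.1 (splitGeneric n D)

/-- `g` is homogeneous of degree `D` and, if `D > 0`, its coefficients satisfy every polynomial
relation over `ℤ` that the `σ_α` satisfy. -/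
def IsSplittable {A : Type u} [CommRing A] {n : ℕ} (D : ℕ)
    (g : MvPolynomial (Fin (n + 1)) A) : Prop :=
  g.IsHomogeneous D ∧
    (0 < D → ∀ P : MvPolynomial (Expo n D) ℤ,
      aeval (elemSymm n D) P = 0 → aeval (fun α : Expo n D => coeff α.1 g) P = 0)

/-- For `f` homogeneous of degree `d` in `X` and `g` splittable of degree `D` in the dual
indeterminates `X^*`, over a reduced ring `A`: the element `w` of `A` is `f ∧ g`. That is, whenever
`g` splits as `y ∏_{t < D} (X^* · x_t)` over an algebraically closed field `K` (along a ring
morphism `A → K`), the image of `w` in `K` is `y ^ d ∏_{t < D} f(x_t)`.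
A splittable polynomial splits over every such `K`, the value does not depend on the splitting,
and elements of a reduced ring are separated by its morphisms to algebraically closed fields,
so there is at most one such `w`. The degrees `d` and `D` matter only when `f` or `g` vanishes. -/
def IsWedge {A : Type u} [CommRing A] {n : ℕ} (d D : ℕ)
    (f g : MvPolynomial (Fin (n + 1)) A) (w : A) : Prop :=
  ∀ (K : Type u) [Field K] [IsAlgClosed K] (ψ : A →+* K) (y : K) (x : Fin D → Fin (n + 1) → K),
    map ψ g = C y * ∏ t : Fin D, ∑ a : Fin (n + 1), C (x t a) * X a →
      ψ w = y ^ d * ∏ t : Fin D, eval (x t) (map ψ f)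

/-- The homogeneous polynomial of degree `d` in `X` with indeterminate coefficients
`T_α`, `|α| = d`, over the ring `A[T]`. -/
def genericForm (A : Type u) [CommRing A] (n d : ℕ) :
    MvPolynomial (Fin (n + 1)) (MvPolynomial (Expo n d) A) :=
  ∑ α : Expo n d, monomial α.1 (X α)

/-! ### Polynomials in several groups of dual indeterminates -/

/-- The index set of all the dual indeterminates `X^*_I`, where `X^*_i` is an
`(n_i + 1)`-tuple. -/
abbrev Vars {ι : Type w} (n : ι → ℕ) : Type w := Σ i : ι, Fin (n i + 1)

section Groups

variable {ι : Type w} [DecidableEq ι] {n : ι → ℕ}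

/-- A polynomial in `A[X^*_I]`, seen as a polynomial in `X^*_i` alone. Its coefficients lie in
`A[X^*_{I \ {i}}]`, which we view throughout as a subring of `A[X^*_I]`. -/
def asPolyIn {A : Type u} [CommRing A] (i : ι) (R : MvPolynomial (Vars n) A) :
    MvPolynomial (Fin (n i + 1)) (MvPolynomial (Vars n) A) :=
  eval₂ (C.comp C)
    (fun p : Vars n =>
      if h : p.1 = i then X (Fin.cast (congrArg (fun j => n j + 1) h) p.2) else C (X p)) R

/-- `w` is `f ∧_i R`, where `f ∈ A[X_i]` is homogeneous of degree `d` and `R ∈ A[X^*_I]` is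
splittable of degree `D` in `X^*_i`. -/
def IsWedgeAt {A : Type u} [CommRing A] (i : ι) (d D : ℕ)
    (f : MvPolynomial (Fin (n i + 1)) A) (R w : MvPolynomial (Vars n) A) : Prop :=
  IsWedge d D (map C f) (asPolyIn i R) w

/-- `R` is a resultant in `X^*_J` over `A`, of degree `D i` in `X^*_i` for each `i ∈ J`.
Here `R` belongs to `A[X^*_J] ⊆ A[X^*_I]`. The rings over which one works are reduced. -/
def IsResultantOfDegree (J : Finset ι) (A : Type u) [CommRing A] (D : ι → ℕ)
    (R : MvPolynomial (Vars n) A) : Prop :=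
  ∀ i, ∀ _ : i ∈ J,
    IsSplittable (D i) (asPolyIn i R) ∧
    ∀ (B : Type u) [CommRing B] [IsReduced B] [Algebra A B] (d : ℕ)
      (f : MvPolynomial (Fin (n i + 1)) B), f.IsHomogeneous d →
      -- `f ∧ R` exists, and is a resultant in the remaining groups of indeterminates
      (∃ w : MvPolynomial (Vars n) B,
        IsWedgeAt i d (D i) f (map (algebraMap A B) R) w ∧
        IsResultantOfDegree (J.erase i) B (fun j => d * D j) w) ∧
      -- `g ∧ f ∧ R = f ∧ g ∧ R`
      ∀ j ∈ J.erase i, ∀ (e : ℕ) (g : MvPolynomial (Fin (n j + 1)) B), g.IsHomogeneous e →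
        ∀ w₁ w₂ z₁ z₂ : MvPolynomial (Vars n) B,
          IsWedgeAt i d (D i) f (map (algebraMap A B) R) w₁ →
          IsWedgeAt j e (d * D j) g w₁ z₁ →
          IsWedgeAt j e (D j) g (map (algebraMap A B) R) w₂ →
          IsWedgeAt i d (e * D i) f w₂ z₂ →
          z₁ = z₂
termination_by J.card
decreasing_by exact Finset.card_erase_lt_of_mem ‹_›

/-- `R` is a resultant in `X^*_I` over `A`. -/
def IsResultant [Fintype ι] {A : Type u} [CommRing A] (R : MvPolynomial (Vars n) A) : Prop :=
  ∃ D : ι → ℕ, IsResultantOfDegree Finset.univ A D R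

/-- `R` is a weak resultant in `X^*_I` over `A`: it is splittable in each `X^*_i`, and for
`j ≠ i`, the wedge of the indeterminate form of degree `n_j` in `X_i` with `R` is splittable
in `X^*_j`. -/
def IsWeakResultant {A : Type u} [CommRing A] (R : MvPolynomial (Vars n) A) : Prop :=
  ∃ D : ι → ℕ, ∀ i,
    IsSplittable (D i) (asPolyIn i R) ∧
    ∀ j, j ≠ i →
      ∃ w : MvPolynomial (Vars n) (MvPolynomial (Expo (n i) (n j)) A),
        IsWedgeAt i (n j) (D i) (genericForm A (n i) (n j)) (map C R) w ∧
        IsSplittable (n j * D j) (asPolyIn j w)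

end Groups

/-! ### Constrained families of projective points and their resultants -/

section Points

variable (k : Type u) {L : Type v} [Field k] [Field L] [Algebra k L] {ι : Type w} {n : ι → ℕ}

/-- The field `k(ξ_I)`, generated over `k` by the ratios of homogeneous coordinates of
the points `ξ_i`. -/
def fieldOf (ξ : ∀ i, ℙ L (Fin (n i + 1) → L)) : IntermediateField k L :=
  IntermediateField.adjoin k
    {z | ∃ (i : ι) (a b : Fin (n i + 1)), (ξ i).rep b ≠ 0 ∧ z = (ξ i).rep a / (ξ i).rep b}

/-- `V^*(ξ_I)`: the families of linear forms `λ_I` (given by their coefficients) such that `λ_i`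
vanishes at `ξ_i` for each `i`. -/
def dualVariety (ξ : ∀ i, ℙ L (Fin (n i + 1) → L)) : Set (Vars n → L) :=
  {l | ∀ i, ∑ a : Fin (n i + 1), l ⟨i, a⟩ * (ξ i).rep a = 0}

/-- `l ∈ V^*(ξ_I)` is generic over `k(ξ_I)`: it satisfies no polynomial relation over
`k(ξ_I)` other than those that hold on all of `V^*(ξ_I)`. -/
def IsGenericDual (ξ : ∀ i, ℙ L (Fin (n i + 1) → L)) (l : Vars n → L) : Prop :=
  l ∈ dualVariety ξ ∧
    ∀ P : MvPolynomial (Vars n) (fieldOf k ξ), aeval l P = 0 →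
      ∀ m ∈ dualVariety ξ, aeval m P = 0

/-- `ξ_I` is unconstrained over `k`: a generic `λ_I ∈ V^*(ξ_I)` is algebraically free over `k`. -/
def IsUnconstrained (ξ : ∀ i, ℙ L (Fin (n i + 1) → L)) : Prop :=
  ∃ l : Vars n → L, IsGenericDual k ξ l ∧ AlgebraicIndependent k l

/-- `ξ_I` is constrained over `k`: a generic `λ_I ∈ V^*(ξ_I)` is not algebraically free. -/
def IsConstrained (ξ : ∀ i, ℙ L (Fin (n i + 1) → L)) : Prop :=
  ∃ l : Vars n → L, IsGenericDual k ξ l ∧ ¬ AlgebraicIndependent k l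

/-- `ξ_I` is minimally constrained over `k`: it is constrained, and no proper
subfamily is. -/
def IsMinimallyConstrained (ξ : ∀ i, ℙ L (Fin (n i + 1) → L)) : Prop :=
  IsConstrained k ξ ∧
    ∀ S : Set ι, S ≠ Set.univ → IsUnconstrained k (n := fun s : S => n s) (fun s : S => ξ s)

/-- `R` is (an instance of) the resultant of `ξ_I` over `k`: the irreducible algebraic relation
over `k`, unique up to a factor in `kˣ`, that a generic `λ_I ∈ V^*(ξ_I)` satisfies. -/
def IsResultantOf (ξ : ∀ i, ℙ L (Fin (n i + 1) → L)) (R : MvPolynomial (Vars n) k) : Prop :=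
  ∃ l : Vars n → L, IsGenericDual k ξ l ∧ Irreducible R ∧ aeval l R = 0 ∧
    ∀ Q : MvPolynomial (Vars n) k, Irreducible Q → aeval l Q = 0 → Associated Q R

/-- `ξ_I` is singly constrained over `k`: a generic `λ_I ∈ V^*(ξ_I)` satisfies a single
irreducible algebraic relation over `k`. -/
def IsSinglyConstrained (ξ : ∀ i, ℙ L (Fin (n i + 1) → L)) : Prop :=
  ∃ R : MvPolynomial (Vars n) k, IsResultantOf k ξ R

/-- The inclusion `k[X^*_J] ⊆ k[X^*_I]` for `J ⊆ I`. -/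
def inclVars {k : Type u} [Field k] (J : Set ι)
    (P : MvPolynomial (Vars (fun j : J => n j)) k) : MvPolynomial (Vars n) k :=
  rename (fun p : Vars (fun j : J => n j) => (⟨p.1.1, p.2⟩ : Vars n)) P

end Points

end AbstractResultant

end

open AbstractResultant

/-! A resultant is a weak resultant because the generic form of degree `n j` is one of the forms
allowed in the recursive definition. The substance lies in two other implications.

From families to resultants. Let R be the resultant of a minimally constrained family x_J; it
generates over k the ideal of the linear space of families of linear forms that vanish at these
points, and it involves every group of J. As a polynomial in X*_i it is prime, and over the function
field of the space attached to the other points it has the linear factor X*_i · x_i. A height-one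
argument makes R divide a multiple, by a nonzero coefficient, of a product of powers of conjugates
of this factor, so R splits over an algebraic closure (`exists_splitting_of_lin_dvd`). Its wedge
with a form of indeterminate coefficients T is rational (Galois theory, plus a descent in the purely
inseparable direction) and integral (valuation rings), so it exists over the coefficient ring, which
is integrally closed (`exists_wedge_of_isIntegrallyClosed`). It is again prime, and generates the
ideal of the space on which, in addition, the form T vanishes at x_i (`IsLinGen.wedge`). Hence group
i disappears, T joins a set of auxiliary coordinates ranging over a linear space, and the situation
reproduces itself: induction on the number of groups applies (`Good.isResultantOfDegree`). Wedges
taken in two orders generate the same ideal; the remaining constant is 1 because substituting a d-th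
power of a linear form turns the wedge into R^d (`IsStep.comm`). Arbitrary forms over reduced
k-algebras are reached because splittings, together with the values of forms at them, specialize
along places (`exists_splitting_specialization`). Since wedges are multiplicative, products of
resultants are resultants.

From weak resultants to families. Let P be an irreducible factor of R ≠ 0 and let l be a point over
L whose relations are exactly the multiples of P. For a group i involved in P, the values of l
outside i are algebraically independent, and the splitting of R over their algebraic closure gives a
point x_i, algebraic over them, at which l_i vanishes. The crux is that x_j is algebraic also over
the values outside i, for i ≠ j (`IsPoint.mem_acl_offGroup`). Take a form T of degree n_j, generic
among those vanishing at x_i. As the wedge is splittable in X*_j, the form l_j vanishes at a point z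
algebraic over T and the groups other than i and j. If x_i were not algebraic over z and these
groups, n_j + 1 conjugates of x_i would determine n_j + 1 coefficients of T, at the cost of only n_j
coordinates of z: the degree n_j is chosen for this count (`IsPoint.mem_acl_of_form`). A second
count identifies z with x_j, after which T can be eliminated. So the points depend on no single
form, l_J is generic over them, P is their resultant, and omitting a group leaves independent
values.

For the extension, each point added outside J carries a new independent coordinate, which frees the
whole form of its group; this is where `n i ≠ 0` enters. -/

open MvPolynomial
open scoped LinearAlgebra.Projectivization

noncomputable section

namespace AbstractResultant

set_option linter.unusedSectionVars false

universe u v w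

/-! ### Linear forms -/

section LinearForms

variable {σ : Type*} [Fintype σ] {A : Type*} [CommRing A]

/-- The linear form `∑ xₐ Xₐ`. -/
def lin (x : σ → A) : MvPolynomial σ A := ∑ a, C (x a) * X a

@[simp] lemma eval_lin (x y : σ → A) : eval y (lin x) = ∑ a, x a * y a := by
  simp [lin]

@[simp] lemma map_lin {B : Type*} [CommRing B] (φ : A →+* B) (x : σ → A) :
    map φ (lin x) = lin (fun a => φ (x a)) := by
  simp [lin]

lemma lin_smul (c : A) (x : σ → A) : lin (c • x) = C c * lin x := by
  simp [lin, Finset.mul_sum, mul_assoc]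

lemma lin_zero : lin (0 : σ → A) = 0 := by simp [lin]

lemma lin_isHomogeneous (x : σ → A) : (lin x).IsHomogeneous 1 :=
  IsHomogeneous.sum _ _ _ fun a _ => by
    simpa using (isHomogeneous_C σ (x a)).mul (isHomogeneous_X A a)

lemma coeff_lin [DecidableEq σ] (x : σ → A) (a : σ) :
    coeff (Finsupp.single a 1) (lin x) = x a := by
  simp only [lin, coeff_sum, coeff_C_mul, coeff_X]
  rw [Finset.sum_eq_single a]
  · simp
  · intro b _ hb
    rw [if_neg, mul_zero]
    intro h
    exact hb (Finsupp.single_left_injective one_ne_zero h)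
  · simp

lemma lin_injective : Function.Injective (lin : (σ → A) → MvPolynomial σ A) := by
  classical
  intro x y h
  funext a
  rw [← coeff_lin x a, h, coeff_lin]

lemma lin_eq_zero {x : σ → A} : lin x = 0 ↔ x = 0 := by
  rw [← lin_zero]
  exact lin_injective.eq_iff

section Elim

variable [DecidableEq σ]

/-- The substitution that eliminates `X s` by means of the equation `lin x = 0`, for `x s = 1`. -/
def elimVar (s : σ) (x : σ → A) : MvPolynomial σ A →ₐ[A] MvPolynomial σ A :=
  aeval fun a => X a - if a = s then lin x else 0

lemma elimVar_lin_eq (s : σ) (x y : σ → A) : elimVar s x (lin y) = lin y - C (y s) * lin x := by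
  have : elimVar s x (lin y) = ∑ a, C (y a) * (X a - if a = s then lin x else 0) := by
    simp [elimVar, lin, algebraMap_eq]
  rw [this]
  simp [mul_sub, Finset.sum_sub_distrib, lin]

lemma elimVar_lin {s : σ} {x : σ → A} (hs : x s = 1) : elimVar s x (lin x) = 0 := by
  simp [elimVar_lin_eq, hs]

lemma lin_dvd_sub_elimVar (s : σ) (x : σ → A) (p : MvPolynomial σ A) :
    lin x ∣ p - elimVar s x p := by
  rw [← Ideal.mem_span_singleton, ← Ideal.Quotient.eq]
  have : (Ideal.Quotient.mkₐ A (Ideal.span {lin x})) =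
      (Ideal.Quotient.mkₐ A (Ideal.span {lin x})).comp (elimVar s x) := by
    refine algHom_ext fun a => ?_
    simp only [elimVar, AlgHom.comp_apply, aeval_X, Ideal.Quotient.mkₐ_eq_mk]
    rw [Ideal.Quotient.eq, Ideal.mem_span_singleton]
    split_ifs <;> simp
  exact DFunLike.congr_fun this p

/-- The substitution kills `lin x` and is the identity modulo `lin x`, so its kernel is the ideal of
`lin x`. Primality of linear forms and all transfers of divisibility rest on this. -/
lemma lin_dvd_iff {s : σ} {x : σ → A} (hs : x s = 1) {p : MvPolynomial σ A} :
    lin x ∣ p ↔ elimVar s x p = 0 := by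
  constructor
  · rintro ⟨q, rfl⟩
    rw [map_mul, elimVar_lin hs, zero_mul]
  · intro h
    simpa [h] using lin_dvd_sub_elimVar s x p

lemma lin_prime_of_eq_one [IsDomain A] {s : σ} {x : σ → A} (hs : x s = 1) :
    Prime (lin x) := by
  refine ⟨fun h => ?_, fun h => ?_, fun p q h => ?_⟩
  · rw [lin_eq_zero] at h
    simp [h] at hs
  · have := (lin_dvd_iff hs (p := 1)).1 h.dvd
    simp at this
  · simp only [lin_dvd_iff hs, map_mul, mul_eq_zero] at h ⊢
    exact h

lemma elimVar_map {B : Type*} [CommRing B] (φ : A →+* B) (s : σ) (x : σ → A)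
    (p : MvPolynomial σ A) :
    elimVar s (fun a => φ (x a)) (map φ p) = map φ (elimVar s x p) := by
  have : ((elimVar s (fun a => φ (x a))).toRingHom.comp (map φ)) =
      (map φ).comp (elimVar s x).toRingHom := by
    refine ringHom_ext (fun a => ?_) (fun a => ?_)
    · simp [algebraMap_eq]
    · simp only [elimVar, AlgHom.toRingHom_eq_coe, RingHom.coe_comp, RingHom.coe_coe,
        Function.comp_apply, map_X, aeval_X, map_sub]
      split_ifs <;> simp
  exact DFunLike.congr_fun this p

lemma eval_elimVar (s : σ) (x μ : σ → A) (p : MvPolynomial σ A) :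
    eval μ (elimVar s x p) = eval (fun a => μ a - if a = s then ∑ b, x b * μ b else 0) p := by
  have : (eval μ).comp (elimVar s x).toRingHom =
      eval (fun a => μ a - if a = s then ∑ b, x b * μ b else 0) := by
    refine ringHom_ext (fun a => ?_) (fun a => ?_)
    · simp [algebraMap_eq]
    · simp only [elimVar, AlgHom.toRingHom_eq_coe, RingHom.coe_comp, RingHom.coe_coe,
        Function.comp_apply, aeval_X, map_sub, eval_X]
      split_ifs <;> simp
  exact DFunLike.congr_fun this p

lemma sum_mul_elim {s : σ} {x : σ → A} (hs : x s = 1) (μ : σ → A) :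
    ∑ a, x a * (μ a - if a = s then ∑ b, x b * μ b else 0) = 0 := by
  simp [mul_sub, Finset.sum_sub_distrib, hs]

lemma elimVar_eq_self_of_notMem_vars {s : σ} {x : σ → A} {p : MvPolynomial σ A}
    (hp : s ∉ p.vars) : elimVar s x p = p := by
  have h : elimVar s x p = aeval X p := by
    refine eval₂Hom_congr' rfl (fun a ha _ => ?_) rfl
    have : a ≠ s := fun h => hp (h ▸ ha)
    simp [this]
  rw [h, aeval_X_left_apply]

/-- A polynomial that does not involve `X s` and is divisible by `lin x`, `x s = 1`, vanishes. -/
lemma eq_zero_of_lin_dvd {s : σ} {x : σ → A} (hs : x s = 1) {p : MvPolynomial σ A}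
    (h : lin x ∣ p) (hp : s ∉ p.vars) : p = 0 := by
  rw [← elimVar_eq_self_of_notMem_vars (x := x) hp]
  exact (lin_dvd_iff hs).1 h

/-- The substitution parametrizes the hyperplane `lin x = 0`, and a polynomial over an infinite
domain is determined by its values. -/
lemma lin_dvd_iff_forall [IsDomain A] [Infinite A] {s : σ} {x : σ → A} (hs : x s = 1)
    {p : MvPolynomial σ A} :
    lin x ∣ p ↔ ∀ μ : σ → A, ∑ a, x a * μ a = 0 → eval μ p = 0 := by
  constructor
  · rintro ⟨q, rfl⟩ μ hμ
    simp [hμ]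
  · intro h
    rw [lin_dvd_iff hs]
    refine MvPolynomial.funext fun μ => ?_
    rw [eval_elimVar, map_zero]
    exact h _ (sum_mul_elim hs μ)

end Elim

end LinearForms

/-! ### Products of linear forms over a field -/

section FieldLinearForms

variable {σ : Type*} [Fintype σ] {K : Type*} [Field K]

lemma lin_associated_smul {c : K} (hc : c ≠ 0) (x : σ → K) : Associated (lin (c • x)) (lin x) := by
  rw [lin_smul, mul_comm]
  exact associated_mul_unit_left _ _ ((isUnit_iff_ne_zero.2 hc).map C)

lemma exists_smul_eq_one {x : σ → K} (hx : x ≠ 0) : ∃ s, x s ≠ 0 ∧ ((x s)⁻¹ • x) s = 1 := by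
  obtain ⟨s, hs⟩ := Function.ne_iff.1 hx
  exact ⟨s, hs, inv_mul_cancel₀ hs⟩

lemma lin_prime {x : σ → K} (hx : x ≠ 0) : Prime (lin x) := by
  classical
  obtain ⟨s, hs, h1⟩ := exists_smul_eq_one hx
  exact (lin_associated_smul (inv_ne_zero hs) x).prime (lin_prime_of_eq_one h1)

lemma eq_smul_of_lin_dvd {x y : σ → K} (hx : x ≠ 0) (h : lin x ∣ lin y) : ∃ c : K, y = c • x := by
  classical
  obtain ⟨s, hs, h1⟩ := exists_smul_eq_one hx
  have h2 := (lin_dvd_iff h1).1 (((lin_associated_smul (inv_ne_zero hs) x).dvd).trans h)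
  rw [elimVar_lin_eq, ← lin_smul, sub_eq_zero] at h2
  exact ⟨y s * (x s)⁻¹, by rw [mul_smul]; exact lin_injective h2⟩

lemma prod_lin_isHomogeneous (m : Multiset (σ → K)) :
    ((m.map lin).prod).IsHomogeneous (Multiset.card m) := by
  induction m using Multiset.induction with
  | empty => simpa using isHomogeneous_one σ K
  | cons x m ih =>
    rw [Multiset.map_cons, Multiset.prod_cons, Multiset.card_cons, add_comm]
    exact (lin_isHomogeneous x).mul ih

/-- A divisor of a product of nonzero linear forms is such a product, up to a constant. -/
lemma exists_eq_prod_lin_of_dvd {m : Multiset (σ → K)} (hm : ∀ x ∈ m, x ≠ 0)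
    {p : MvPolynomial σ K} (h : p ∣ (m.map lin).prod) :
    ∃ c : K, c ≠ 0 ∧ ∃ m' ≤ m, p = C c * (m'.map lin).prod := by
  induction m using Multiset.induction generalizing p with
  | empty =>
    rw [Multiset.map_zero, Multiset.prod_zero] at h
    obtain ⟨c, hc, rfl⟩ := (isUnit_iff_eq_C_of_isReduced).1 (isUnit_of_dvd_one h)
    exact ⟨c, hc.ne_zero, 0, le_rfl, by simp⟩
  | cons x m ih =>
    have hm' : ∀ x ∈ m, x ≠ 0 := fun y hy => hm y (Multiset.mem_cons_of_mem hy)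
    rw [Multiset.map_cons, Multiset.prod_cons] at h
    have hx := lin_prime (hm x (Multiset.mem_cons_self x m))
    rcases hx.left_dvd_or_dvd_right_of_dvd_mul h with ⟨q, rfl⟩ | h
    · obtain ⟨c, hc, m', hle, rfl⟩ := ih hm' ((mul_dvd_mul_iff_left hx.ne_zero).1 h)
      refine ⟨c, hc, x ::ₘ m', Multiset.cons_le_cons x hle, ?_⟩
      rw [Multiset.map_cons, Multiset.prod_cons]
      ring
    · obtain ⟨c, hc, m', hle, rfl⟩ := ih hm' h
      exact ⟨c, hc, m', hle.trans (Multiset.le_cons_self _ _), rfl⟩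

lemma exists_eq_prod_lin_of_dvd_C_mul {m : Multiset (σ → K)} {y : K}
    {p : MvPolynomial σ K} (h0 : C y * (m.map lin).prod ≠ 0) (h : p ∣ C y * (m.map lin).prod) :
    ∃ c : K, c ≠ 0 ∧ ∃ m' ≤ m, (∀ x ∈ m', x ≠ 0) ∧ p = C c * (m'.map lin).prod := by
  have hy : y ≠ 0 := by rintro rfl; simp at h0
  have hm : ∀ x ∈ m, x ≠ 0 := by
    rintro x hx rfl
    refine h0 (by rw [Multiset.prod_eq_zero (Multiset.mem_map.2 ⟨0, hx, lin_zero⟩), mul_zero])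
  rw [((isUnit_iff_ne_zero.2 hy).map C).dvd_mul_left] at h
  obtain ⟨c, hc, m', hle, rfl⟩ := exists_eq_prod_lin_of_dvd hm h
  exact ⟨c, hc, m', hle, fun x hx => hm x (Multiset.mem_of_le hle hx), rfl⟩

/-- If a nonzero linear form divides a product of linear forms then it is proportional to one of
them. -/
lemma exists_smul_of_lin_dvd_prod {m : Multiset (σ → K)} {y : K} {x : σ → K} (hx : x ≠ 0)
    (hy : y ≠ 0) (h : lin x ∣ C y * (m.map lin).prod) : ∃ z ∈ m, ∃ c : K, z = c • x := by
  rw [((isUnit_iff_ne_zero.2 hy).map C).dvd_mul_left] at h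
  obtain ⟨q, hq, hd⟩ := (lin_prime hx).exists_mem_multiset_dvd h
  obtain ⟨z, hz, rfl⟩ := Multiset.mem_map.1 hq
  exact ⟨z, hz, eq_smul_of_lin_dvd hx hd⟩

/-! ### Values attached to a splitting -/

section SplitValue

variable {R : Type*} [CommRing R] [Algebra K R]

/-- The value `y ^ d ∏ v(x)` attached to a splitting `y ∏ (X · x)`. -/
def splitValue (d : ℕ) (v : (σ → K) → R) (y : K) (m : Multiset (σ → K)) : R :=
  algebraMap K R (y ^ d) * (m.map v).prod

/-- Either `d = 0` and `v` is constant, or `d > 0` and a zero factor kills the value. The result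
depends only on `d` and the number of factors, which is why the zero polynomial must come with
prescribed degrees. -/
lemma splitValue_eq_of_eq_zero {d : ℕ} {v : (σ → K) → R}
    (hv : ∀ (c : K) (x : σ → K), v (c • x) = algebraMap K R (c ^ d) * v x)
    {y : K} {m : Multiset (σ → K)} (h : C y * (m.map lin).prod = 0) :
    splitValue d v y m = 0 ^ d * v 0 ^ Multiset.card m := by
  rcases Nat.eq_zero_or_pos d with rfl | hd
  · have h1 : ∀ x, v x = v 0 := fun x => by simpa using (hv 0 x).symm
    have h2 : m.map v = Multiset.replicate (Multiset.card m) (v 0) := by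
      rw [Multiset.eq_replicate]
      refine ⟨by simp, fun b hb => ?_⟩
      obtain ⟨x, -, rfl⟩ := Multiset.mem_map.1 hb
      exact h1 x
    simp [splitValue, h2]
  · rw [zero_pow hd.ne', zero_mul]
    rcases mul_eq_zero.1 h with h | h
    · have : y = 0 := by simpa using h
      simp [splitValue, this, hd.ne']
    · rw [Multiset.prod_eq_zero_iff, Multiset.mem_map] at h
      obtain ⟨x, hx, h⟩ := h
      have hx0 : x = 0 := lin_eq_zero.1 h
      subst hx0
      have hv0 : v 0 = 0 := by simpa [hd.ne'] using hv 0 0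
      rw [splitValue, Multiset.prod_eq_zero (Multiset.mem_map.2 ⟨0, hx, hv0⟩), mul_zero]

/-- The value attached to a splitting depends on the split polynomial only. -/
theorem splitValue_unique {d : ℕ} {v : (σ → K) → R}
    (hv : ∀ (c : K) (x : σ → K), v (c • x) = algebraMap K R (c ^ d) * v x)
    {y y' : K} {m m' : Multiset (σ → K)} (hcard : Multiset.card m = Multiset.card m')
    (h : C y * (m.map lin).prod = C y' * (m'.map lin).prod) :
    splitValue d v y m = splitValue d v y' m' := by
  by_cases h0 : C y * (m.map lin).prod = 0
  · rw [splitValue_eq_of_eq_zero hv h0, splitValue_eq_of_eq_zero hv (h ▸ h0), hcard]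
  · induction m using Multiset.induction generalizing y y' m' with
    | empty =>
      obtain rfl : m' = 0 := by simpa using hcard.symm
      have : y = y' := by simpa using h
      rw [this]
    | cons x m ih =>
      have hy : y ≠ 0 := by rintro rfl; simp at h0
      have hy' : y' ≠ 0 := by
        rintro rfl
        exact h0 (by rw [h]; simp)
      have hx : x ≠ 0 := by
        rintro rfl
        simp [lin_zero] at h0
      have hd : lin x ∣ C y' * (m'.map lin).prod := by
        rw [← h, Multiset.map_cons, Multiset.prod_cons]
        exact ((dvd_mul_right _ _).mul_left _)
      -- By unique factorization `x` is proportional to a factor on the other side. The scalar moves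
      -- into the constant `y'`, and the homogeneity of `v` accounts for it by the same `c ^ d`.
      obtain ⟨z, hz, c, rfl⟩ := exists_smul_of_lin_dvd_prod hx hy' hd
      obtain ⟨m'', rfl⟩ := Multiset.exists_cons_of_mem hz
      rw [Multiset.map_cons, Multiset.prod_cons, Multiset.map_cons, Multiset.prod_cons,
        lin_smul] at h
      have h1 : C y * (m.map lin).prod = C (y' * c) * (m''.map lin).prod := by
        apply mul_left_cancel₀ (lin_prime hx).ne_zero
        rw [C_mul]
        linear_combination h
      have h2 := ih (by simpa using hcard) h1 (by
        intro h3
        apply h0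
        rw [Multiset.map_cons, Multiset.prod_cons]
        linear_combination lin x * h3)
      simp only [splitValue, Multiset.map_cons, Multiset.prod_cons, hv, mul_pow, map_mul] at h2 ⊢
      linear_combination v x * h2

end SplitValue

end FieldLinearForms

/-! ### Specialization of splittings -/

section Specialization

lemma eval_smul_of_isHomogeneous {σ : Type*} {A : Type*} [CommRing A] {f : MvPolynomial σ A}
    {d : ℕ} (hf : f.IsHomogeneous d) (c : A) (x : σ → A) :
    eval (c • x) f = c ^ d * eval x f := by
  rw [eval_eq, eval_eq, Finset.mul_sum]
  refine Finset.sum_congr rfl fun e he => ?_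
  have h := hf (mem_support_iff.1 he)
  change Finsupp.weight (fun _ => 1) e = d at h
  rw [← Finsupp.degree_eq_weight_one] at h
  simp only [Pi.smul_apply, smul_eq_mul, mul_pow, Finset.prod_mul_distrib, Finset.prod_pow_eq_pow_sum]
  have h' : ∑ i ∈ e.support, e i = d := h
  rw [h']
  ring

lemma eval_map_apply {σ : Type*} {A B : Type*} [CommRing A] [CommRing B] (φ : A →+* B)
    (x : σ → A) (p : MvPolynomial σ A) : eval (fun a => φ (x a)) (map φ p) = φ (eval x p) := by
  rw [eval_map]
  exact (eval₂_comp_left φ (RingHom.id A) x p).symm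

lemma eval_zero_map {σ : Type*} {A B : Type*} [CommRing A] [CommRing B] (φ : A →+* B)
    (p : MvPolynomial σ A) : eval (0 : σ → B) (map φ p) = φ (eval 0 p) := by
  rw [← eval_map_apply]
  congr 2
  funext a
  exact (map_zero φ).symm

/-- A finite family of elements of an algebra over `F` specializes to an algebraically closed
extension of `F`, with all its polynomial relations. -/
theorem exists_specialization {I : Type*} [Finite I] (F K : Type*) [Field F] [Field K]
    [IsAlgClosed K] [Algebra F K] {B : Type*} [CommRing B] [Nontrivial B] [Algebra F B]
    (s : I → B) :
    ∃ t : I → K, ∀ P : MvPolynomial I F, aeval s P = 0 → aeval t P = 0 := by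
  have hne : RingHom.ker (aeval (R := F) s) ≠ ⊤ := RingHom.ker_ne_top _
  -- Nullstellensatz: a maximal ideal containing all the relations is the ideal of a point over `K`.
  obtain ⟨M, hM, hle⟩ := Ideal.exists_le_maximal _ hne
  obtain ⟨t, ht⟩ := eq_vanishingIdeal_singleton_of_isMaximal K hM
  refine ⟨t, fun P hP => ?_⟩
  have : P ∈ M := hle hP
  rw [ht, mem_vanishingIdeal_singleton_iff] at this
  exact this

/-- A place: a ring `S` in a field and a prime ideal of `S` are dominated by a valuation ring. -/
theorem exists_valuationSubring_dominating {S M K : Type*} [CommRing S] [Field M] [Field K]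
    (i : S →+* M) (ψ : S →+* K) (h : RingHom.ker i ≤ RingHom.ker ψ) :
    ∃ V : ValuationSubring M, ∃ hV : ∀ s, i s ∈ V,
      ∀ s, IsLocalRing.residue V ⟨i s, hV s⟩ = 0 ↔ ψ s = 0 := by
  let A := i.range
  have hsurj : Function.Surjective i.rangeRestrict := i.rangeRestrict_surjective
  -- This image is prime because the kernels are nested. A valuation ring dominating the
  -- localization at `P` has residues vanishing exactly where `ψ` does.
  let P : Ideal A := (RingHom.ker ψ).map i.rangeRestrict
  have hker : RingHom.ker i.rangeRestrict ≤ RingHom.ker ψ := by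
    intro s hs
    apply h
    rw [RingHom.mem_ker] at hs ⊢
    simpa using congrArg Subtype.val hs
  have := RingHom.ker_isPrime ψ
  have hP : P.IsPrime := Ideal.map_isPrime_of_surjective hsurj hker
  have hmem : ∀ s, i.rangeRestrict s ∈ P ↔ ψ s = 0 := by
    intro s
    constructor
    · intro hs
      obtain ⟨t, ht, hts⟩ := (Ideal.mem_map_iff_of_surjective _ hsurj).1 hs
      have : t - s ∈ RingHom.ker ψ := hker (by rw [RingHom.mem_ker, map_sub, hts, sub_self])
      rw [RingHom.mem_ker, map_sub, sub_eq_zero] at this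
      rw [← this]
      exact ht
    · intro hs
      exact Ideal.mem_map_of_mem _ hs
  obtain ⟨V, hV1, hV2⟩ := (LocalSubring.ofPrime A P).exists_le_valuationSubring
  have hV : ∀ s, i s ∈ V := fun s => hV1 (LocalSubring.le_ofPrime A P ⟨s, rfl⟩)
  refine ⟨V, hV, fun s => ?_⟩
  have h1 : IsUnit (⟨i s, hV s⟩ : V) ↔ IsUnit (algebraMap A (LocalSubring.ofPrime A P).toSubring
      (i.rangeRestrict s)) :=
    isUnit_map_iff (Subring.inclusion hV1) (algebraMap A (LocalSubring.ofPrime A P).toSubring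
      (i.rangeRestrict s))
  rw [IsLocalization.AtPrime.isUnit_to_map_iff _ P, Ideal.mem_primeCompl_iff, hmem] at h1
  rw [IsLocalRing.residue_eq_zero_iff, IsLocalRing.mem_maximalIdeal, mem_nonunits_iff, h1,
    not_not]

lemma exists_max_valuation {σ : Type*} [Finite σ] {M : Type*} [Field M] (V : ValuationSubring M)
    {x : σ → M} (hx : x ≠ 0) : ∃ s, x s ≠ 0 ∧ ∀ a, x a / x s ∈ V := by
  obtain ⟨r, hr⟩ := Function.ne_iff.1 hx
  have : Nonempty σ := ⟨r⟩
  obtain ⟨s, hs⟩ := Finite.exists_max fun a => V.valuation (x a)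
  have h0 : x s ≠ 0 := by
    intro h
    have := hs r
    rw [h, map_zero, le_zero_iff, map_eq_zero] at this
    exact hr this
  refine ⟨s, h0, fun a => ?_⟩
  rw [← V.valuation_le_one_iff, map_div₀]
  exact div_le_one_of_le₀ (hs a) zero_le

/-- A splitting of (a nonzero image of) a polynomial over a valued field reduces to the residue
field, after scaling. -/
lemma exists_integral_splitting {σ : Type*} [Fintype σ] {M : Type*} [Field M]
    (V : ValuationSubring M) {D : ℕ} {g : MvPolynomial σ V} {y : M} {x : Fin D → σ → M}
    (hg : map V.subtype g = C y * ∏ t, lin (x t)) (h0 : map V.subtype g ≠ 0) :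
    ∃ (y' : V) (x' : Fin D → σ → V) (c : Fin D → M),
      (∀ t a, x t a = c t * x' t a) ∧ (y' : M) = y * ∏ t, c t ∧ g = C y' * ∏ t, lin (x' t) := by
  have hx : ∀ t, x t ≠ 0 := by
    intro t ht
    apply h0
    rw [hg, Finset.prod_eq_zero (Finset.mem_univ t) (by rw [ht, lin_zero]), mul_zero]
  choose s hs hV using fun t => exists_max_valuation V (hx t)
  let x' : Fin D → σ → V := fun t a => ⟨x t a / x t (s t), hV t a⟩
  have hxx : ∀ t a, x t a = x t (s t) * x' t a := fun t a => by
    simp only [x']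
    rw [mul_div_cancel₀ _ (hs t)]
  have hlin : ∀ t, lin (x t) = C (x t (s t)) * map V.subtype (lin (x' t)) := by
    intro t
    rw [map_lin, ← lin_smul]
    congr 1
    funext a
    exact hxx t a
  have hg' : map V.subtype g = C (y * ∏ t, x t (s t)) * map V.subtype (∏ t, lin (x' t)) := by
    rw [hg, Finset.prod_congr rfl fun t _ => hlin t, Finset.prod_mul_distrib, map_prod, C_mul,
      map_prod]
    ring
  -- Each normalized vector has a coordinate 1, so no factor dies in the residue field. Hence some
  -- coefficient of the product is a unit, and the constant is a coefficient of `g` divided by this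
  -- unit.
  have hres : map (IsLocalRing.residue V) (∏ t, lin (x' t)) ≠ 0 := by
    rw [map_prod, Finset.prod_ne_zero_iff]
    intro t _
    rw [map_lin, Ne, lin_eq_zero]
    intro h
    have := congrFun h (s t)
    have h1 : x' t (s t) = 1 := Subtype.ext (div_self (hs t))
    simp [h1] at this
  obtain ⟨β, hβ⟩ := ne_zero_iff.1 hres
  rw [coeff_map, Ne, IsLocalRing.residue_eq_zero_iff, IsLocalRing.mem_maximalIdeal,
    mem_nonunits_iff, not_not] at hβ
  obtain ⟨u, hu⟩ := hβ
  have hy : y * ∏ t, x t (s t) = ((coeff β g * ↑u⁻¹ : V) : M) := by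
    have h1 := congrArg (coeff β) hg'
    rw [coeff_C_mul, coeff_map, coeff_map, ← hu] at h1
    have h2 : ((u : V) : M) * ((↑u⁻¹ : V) : M) = 1 := by
      have := congrArg V.subtype u.mul_inv
      simpa only [map_mul, map_one, ValuationSubring.subtype_apply] using this
    change ((coeff β g : V) : M) = _ * ((u : V) : M) at h1
    push_cast
    rw [h1, mul_assoc, h2, mul_one]
  refine ⟨coeff β g * ↑u⁻¹, x', fun t => x t (s t), hxx, hy.symm, ?_⟩
  apply map_injective V.subtype V.subtype_injective
  rw [map_mul, map_C, hg', hy]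
  rfl

/-- The fundamental specialization theorem: a splitting over a field specializes along any
ring morphism to an algebraically closed field, together with the values of forms at it. -/
theorem exists_splitting_specialization {σ : Type*} [Fintype σ] {S M K : Type*} [CommRing S]
    [Field M] [Field K] [IsAlgClosed K] (i : S →+* M) (ψ : S →+* K)
    (h : RingHom.ker i ≤ RingHom.ker ψ) {D : ℕ} {g : MvPolynomial σ S} {y : M}
    {x : Fin D → σ → M} (hg : map i g = C y * ∏ t, lin (x t)) :
    ∃ (y' : K) (x' : Fin D → σ → K), map ψ g = C y' * ∏ t, lin (x' t) ∧
      ∀ (d : ℕ) (F : MvPolynomial σ S) (w : S), F.IsHomogeneous d →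
        i w = y ^ d * ∏ t, eval (x t) (map i F) →
        ψ w = y' ^ d * ∏ t, eval (x' t) (map ψ F) := by
  by_cases h0 : map i g = 0
  -- If `g` maps to zero, `i w` is the image of `0 ^ d * F(0) ^ D`; this identity passes to `ψ`
  -- through the kernels.
  · refine ⟨0, 0, ?_, fun d F w hF hw => ?_⟩
    · rw [map_zero, zero_mul]
      ext β
      have : coeff β g ∈ RingHom.ker ψ := by
        apply h
        rw [RingHom.mem_ker, ← coeff_map, h0, coeff_zero]
      rw [coeff_map, coeff_zero]
      exact this
    · have hv := splitValue_eq_of_eq_zero (R := M) (d := d) (v := fun x => eval x (map i F))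
        (fun c x => by
          simpa using eval_smul_of_isHomogeneous (hF.map i) c x)
        (y := y) (m := Finset.univ.val.map x) (by
          rw [Multiset.map_map, ← h0, hg]; rfl)
      have h1 : i w = i (0 ^ d * eval 0 F ^ D) := by
        rw [hw]
        have h2 : eval (0 : σ → M) (map i F) = i (eval 0 F) := eval_zero_map i F
        rw [splitValue, Multiset.map_map] at hv
        simp only [Algebra.algebraMap_self, RingHom.id_apply, Multiset.card_map,
          Finset.card_val, Finset.card_univ, Fintype.card_fin, h2] at hv
        rw [map_mul, map_pow, map_pow, map_zero]
        exact hv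
      have h3 : w - 0 ^ d * eval 0 F ^ D ∈ RingHom.ker ψ := by
        apply h
        rw [RingHom.mem_ker, map_sub, h1, sub_self]
      rw [RingHom.mem_ker, map_sub, sub_eq_zero] at h3
      have h2 : eval (fun _ : σ => (0 : K)) (map ψ F) = ψ (eval 0 F) := eval_zero_map ψ F
      simp [h3]
  -- Normalized over a dominating valuation ring, the splitting reduces to the residue field. The
  -- residue field and `K` both contain the fraction field of `S / ker ψ`, over which the
  -- coordinates are then specialized.
  · obtain ⟨V, hV, hres⟩ := exists_valuationSubring_dominating i ψ h
    let iV : S →+* V := i.codRestrict V hV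
    have hiV : V.subtype.comp iV = i := rfl
    have hmap : ∀ p : MvPolynomial σ S, map V.subtype (map iV p) = map i p := fun p => by
      rw [map_map, hiV]
    obtain ⟨y₁, x₁, c, hxc, hy₁, hg₁⟩ := exists_integral_splitting V
      (g := map iV g) (by rw [hmap, hg]) (by rwa [hmap])
    let κ := IsLocalRing.ResidueField V
    let r : S →+* κ := (IsLocalRing.residue V).comp iV
    have hrker : RingHom.ker r = RingHom.ker ψ := by
      ext s
      exact hres s
    let Q := S ⧸ RingHom.ker ψ
    let F₀ := FractionRing Q
    have hψ : (RingHom.ker ψ).IsPrime := RingHom.ker_isPrime ψ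
    let qK : Q →+* K := Ideal.Quotient.lift _ ψ fun a ha => ha
    have hqK : Function.Injective qK := RingHom.kerLift_injective ψ
    let qκ : Q →+* κ := Ideal.Quotient.lift _ r fun a ha => by
      rw [← hrker] at ha; exact ha
    have hqκ : Function.Injective qκ := by
      rw [injective_iff_map_eq_zero]
      intro a ha
      obtain ⟨a, rfl⟩ := Ideal.Quotient.mk_surjective a
      have ha : r a = 0 := ha
      rw [Ideal.Quotient.eq_zero_iff_mem, ← hrker]
      exact ha
    let _ : Algebra F₀ K := (IsFractionRing.lift hqK).toAlgebra
    let _ : Algebra F₀ κ := (IsFractionRing.lift hqκ).toAlgebra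
    let j : S →+* F₀ := (algebraMap Q F₀).comp (Ideal.Quotient.mk _)
    have hjK : ∀ s, algebraMap F₀ K (j s) = ψ s := fun s =>
      IsFractionRing.lift_algebraMap hqK _
    have hjκ : ∀ s, algebraMap F₀ κ (j s) = r s := fun s =>
      IsFractionRing.lift_algebraMap hqκ _
    let I := Option (Fin D × σ)
    let val : I → κ := fun o => o.elim (IsLocalRing.residue V y₁)
      fun p => IsLocalRing.residue V (x₁ p.1 p.2)
    obtain ⟨t, ht⟩ := exists_specialization F₀ K val
    -- the generic splitting
    let 𝔾 : MvPolynomial σ (MvPolynomial I F₀) :=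
      C (X none : MvPolynomial I F₀) *
        ∏ t : Fin D, lin (fun a => (X (some (t, a)) : MvPolynomial I F₀))
    refine ⟨t none, fun u a => t (some (u, a)), ?_, ?_⟩
    · have h𝔾K : map (aeval t : MvPolynomial I F₀ →ₐ[F₀] K).toRingHom 𝔾 =
          C (t none) * ∏ u : Fin D, lin (fun a => t (some (u, a))) := by
        simp [𝔾, map_prod]
      have h𝔾κ : map (aeval val : MvPolynomial I F₀ →ₐ[F₀] κ).toRingHom 𝔾 =
          C (val none) * ∏ u : Fin D, lin (fun a => val (some (u, a))) := by
        simp [𝔾, map_prod]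
      rw [← h𝔾K]
      ext β
      have h1 : aeval val (C (j (coeff β g)) - coeff β 𝔾) = 0 := by
        have h2 := congrArg (map (IsLocalRing.residue V)) hg₁
        rw [map_map] at h2
        have h3 : map r g = map (aeval val : MvPolynomial I F₀ →ₐ[F₀] κ).toRingHom 𝔾 := by
          rw [h𝔾κ]
          refine h2.trans ?_
          simp [map_prod, val]
        rw [map_sub, aeval_C, hjκ, sub_eq_zero]
        have h4 := congrArg (coeff β) h3
        rw [coeff_map, coeff_map] at h4
        exact h4
      have h2 := ht _ h1
      rw [map_sub, aeval_C, hjK, sub_eq_zero] at h2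
      rw [coeff_map, coeff_map]
      exact h2
    · intro d F w hF hw
      -- The value formula is a polynomial relation over `F₀` between the coordinates of the
      -- splitting, so it survives the specialization.
      let P : MvPolynomial I F₀ := C (j w) - X none ^ d *
        ∏ u : Fin D, eval₂ (C.comp j) (fun a => X (some (u, a))) F
      have hP : aeval val P = 0 := by
        have h1 : iV w = y₁ ^ d * ∏ u, eval (x₁ u) (map iV F) := by
          apply V.subtype_injective
          change i w = _
          have h2 : ∀ u, eval (x u) (map i F) = c u ^ d * V.subtype (eval (x₁ u) (map iV F)) := by
            intro u
            have : x u = c u • fun a => V.subtype (x₁ u a) := funext fun a => hxc u a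
            rw [this, eval_smul_of_isHomogeneous (hF.map i), ← hmap, eval_map_apply]
          rw [hw, Finset.prod_congr rfl fun u _ => h2 u, Finset.prod_mul_distrib,
            Finset.prod_pow]
          simp only [map_mul, map_pow, map_prod]
          change _ = (y₁ : M) ^ d * _
          rw [hy₁]
          ring
        have h2 := congrArg (IsLocalRing.residue V) h1
        simp only [P, map_sub, map_mul, map_pow, map_prod, aeval_C, aeval_X, hjκ] at h2 ⊢
        rw [sub_eq_zero]
        refine h2.trans ?_
        congr 1
        refine Finset.prod_congr rfl fun u _ => ?_
        rw [eval_map, eval₂_comp_left, ← AlgHom.coe_toRingHom, eval₂_comp_left]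
        congr 1
        · ext s
          simp [hjκ, r]
        · funext a
          simp [val]
      have h2 := ht _ hP
      simp only [P, map_sub, map_mul, map_pow, map_prod, aeval_C, aeval_X, hjK,
        sub_eq_zero] at h2
      rw [h2]
      congr 1
      refine Finset.prod_congr rfl fun u _ => ?_
      rw [eval_map, ← AlgHom.coe_toRingHom, eval₂_comp_left]
      congr 1
      · ext s
        simp [hjK]
      · funext a
        simp

end Specialization

/-! ### Splittable polynomials and generic wedges -/

section Splittable

lemma prod_fin_lin {σ : Type*} [Fintype σ] {A : Type*} [CommRing A] {D : ℕ} (x : Fin D → σ → A) :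
    ∏ t, lin (x t) = ((Finset.univ.val.map x).map lin).prod := by
  rw [Multiset.map_map]; rfl

lemma exists_fin_map_eq {α : Type*} (m : Multiset α) :
    ∃ x : Fin (Multiset.card m) → α, Finset.univ.val.map x = m := by
  obtain ⟨l, rfl⟩ : ∃ l : List α, (l : Multiset α) = m := Quot.exists_rep m
  have h : Finset.univ.val.map l.get = (l : Multiset α) := by
    rw [Fin.univ_val_map, List.ofFn_get]
  exact ⟨l.get, h⟩

lemma exists_fin_map_eq' {α : Type*} {m : Multiset α} {D : ℕ} (h : Multiset.card m = D) :
    ∃ x : Fin D → α, Finset.univ.val.map x = m := by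
  subst h
  exact exists_fin_map_eq m

variable {n : ℕ}

/-- The Veronese map: all monomials of degree `d`. -/
def vero {A : Type*} [CommRing A] (d : ℕ) (x : Fin (n + 1) → A) : Expo n d → A :=
  fun α => ∏ a, x a ^ α.1 a

lemma expo_sum {d : ℕ} (α : Expo n d) : ∑ a, α.1 a = d :=
  (Finset.mem_finsuppAntidiag.1 α.2).1

lemma vero_smul {A : Type*} [CommRing A] (d : ℕ) (c : A) (x : Fin (n + 1) → A) :
    vero d (c • x) = c ^ d • vero d x := by
  funext α
  simp [vero, mul_pow, Finset.prod_mul_distrib, Finset.prod_pow_eq_pow_sum, expo_sum]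

lemma map_vero {A B : Type*} [CommRing A] [CommRing B] (φ : A →+* B) (d : ℕ)
    (x : Fin (n + 1) → A) : vero d (fun a => φ (x a)) = fun α => φ (vero d x α) := by
  funext α
  simp [vero]

/-- The exponent `d` at the coordinate `s`. -/
def expoSingle (d : ℕ) (s : Fin (n + 1)) : Expo n d :=
  ⟨Finsupp.single s d, by simp [Finset.mem_finsuppAntidiag]⟩

lemma vero_expoSingle {A : Type*} [CommRing A] (d : ℕ) (s : Fin (n + 1)) (x : Fin (n + 1) → A) :
    vero d x (expoSingle d s) = x s ^ d := by
  rw [vero, Finset.prod_eq_single s]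
  · simp [expoSingle]
  · intro b _ hb
    simp [expoSingle, hb.symm]
  · simp

lemma mem_expo_of_isHomogeneous {A : Type*} [CommRing A] {d : ℕ}
    {p : MvPolynomial (Fin (n + 1)) A} (hp : p.IsHomogeneous d) {β : Fin (n + 1) →₀ ℕ}
    (hβ : coeff β p ≠ 0) : β ∈ (Finset.univ : Finset (Fin (n + 1))).finsuppAntidiag d := by
  rw [Finset.mem_finsuppAntidiag]
  refine ⟨?_, Finset.subset_univ _⟩
  have h := hp hβ
  change Finsupp.weight (fun _ => 1) β = d at h
  rw [← Finsupp.degree_eq_weight_one, Finsupp.degree_eq_sum] at h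
  exact h

lemma genericForm_isHomogeneous (A : Type*) [CommRing A] (n d : ℕ) :
    (genericForm A n d).IsHomogeneous d :=
  IsHomogeneous.sum _ _ _ fun α _ => isHomogeneous_monomial _ (by
    rw [Finsupp.degree_eq_sum]; exact expo_sum α)

/-- Every form is a specialization of the generic form. -/
lemma map_genericForm {A B : Type*} [CommRing A] [CommRing B] {d : ℕ}
    (φ : MvPolynomial (Expo n d) A →+* B) {p : MvPolynomial (Fin (n + 1)) B}
    (hp : p.IsHomogeneous d) (h : ∀ α, φ (X α) = coeff α.1 p) :
    map φ (genericForm A n d) = p := by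
  classical
  ext β
  rw [genericForm, map_sum, coeff_sum]
  simp only [map_monomial, coeff_monomial, h]
  by_cases hβ : coeff β p = 0
  · rw [hβ]
    refine Finset.sum_eq_zero fun α _ => ?_
    split_ifs with hα
    · rw [hα, hβ]
    · rfl
  · rw [Finset.sum_eq_single ⟨β, mem_expo_of_isHomogeneous hp hβ⟩]
    · simp
    · intro α _ hα
      rw [if_neg]
      rintro rfl
      exact hα rfl
    · simp

lemma eval_map_genericForm {A B : Type*} [CommRing A] [CommRing B] {d : ℕ}
    (φ : MvPolynomial (Expo n d) A →+* B) (x : Fin (n + 1) → B) :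
    eval x (map φ (genericForm A n d)) = ∑ α, vero d x α * φ (X α) := by
  rw [genericForm, map_sum, map_sum]
  refine Finset.sum_congr rfl fun α _ => ?_
  rw [map_monomial, eval_monomial, mul_comm, vero, Finsupp.prod_fintype _ _ (by simp)]

/-- The value of a form of degree `d`, as the value of a linear form at its coefficients. -/
lemma eval_eq_sum_vero {B : Type*} [CommRing B] {d : ℕ} {p : MvPolynomial (Fin (n + 1)) B}
    (hp : p.IsHomogeneous d) (x : Fin (n + 1) → B) :
    eval x p = ∑ α : Expo n d, vero d x α * coeff α.1 p := by
  have h := map_genericForm (A := B) (aeval fun α : Expo n d => coeff α.1 p).toRingHom hp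
    (fun α => by simp)
  conv_lhs => rw [← h]
  rw [eval_map_genericForm]
  simp

lemma splitGeneric_eq (n D : ℕ) : splitGeneric n D =
    ∏ t : Fin D, lin (fun a => (X (t, a) : MvPolynomial (Fin D × Fin (n + 1)) ℤ)) := rfl

lemma prod_fin_lin_isHomogeneous {σ : Type*} [Fintype σ] {A : Type*} [CommRing A] {D : ℕ}
    (x : Fin D → σ → A) : (∏ t, lin (x t)).IsHomogeneous D := by
  have h := IsHomogeneous.prod Finset.univ (fun t => lin (x t)) (fun _ => 1)
    fun t _ => lin_isHomogeneous (x t)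
  simpa using h

/-- Over an algebraically closed field, splittable polynomials split. -/
theorem IsSplittable.exists_splitting {A : Type*} [CommRing A] {D : ℕ}
    {g : MvPolynomial (Fin (n + 1)) A} (hg : IsSplittable D g) {K : Type*} [Field K]
    [IsAlgClosed K] (ψ : A →+* K) :
    ∃ (y : K) (x : Fin D → Fin (n + 1) → K), map ψ g = C y * ∏ t, lin (x t) := by
  rcases Nat.eq_zero_or_pos D with rfl | hD
  · have h := hg.1.totalDegree_le
    rw [Nat.le_zero, totalDegree_eq_zero_iff_eq_C] at h
    exact ⟨ψ (coeff 0 g), fun t => t.elim0, by rw [h]; simp⟩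
  -- Indeterminate coefficients go to the `σ_α` on one side and to the coefficients of `g` on the
  -- other. Splittability says that the kernels are nested, and `G_D` splits by definition.
  · let i : MvPolynomial (Expo n D) ℤ →+* FractionRing (MvPolynomial (Fin D × Fin (n + 1)) ℤ) :=
      (algebraMap _ _).comp (aeval (R := ℤ) (elemSymm n D)).toRingHom
    let ψ' : MvPolynomial (Expo n D) ℤ →+* K :=
      ψ.comp (aeval (R := ℤ) fun α : Expo n D => coeff α.1 g).toRingHom
    have hi : map (aeval (R := ℤ) (elemSymm n D)).toRingHom (genericForm ℤ n D) = splitGeneric n D :=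
      map_genericForm _ (prod_fin_lin_isHomogeneous _) fun α => by simp [elemSymm]
    obtain ⟨y, x, h, -⟩ := exists_splitting_specialization i ψ' (by
      intro P hP
      rw [RingHom.mem_ker] at hP ⊢
      have h1 : aeval (elemSymm n D) P = 0 :=
        (IsFractionRing.injective (MvPolynomial (Fin D × Fin (n + 1)) ℤ)
          (FractionRing (MvPolynomial (Fin D × Fin (n + 1)) ℤ))) (by rw [map_zero]; exact hP)
      have h2 := hg.2 hD P h1
      change ψ (aeval (fun α : Expo n D => coeff α.1 g) P) = 0
      rw [h2, map_zero])
      (g := genericForm ℤ n D) (D := D) (y := 1)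
      (x := fun t a => algebraMap _ _ (X (t, a) : MvPolynomial (Fin D × Fin (n + 1)) ℤ)) (by
        rw [← map_map, hi, splitGeneric_eq, map_prod]
        simp)
    refine ⟨y, x, ?_⟩
    rw [← h, ← map_map, map_genericForm _ hg.1 fun α => by simp]

/-- A polynomial over a subring of a field that splits over the field is splittable. -/
theorem isSplittable_of_splitting {A : Type*} [CommRing A] {M : Type*} [Field M] {i : A →+* M}
    (hi : Function.Injective i) {D : ℕ} {g : MvPolynomial (Fin (n + 1)) A} {y : M}
    {x : Fin D → Fin (n + 1) → M} (h : map i g = C y * ∏ t, lin (x t)) : IsSplittable D g := by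
  have hhom : g.IsHomogeneous D := by
    refine IsHomogeneous.of_map hi ?_
    rw [h]
    simpa using (isHomogeneous_C _ y).mul (prod_fin_lin_isHomogeneous x)
  refine ⟨hhom, fun hD P hP => ?_⟩
  -- The constant is absorbed into one of the factors, which requires `0 < D`.
  let t₀ : Fin D := ⟨0, hD⟩
  let x' : Fin D → Fin (n + 1) → M := fun t => (if t = t₀ then y else 1) • x t
  let φ : MvPolynomial (Fin D × Fin (n + 1)) ℤ →+* M := (aeval (R := ℤ) fun p => x' p.1 p.2).toRingHom
  have h1 : map φ (splitGeneric n D) = map i g := by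
    rw [splitGeneric_eq, map_prod, h]
    have h2 : ∀ t, map φ (lin (fun a => (X (t, a) : MvPolynomial (Fin D × Fin (n + 1)) ℤ))) =
        C (if t = t₀ then y else 1) * lin (x t) := fun t => by
      rw [← lin_smul, map_lin]
      simp [φ, x']
    rw [Finset.prod_congr rfl fun t _ => h2 t, Finset.prod_mul_distrib, ← map_prod]
    simp
  apply hi
  rw [map_zero, ← map_zero φ, ← hP]
  have h2 : (i.comp (aeval (R := ℤ) fun α : Expo n D => coeff α.1 g).toRingHom) =
      φ.comp (aeval (R := ℤ) (elemSymm n D)).toRingHom := by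
    refine ringHom_ext (fun a => by simp) fun α => ?_
    have := congrArg (coeff α.1) h1
    rw [coeff_map, coeff_map] at this
    simpa [elemSymm] using this.symm
  exact DFunLike.congr_fun h2 P

lemma IsSplittable.map {A B : Type*} [CommRing A] [CommRing B] {D : ℕ}
    {g : MvPolynomial (Fin (n + 1)) A} (hg : IsSplittable D g) (φ : A →+* B) :
    IsSplittable D (MvPolynomial.map φ g) := by
  refine ⟨hg.1.map φ, fun hD P hP => ?_⟩
  have h := congrArg φ (hg.2 hD P hP)
  rw [map_zero] at h
  rw [← h]
  have h2 : (aeval (R := ℤ) fun α : Expo n D => coeff α.1 (MvPolynomial.map φ g)).toRingHom =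
      φ.comp (aeval (R := ℤ) fun α : Expo n D => coeff α.1 g).toRingHom :=
    ringHom_ext (fun a => by simp) fun α => by simp [MvPolynomial.coeff_map]
  exact DFunLike.congr_fun h2 P

/-- `lin ∘ vero d` is homogeneous of degree `d`. -/
lemma lin_vero_smul {K : Type*} [Field K] (d : ℕ) (c : K) (x : Fin (n + 1) → K) :
    lin (vero d (c • x)) = algebraMap K (MvPolynomial (Expo n d) K) (c ^ d) * lin (vero d x) := by
  rw [vero_smul, lin_smul, algebraMap_eq]

lemma lin_vero_unique {K : Type*} [Field K] {d : ℕ} {y y' : K}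
    {m m' : Multiset (Fin (n + 1) → K)} (hcard : Multiset.card m = Multiset.card m')
    (h : C y * (m.map lin).prod = C y' * (m'.map lin).prod) :
    C (y ^ d) * (m.map fun x => lin (vero d x)).prod =
      C (y' ^ d) * (m'.map fun x => lin (vero d x)).prod :=
  splitValue_unique (R := MvPolynomial (Expo n d) K) (v := fun x => lin (vero d x))
    (lin_vero_smul d) hcard h

lemma eval_vero_unique {K : Type*} [Field K] {d D : ℕ} {y y' : K}
    {x x' : Fin D → Fin (n + 1) → K} (h : C y * ∏ t, lin (x t) = C y' * ∏ t, lin (x' t))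
    {f : MvPolynomial (Fin (n + 1)) K} (hf : f.IsHomogeneous d) :
    y ^ d * ∏ t, eval (x t) f = y' ^ d * ∏ t, eval (x' t) f := by
  rw [prod_fin_lin, prod_fin_lin] at h
  have := splitValue_unique (R := K) (d := d) (v := fun x => eval x f)
    (fun c x => by simpa using eval_smul_of_isHomogeneous hf c x) (by simp) h
  simp only [splitValue, Multiset.map_map] at this
  exact this

/-- `w`, a polynomial in the coefficients of a generic form of degree `d`, is its wedge with `g`. -/
def IsGenWedge {A M : Type*} [CommRing A] [Field M] (i : A →+* M) (d D : ℕ)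
    (g : MvPolynomial (Fin (n + 1)) A) (w : MvPolynomial (Expo n d) A) : Prop :=
  ∃ (y : M) (m : Multiset (Fin (n + 1) → M)), Multiset.card m = D ∧
    map i g = C y * (m.map lin).prod ∧
    map i w = C (y ^ d) * (m.map fun x => lin (vero d x)).prod

/-- The specialization theorem is applied over `A[T]`, where `w` is the wedge of `g` with the
generic form, and `T` is sent to arbitrary values `τ`. Equality at all `τ` suffices over an infinite
field. -/
lemma IsGenWedge.specialize_aux {A M : Type*} [CommRing A] [Field M] {i : A →+* M}
    (hi : Function.Injective i) {d D : ℕ} {g : MvPolynomial (Fin (n + 1)) A}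
    {w : MvPolynomial (Expo n d) A} {y₀ : M} {x₀ : Fin D → Fin (n + 1) → M}
    (hg : map i g = C y₀ * ∏ t, lin (x₀ t))
    (hw : map i w = C (y₀ ^ d) * ∏ t, lin (vero d (x₀ t))) {M' : Type*} [Field M']
    {j : MvPolynomial (Expo n d) M →+* M'} (hj : Function.Injective j) {K : Type*} [Field K]
    [IsAlgClosed K] (ψ : A →+* K) {y : K} {x : Fin D → Fin (n + 1) → K}
    (hψ : map ψ g = C y * ∏ t, lin (x t)) (τ : Expo n d → K) :
    eval τ (map ψ w) = eval τ (C (y ^ d) * ∏ t, lin (vero d (x t))) := by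
  obtain ⟨i', hi'⟩ : ∃ i' : MvPolynomial (Expo n d) A →+* M', i' = j.comp (map i) := ⟨_, rfl⟩
  have hii : Function.Injective i' := hi' ▸ hj.comp (map_injective i hi)
  obtain ⟨ψ', hψ'⟩ : ∃ ψ' : MvPolynomial (Expo n d) A →+* K, ψ' = eval₂Hom ψ τ := ⟨_, rfl⟩
  have hC : i'.comp C = (j.comp C).comp i := by ext a; simp [hi']
  have hC' : ψ'.comp C = ψ := by ext a; simp [hψ']
  have hg' : map i' (map C g) = C (j (C y₀)) * ∏ t, lin (fun a => j (C (x₀ t a))) := by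
    rw [map_map, hC, ← map_map, hg]
    simp [map_prod]
  have hker : RingHom.ker i' ≤ RingHom.ker ψ' := by
    rw [(RingHom.injective_iff_ker_eq_bot i').1 hii]; exact bot_le
  obtain ⟨y', x', h1, h2⟩ := exists_splitting_specialization i' ψ' hker hg'
  have hw' : i' w = j (C y₀) ^ d *
      ∏ t, eval (fun a => j (C (x₀ t a))) (map i' (genericForm A n d)) := by
    rw [hi', RingHom.comp_apply, hw, map_mul, map_prod, map_pow C, map_pow j]
    refine congrArg _ (Finset.prod_congr rfl fun t _ => ?_)
    rw [eval_map_genericForm]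
    have := map_vero (j.comp C) d (x₀ t)
    simp only [RingHom.comp_apply] at this
    simp [this, lin]
  have h3 := h2 d (genericForm A n d) w (genericForm_isHomogeneous A n d) hw'
  rw [map_map, hC', hψ] at h1
  have h4 := eval_vero_unique h1 ((genericForm_isHomogeneous A n d).map ψ')
  have h5 : eval τ (map ψ w) = ψ' w := by rw [eval_map, hψ']; rfl
  rw [h5, h3, ← h4, map_mul, map_prod, eval_C]
  refine congrArg _ (Finset.prod_congr rfl fun t _ => ?_)
  rw [eval_map_genericForm, eval_lin]
  simp [hψ']

/-- The wedge with a generic form specializes. -/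
theorem IsGenWedge.specialize {A M : Type*} [CommRing A] [Field M] {i : A →+* M}
    (hi : Function.Injective i) {d D : ℕ} {g : MvPolynomial (Fin (n + 1)) A}
    {w : MvPolynomial (Expo n d) A} (h : IsGenWedge i d D g w) {K : Type*} [Field K]
    [IsAlgClosed K] (ψ : A →+* K) {y : K} {x : Fin D → Fin (n + 1) → K}
    (hψ : map ψ g = C y * ∏ t, lin (x t)) :
    map ψ w = C (y ^ d) * ∏ t, lin (vero d (x t)) := by
  obtain ⟨y₀, m, hm, hg, hw⟩ := h
  obtain ⟨x₀, rfl⟩ := exists_fin_map_eq' hm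
  have hK : Infinite K := inferInstance
  rw [← prod_fin_lin] at hg
  rw [Multiset.map_map] at hw
  exact MvPolynomial.funext fun τ => IsGenWedge.specialize_aux hi hg hw
    (IsFractionRing.injective (MvPolynomial (Expo n d) M)
      (FractionRing (MvPolynomial (Expo n d) M))) ψ hψ τ

lemma eval₂_coeff_of_map_eq {A : Type*} [CommRing A] {K : Type*} [Field K] {d D : ℕ}
    {w : MvPolynomial (Expo n d) A} (ψ : A →+* K) {y : K} {x : Fin D → Fin (n + 1) → K}
    (hψ : map ψ w = C (y ^ d) * ∏ t, lin (vero d (x t))) {f : MvPolynomial (Fin (n + 1)) K}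
    (hf : f.IsHomogeneous d) :
    eval₂ ψ (fun α : Expo n d => coeff α.1 f) w = y ^ d * ∏ t, eval (x t) f := by
  have h1 : ∀ t, eval (x t) f = eval (fun α : Expo n d => coeff α.1 f) (lin (vero d (x t))) :=
    fun t => by rw [eval_eq_sum_vero hf, eval_lin]
  simp only [h1]
  rw [← eval_C (f := fun α : Expo n d => coeff α.1 f) (y ^ d), ← map_prod, ← map_mul, ← hψ,
    eval_map]

/-- The wedge with any form is a specialization of the wedge with the generic form. -/
theorem IsGenWedge.value {A M : Type*} [CommRing A] [Field M] {i : A →+* M}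
    (hi : Function.Injective i) {d D : ℕ} {g : MvPolynomial (Fin (n + 1)) A}
    {w : MvPolynomial (Expo n d) A} (h : IsGenWedge i d D g w) {K : Type*} [Field K]
    [IsAlgClosed K] (ψ : A →+* K) {y : K} {x : Fin D → Fin (n + 1) → K}
    (hψ : map ψ g = C y * ∏ t, lin (x t)) {f : MvPolynomial (Fin (n + 1)) K}
    (hf : f.IsHomogeneous d) :
    eval₂ ψ (fun α : Expo n d => coeff α.1 f) w = y ^ d * ∏ t, eval (x t) f :=
  eval₂_coeff_of_map_eq ψ (IsGenWedge.specialize hi h ψ hψ) hf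

end Splittable

/-! ### Existence of generic wedges -/

section Existence

/-- Divisibility of polynomials descends along field extensions. -/
lemma dvd_of_map_dvd {σ : Type*} {K M : Type*} [Field K] [Field M] (φ : K →+* M)
    {a b : MvPolynomial σ K} (h : map φ b ∣ map φ a) : b ∣ a := by
  classical
  let _ := φ.toAlgebra
  obtain ⟨c, hc⟩ := h
  -- A `K`-linear retraction of `M` onto `K`, applied to the coefficients of the quotient, gives a
  -- quotient over `K`.
  obtain ⟨ρ, hρ⟩ := (Algebra.linearMap K M).exists_leftInverse_of_injective
    (LinearMap.ker_eq_bot.2 φ.injective)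
  have hρ' : ∀ z : K, ρ (φ z) = z := fun z => LinearMap.congr_fun hρ z
  have hρm : ∀ (z : K) (m : M), ρ (φ z * m) = z * ρ m := fun z m => by
    rw [← smul_eq_mul z, ← map_smul, Algebra.smul_def]; rfl
  refine ⟨∑ β ∈ c.support, monomial β (ρ (coeff β c)), ?_⟩
  have hcoef : ∀ γ, coeff γ (∑ β ∈ c.support, monomial β (ρ (coeff β c))) = ρ (coeff γ c) := by
    intro γ
    simp only [coeff_sum, coeff_monomial, Finset.sum_ite_eq', mem_support_iff]
    split_ifs with h
    · rfl
    · rw [not_not.1 h, map_zero]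
  ext γ
  rw [coeff_mul]
  simp only [hcoef, ← hρm]
  rw [← map_sum, ← hρ' (coeff γ a), ← coeff_map, hc, coeff_mul]
  simp [coeff_map]

lemma lin_pow_expChar {σ : Type*} [Fintype σ] {A : Type*} [CommRing A] (p : ℕ) [ExpChar A p] (e : ℕ)
    (x : σ → A) : lin x ^ p ^ e = expand (p ^ e) (lin (fun a => x a ^ p ^ e)) := by
  have : ExpChar (MvPolynomial σ A) p := inferInstance
  rw [lin, lin, sum_pow_char_pow, map_sum]
  refine Finset.sum_congr rfl fun a _ => ?_
  rw [mul_pow, map_mul, expand_C, expand_X, map_pow]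

lemma mem_range_map_iff_coeff {σ : Type*} {A B : Type*} [CommRing A] [CommRing B] {φ : A →+* B}
    {f : MvPolynomial σ B} : f ∈ (map (σ := σ) φ).range ↔ ∀ β, coeff β f ∈ φ.range := by
  change f ∈ Set.range (map φ) ↔ _
  rw [mem_range_map_iff_coeffs_subset]
  constructor
  · intro h β
    by_cases h0 : coeff β f = 0
    · rw [h0]; exact zero_mem _
    · exact h (coeff_mem_coeffs β h0)
  · rintro h z hz
    obtain ⟨β, -, rfl⟩ := mem_coeffs_iff.1 hz
    exact h β

lemma eval_pderiv_lin_pow {σ : Type*} [Fintype σ] [DecidableEq σ] {A : Type*} [CommRing A]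
    {y : σ → A} {s : σ} (hs : y s = 1) (a : σ) (b : ℕ) :
    eval (Pi.single s 1) (pderiv a (lin y ^ b)) = b * y a := by
  have h : eval (Pi.single s 1) (lin y) = 1 := by
    rw [eval_lin, Finset.sum_eq_single s] <;> simp +contextual [hs]
  have h2 : pderiv a (lin y) = C (y a) := by
    rw [lin, map_sum, Finset.sum_eq_single a]
    · rw [pderiv_C_mul, pderiv_X_self, mul_one]
    · intro c _ hc
      rw [pderiv_C_mul, pderiv_X_of_ne hc, mul_zero]
    · simp
  rw [pderiv_pow, h2]
  simp [h]

lemma card_eq_of_prod_lin_eq {σ : Type*} [Fintype σ] {K : Type*} [Field K] {y y' : K}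
    {m m' : Multiset (σ → K)} (h : C y * (m.map lin).prod = C y' * (m'.map lin).prod)
    (h0 : C y * (m.map lin).prod ≠ 0) : Multiset.card m = Multiset.card m' := by
  have h1 := (isHomogeneous_C σ y).mul (prod_lin_isHomogeneous m)
  have h2 := (isHomogeneous_C σ y').mul (prod_lin_isHomogeneous m')
  rw [← h] at h2
  simpa using h1.inj_right h2 h0

variable {n : ℕ} {K Ω : Type*} [Field K] [Field Ω] [Algebra K Ω]

/-- With `y a = x a ^ p ^ e`, the polynomial is `lin y ^ b` in the variables `X ^ p ^ e`. The
derivative of `lin y ^ b` in the direction `a`, at the unit vector of `s`, is `b * y a`, and `b` is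
invertible. -/
lemma exists_pow_mem_of_lin_pow (p : ℕ) [ExpChar Ω p] {x : Fin (n + 1) → Ω} {s : Fin (n + 1)}
    (hs : x s = 1) {e b : ℕ} (hb : (b : Ω) ≠ 0)
    (hP : lin x ^ (p ^ e * b) ∈ (map (σ := Fin (n + 1)) (algebraMap K Ω)).range)
    (a : Fin (n + 1)) : x a ^ p ^ e ∈ (algebraMap K Ω).range := by
  have hp : p ^ e ≠ 0 := pow_ne_zero _ (expChar_pos Ω p).ne'
  rw [pow_mul, lin_pow_expChar p, ← map_pow, mem_range_map_iff_coeff] at hP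
  obtain ⟨Q, hQ⟩ := mem_range_map_iff_coeff.2 fun β => by
    have := hP (p ^ e • β)
    rwa [coeff_expand_smul _ hp] at this
  have h := eval_pderiv_lin_pow (y := fun a => x a ^ p ^ e) (s := s) (by simp [hs]) a b
  rw [← hQ] at h
  have h1 : eval (Pi.single s 1) (pderiv a (map (algebraMap K Ω) Q)) =
      algebraMap K Ω (eval (Pi.single s 1) (pderiv a Q)) := by
    rw [pderiv_map, ← eval_map_apply]
    congr 2
    funext c
    simp [Pi.single_apply, apply_ite (algebraMap K Ω)]
  have hb' : (b : K) ≠ 0 := fun h => hb (by rw [← map_natCast (algebraMap K Ω), h, map_zero])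
  refine ⟨(b : K)⁻¹ * eval (Pi.single s 1) (pderiv a Q), ?_⟩
  rw [map_mul, ← h1, h, map_inv₀, map_natCast, inv_mul_cancel_left₀ hb]

lemma lin_pow_mem_range {σ : Type*} [Fintype σ] (p : ℕ) [ExpChar Ω p] {x : σ → Ω} {e b : ℕ}
    (h : ∀ a, x a ^ p ^ e ∈ (algebraMap K Ω).range) :
    lin x ^ (p ^ e * b) ∈ (map (σ := σ) (algebraMap K Ω)).range := by
  rw [pow_mul, lin_pow_expChar p]
  refine pow_mem ?_ b
  choose z hz using h
  exact ⟨expand (p ^ e) (lin z), by rw [map_expand, map_lin]; simp only [hz]⟩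

lemma exists_pow_mul_natCast_ne_zero (p : ℕ) [ExpChar Ω p] {j : ℕ} (hj : j ≠ 0) :
    ∃ e b : ℕ, j = p ^ e * b ∧ (b : Ω) ≠ 0 := by
  obtain h | hp := expChar_is_prime_or_one Ω p
  · have := h.ne_one
    obtain ⟨e, b, hb, rfl⟩ := Nat.exists_eq_pow_mul_and_not_dvd hj p h.ne_one
    refine ⟨e, b, rfl, fun h0 => hb ?_⟩
    have : CharP Ω p := by
      cases ‹ExpChar Ω p› with
      | zero => exact absurd rfl h.ne_one
      | prime _ => assumption
    exact (CharP.cast_eq_zero_iff Ω p b).1 h0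
  · subst hp
    have : CharZero Ω := by
      cases ‹ExpChar Ω 1› with
      | zero => assumption
      | prime h => exact absurd h Nat.not_prime_one
    exact ⟨0, j, by simp, Nat.cast_ne_zero.2 hj⟩

/-- Some power of each linear factor is rational, and an irreducible factor `g` of it over `K` is a
constant times `lin x ^ j` and divides the given polynomial. Removing `g` decreases the number of
factors. Its contribution to the wedge is a constant times `lin (vero d x) ^ j`: writing `j = p ^ e'
* b` with `b` invertible, the coordinates of `x` have rational `p ^ e'`-th powers, hence so do the
monomials in them. -/
lemma wedge_mem_range_of_isPurelyInseparable [IsPurelyInseparable K Ω] (d : ℕ) {y : Ω}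
    {m : Multiset (Fin (n + 1) → Ω)} (h0 : C y * (m.map lin).prod ≠ 0)
    (h : C y * (m.map lin).prod ∈ (map (σ := Fin (n + 1)) (algebraMap K Ω)).range) :
    C (y ^ d) * (m.map fun x => lin (vero d x)).prod ∈
      (map (σ := Expo n d) (algebraMap K Ω)).range := by
  obtain ⟨N, hN⟩ : ∃ N, Multiset.card m = N := ⟨_, rfl⟩
  induction N using Nat.strong_induction_on generalizing y m with
  | _ N ih =>
  obtain ⟨p, hp⟩ := ExpChar.exists K
  have hpΩ : ExpChar Ω p := expChar_of_injective_algebraMap (algebraMap K Ω).injective p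
  have hy : y ≠ 0 := by rintro rfl; simp at h0
  have hm0 : ∀ x ∈ m, x ≠ 0 := by
    rintro x hx rfl
    exact h0 (by rw [Multiset.prod_eq_zero (Multiset.mem_map.2 ⟨0, hx, lin_zero⟩), mul_zero])
  rcases Multiset.empty_or_exists_mem m with rfl | ⟨x₀, hx₀⟩
  · obtain ⟨R, hR⟩ := h
    refine ⟨C (coeff 0 R) ^ d, ?_⟩
    have : algebraMap K Ω (coeff 0 R) = y := by
      rw [← coeff_map, hR]; simp
    simp [this]
  obtain ⟨s, hs0, hs⟩ := exists_smul_eq_one (hm0 x₀ hx₀)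
  obtain ⟨x, hx⟩ : ∃ x, x = (x₀ s)⁻¹ • x₀ := ⟨_, rfl⟩
  rw [← hx] at hs
  have hlx : Prime (lin x) := lin_prime_of_eq_one hs
  have hxdvd : lin x ∣ C y * (m.map lin).prod := by
    rw [hx]
    exact ((lin_associated_smul (inv_ne_zero hs0) x₀).dvd).trans
      ((Multiset.dvd_prod (Multiset.mem_map_of_mem _ hx₀)).trans (dvd_mul_left _ _))
  have hq : ∃ e, ∀ a, x a ^ p ^ e ∈ (algebraMap K Ω).range := by
    choose e he using fun a => IsPurelyInseparable.pow_mem K p (x a)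
    refine ⟨∑ a, e a, fun a => ?_⟩
    rw [← Finset.add_sum_erase _ _ (Finset.mem_univ a), pow_add, pow_mul]
    exact pow_mem (he a) _
  obtain ⟨e, he⟩ := hq
  obtain ⟨P, hP⟩ := lin_pow_mem_range p (b := 1) he
  rw [mul_one] at hP
  change map _ _ = _ at hP
  have hpe : p ^ e ≠ 0 := pow_ne_zero _ (expChar_pos Ω p).ne'
  have hPu : ¬ IsUnit P := fun hu => by
    have := hu.map (map (σ := Fin (n + 1)) (algebraMap K Ω))
    rw [hP] at this
    exact hlx.not_isUnit ((isUnit_pow_iff hpe).1 this)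
  have hP0 : P ≠ 0 := by
    rintro rfl
    rw [map_zero] at hP
    exact pow_ne_zero _ hlx.ne_zero hP.symm
  obtain ⟨g, hg, hgP⟩ := WfDvdMonoid.exists_irreducible_factor hPu hP0
  have hgP' := map_dvd (map (σ := Fin (n + 1)) (algebraMap K Ω)) hgP
  rw [hP] at hgP'
  obtain ⟨j, -, hgj⟩ := (dvd_prime_pow hlx _).1 hgP'
  obtain ⟨u, hu⟩ := hgj.symm
  obtain ⟨c, hc, hcu⟩ := (isUnit_iff_eq_C_of_isReduced).1 u.isUnit
  rw [hcu, mul_comm] at hu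
  have hj : j ≠ 0 := by
    rintro rfl
    apply hg.not_isUnit
    have h1 : map (algebraMap K Ω) g ∣ map (algebraMap K Ω) 1 := by
      rw [← hu, map_one, pow_zero, mul_one]; exact (hc.map C).dvd
    exact isUnit_of_dvd_one (dvd_of_map_dvd _ h1)
  obtain ⟨R, hR⟩ := h
  change map _ _ = _ at hR
  have hgR : g ∣ R := by
    refine hg.prime.dvd_of_dvd_pow (n := j) (dvd_of_map_dvd (algebraMap K Ω) ?_)
    rw [map_pow, hR, ← hu]
    rw [(hc.map C).mul_left_dvd]
    exact pow_dvd_pow_of_dvd hxdvd j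
  obtain ⟨R', rfl⟩ := hgR
  rw [map_mul] at hR
  obtain ⟨c', hc', m', -, -, hm'⟩ := exists_eq_prod_lin_of_dvd_C_mul h0 (Dvd.intro_left _ hR)
  have heq : C y * (m.map lin).prod = C (c * c') * ((m' + Multiset.replicate j x).map lin).prod := by
    rw [← hR, hm', ← hu, Multiset.map_add, Multiset.prod_add, Multiset.map_replicate,
      Multiset.prod_replicate, C_mul]
    ring
  have hcard := card_eq_of_prod_lin_eq heq h0
  rw [lin_vero_unique hcard heq]
  have h1 : C (c' ^ d) * (m'.map fun x => lin (vero d x)).prod ∈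
      (map (σ := Expo n d) (algebraMap K Ω)).range := by
    refine ih (Multiset.card m') ?_ ?_ ?_ rfl
    · rw [← hN, hcard, Multiset.card_add, Multiset.card_replicate]
      omega
    · rw [← hm']
      intro hz
      rw [hz, mul_zero] at hR
      exact h0 hR.symm
    · exact ⟨R', hm'⟩
  -- The constant is the value of `g` at the unit vector of `s`, where `lin x` is 1.
  have hcK : c ∈ (algebraMap K Ω).range := by
    refine ⟨eval (Pi.single s 1) g, ?_⟩
    rw [← eval_map_apply, ← hu]
    have : (fun a => algebraMap K Ω ((Pi.single s 1 : Fin (n + 1) → K) a)) = Pi.single s 1 := by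
      funext a
      simp [Pi.single_apply, apply_ite (algebraMap K Ω)]
    rw [this, map_mul, map_pow, eval_lin, Finset.sum_eq_single s] <;> simp +contextual [hs]
  obtain ⟨e', b, hjb, hb⟩ := exists_pow_mul_natCast_ne_zero (Ω := Ω) p hj
  have hlinx : lin x ^ (p ^ e' * b) ∈ (map (σ := Fin (n + 1)) (algebraMap K Ω)).range := by
    obtain ⟨k, hk⟩ := hcK
    refine ⟨C k⁻¹ * g, ?_⟩
    change map _ _ = _
    have hk0 : algebraMap K Ω k ≠ 0 := hk ▸ hc.ne_zero
    rw [map_mul, ← hu, map_C, map_inv₀, ← hk, ← hjb, ← mul_assoc, ← C_mul, inv_mul_cancel₀ hk0,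
      C_1, one_mul]
  have hxK := exists_pow_mem_of_lin_pow p hs hb hlinx
  have hvx : ∀ α, vero d x α ^ p ^ e' ∈ (algebraMap K Ω).range := fun α => by
    rw [vero, ← Finset.prod_pow]
    refine prod_mem fun a _ => ?_
    rw [← pow_mul, mul_comm, pow_mul]
    exact pow_mem (hxK a) _
  have hvl := lin_pow_mem_range p (b := b) hvx
  rw [← hjb] at hvl
  rw [mul_pow, C_mul, Multiset.map_add, Multiset.prod_add, Multiset.map_replicate,
    Multiset.prod_replicate, mul_comm (Multiset.prod _), mul_mul_mul_comm]
  refine mul_mem (mul_mem ?_ hvl) h1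
  obtain ⟨k, hk⟩ := hcK
  exact ⟨C (k ^ d), by simp [hk]⟩

/-- Galois theory in the separable closure, whose automorphisms extend to the normal extension `Ω`.
-/
lemma mem_range_of_fixed_of_isSeparable [IsAlgClosure K Ω] {c : Ω} (hc : IsSeparable K c)
    (h : ∀ τ : Ω ≃ₐ[K] Ω, τ c = c) : c ∈ (algebraMap K Ω).range := by
  have : Normal K Ω := IsAlgClosure.normal K Ω
  obtain ⟨z, hz⟩ : ∃ z : separableClosure K Ω, (z : Ω) = c := ⟨⟨c, mem_separableClosure_iff.2 hc⟩, rfl⟩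
  have h1 : z ∈ (⊥ : IntermediateField K (separableClosure K Ω)) := by
    rw [InfiniteGalois.mem_bot_iff_fixed]
    intro τ
    apply Subtype.ext
    have h2 := AlgEquiv.liftNormal_commutes τ Ω z
    have h3 := h (AlgEquiv.liftNormal τ Ω)
    rw [← hz] at h3
    exact h2.symm.trans h3
  obtain ⟨a, ha⟩ := IntermediateField.mem_bot.1 h1
  refine ⟨a, ?_⟩
  rw [← hz, ← ha]
  rfl

/-- The endomorphism only replaces a splitting by another splitting of the same polynomial, and the
wedge is independent of the splitting. -/
lemma map_wedge_eq_self {d : ℕ} {y : Ω} {m : Multiset (Fin (n + 1) → Ω)} {τ : Ω →+* Ω}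
    (h : map τ (C y * (m.map lin).prod) = C y * (m.map lin).prod) :
    map τ (C (y ^ d) * (m.map fun x => lin (vero d x)).prod) =
      C (y ^ d) * (m.map fun x => lin (vero d x)).prod := by
  have h1 : map τ (C y * (m.map lin).prod) =
      C (τ y) * ((m.map fun x a => τ (x a)).map lin).prod := by
    rw [map_mul, map_C, map_multiset_prod, Multiset.map_map, Multiset.map_map]
    simp only [Function.comp_def, map_lin]
  have h2 : map τ (C (y ^ d) * (m.map fun x => lin (vero d x)).prod) =
      C (τ y ^ d) * ((m.map fun x a => τ (x a)).map fun x => lin (vero d x)).prod := by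
    rw [map_mul, map_C, map_multiset_prod, Multiset.map_map, Multiset.map_map, map_pow]
    simp only [Function.comp_def, map_lin, map_vero]
  rw [h2]
  exact lin_vero_unique (by simp) (h1.symm.trans h)

/-- `Ω` is purely inseparable over the separable closure of `K`, so the coefficients of the wedge
are separable over `K`; and all automorphisms fix them. -/
lemma wedge_mem_range_of_isAlgClosure [IsAlgClosure K Ω] (d : ℕ) {y : Ω}
    {m : Multiset (Fin (n + 1) → Ω)} (h0 : C y * (m.map lin).prod ≠ 0)
    (h : C y * (m.map lin).prod ∈ (map (σ := Fin (n + 1)) (algebraMap K Ω)).range) :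
    C (y ^ d) * (m.map fun x => lin (vero d x)).prod ∈
      (map (σ := Expo n d) (algebraMap K Ω)).range := by
  have : Algebra.IsAlgebraic K Ω := IsAlgClosure.isAlgebraic
  obtain ⟨R, hR⟩ := h
  change map _ _ = _ at hR
  rw [mem_range_map_iff_coeff]
  intro β
  refine mem_range_of_fixed_of_isSeparable ?_ fun τ => ?_
  · have := mem_range_map_iff_coeff.1
      (wedge_mem_range_of_isPurelyInseparable (K := separableClosure K Ω) d h0
        ⟨map (algebraMap K _) R, by
          change map _ _ = _
          rw [map_map, ← IsScalarTower.algebraMap_eq, hR]⟩) β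
    obtain ⟨z, hz⟩ := this
    rw [← hz]
    exact mem_separableClosure_iff.1 z.2
  · have h1 := map_wedge_eq_self (d := d) (τ := (τ : Ω →+* Ω)) (y := y) (m := m) (by
      rw [← hR, map_map]
      congr 1
      congr 1
      ext a
      simp)
    conv_rhs => rw [← h1]
    rw [coeff_map]
    rfl

/-- Over an integrally closed domain, the wedge with a generic form exists. -/
theorem exists_wedge_of_isIntegrallyClosed {A : Type*} [CommRing A] [IsDomain A]
    [IsIntegrallyClosed A] [Algebra A K] [IsFractionRing A K] [Algebra A Ω] [IsScalarTower A K Ω]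
    [IsAlgClosure K Ω] (d : ℕ) {D : ℕ} {g : MvPolynomial (Fin (n + 1)) A} (hg : g ≠ 0) {y : Ω}
    {x : Fin D → Fin (n + 1) → Ω} (h : map (algebraMap A Ω) g = C y * ∏ t, lin (x t)) :
    ∃ w : MvPolynomial (Expo n d) A,
      map (algebraMap A Ω) w = C (y ^ d) * ∏ t, lin (vero d (x t)) := by
  have hinj : Function.Injective (algebraMap A Ω) := by
    rw [IsScalarTower.algebraMap_eq A K Ω]
    exact (algebraMap K Ω).injective.comp (IsFractionRing.injective A K)
  have h0 : map (algebraMap A Ω) g ≠ 0 := fun hz => hg (map_injective _ hinj (by rw [hz, map_zero]))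
  suffices hs : C (y ^ d) * ∏ t, lin (vero d (x t)) ∈
      (map (σ := Expo n d) (algebraMap A Ω)).range from hs
  rw [mem_range_map_iff_coeff]
  intro β
  have hK : coeff β (C (y ^ d) * ∏ t, lin (vero d (x t))) ∈ (algebraMap K Ω).range := by
    have h1 := h
    rw [prod_fin_lin] at h1
    have h2 := wedge_mem_range_of_isAlgClosure (K := K) d (h1 ▸ h0) ⟨map (algebraMap A K) g, by
      change map _ _ = _
      rw [map_map, ← IsScalarTower.algebraMap_eq, h1]⟩
    rw [Multiset.map_map] at h2
    exact mem_range_map_iff_coeff.1 h2 β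
  -- The integral closure is the intersection of the valuation rings that contain the image of `A`.
  -- In each of them the splitting can be normalized, which makes the wedge visibly integral.
  have hint : IsIntegral A (coeff β (C (y ^ d) * ∏ t, lin (vero d (x t)))) := by
    have h3 : coeff β (C (y ^ d) * ∏ t, lin (vero d (x t))) ∈
        (integralClosure (Subring.closure ((algebraMap A Ω).range : Set Ω)) Ω).toSubring := by
      rw [← iInf_valuationSubring_superset, Subring.mem_iInf]
      rintro ⟨V, hV⟩
      let iV : A →+* V := (algebraMap A Ω).codRestrict V.toSubring fun a => hV ⟨a, rfl⟩
      have hmap : map V.subtype (map iV g) = map (algebraMap A Ω) g := by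
        rw [map_map]; rfl
      obtain ⟨y', x', c, hxc, hy', -⟩ := exists_integral_splitting V (hmap.trans h) (hmap ▸ h0)
      have h4 : C (y ^ d) * ∏ t, lin (vero d (x t)) =
          map V.subtype (C (y' ^ d) * ∏ t, lin (vero d (x' t))) := by
        have h5 : ∀ t, lin (vero d (x t)) = C (c t ^ d) * map V.subtype (lin (vero d (x' t))) := by
          intro t
          have : x t = c t • fun a => (x' t a : Ω) := funext fun a => hxc t a
          rw [this, vero_smul, lin_smul, map_lin]
          congr 2
          exact map_vero V.subtype d (x' t)
        rw [Finset.prod_congr rfl fun t _ => h5 t, Finset.prod_mul_distrib, map_mul, map_prod,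
          map_C, ← mul_assoc, ← map_prod C, ← C_mul, Finset.prod_pow, ← mul_pow, ← hy']
        rfl
      rw [h4, coeff_map]
      exact Subtype.mem _
    let S := Subring.closure ((algebraMap A Ω).range : Set Ω)
    let iS : A →+* S := (algebraMap A Ω).codRestrict S fun a => Subring.subset_closure ⟨a, rfl⟩
    let _ : Algebra A S := iS.toAlgebra
    have : IsScalarTower A S Ω := IsScalarTower.of_algebraMap_eq fun _ => rfl
    have : Algebra.IsIntegral A S := Algebra.isIntegral_of_surjective fun ⟨z, hz⟩ => by
      rw [show S = _ from Subring.closure_eq _] at hz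
      obtain ⟨a, ha⟩ := hz
      exact ⟨a, Subtype.ext ha⟩
    exact isIntegral_trans (A := S) _ h3
  obtain ⟨z, hz⟩ := hK
  rw [← hz] at hint ⊢
  obtain ⟨a, ha⟩ := IsIntegrallyClosed.isIntegral_iff.1
    ((isIntegral_algebraMap_iff (algebraMap K Ω).injective).1 hint)
  exact ⟨a, by rw [← ha, ← IsScalarTower.algebraMap_apply]⟩

end Existence

/-! ### Prime ideals of height one and irreducible polynomials with a linear factor -/

section HeightOne

open Polynomial in
/-- A prime ideal of `A[Y]` that meets `A` in zero is generated by any prime element in it. -/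
lemma dvd_of_mem_of_disjoint {A : Type*} [CommRing A] [IsDomain A] [IsIntegrallyClosed A]
    [NormalizedGCDMonoid A]
    {𝔭 : Ideal A[X]} (h𝔭 : ∀ a : A, Polynomial.C a ∈ 𝔭 → a = 0) {W Q : A[X]} (hW : Prime W)
    (hWp : W ∈ 𝔭) (hQ : Q ∈ 𝔭) : W ∣ Q := by
  classical
  let F := FractionRing A
  have hinj : Function.Injective (Polynomial.mapRingHom (algebraMap A F)) :=
    Polynomial.map_injective _ (IsFractionRing.injective A F)
  have hdeg : W.natDegree ≠ 0 := fun h => by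
    rw [Polynomial.natDegree_eq_zero] at h
    obtain ⟨a, rfl⟩ := h
    rw [h𝔭 a hWp, map_zero] at hW
    exact hW.ne_zero rfl
  have hWirr : Irreducible (W.map (algebraMap A F)) :=
    ((hW.irreducible.isPrimitive hdeg).irreducible_iff_irreducible_map_fraction_map).1 hW.irreducible
  have clear : ∀ u : F[X], ∃ a : A, a ≠ 0 ∧ ∃ u' : A[X],
      u'.map (algebraMap A F) = Polynomial.C (algebraMap A F a) * u := fun u => by
    obtain ⟨b, hb, h⟩ := IsLocalization.integerNormalization_spec (nonZeroDivisors A) u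
    exact ⟨b, nonZeroDivisors.ne_zero hb, _, by
      rw [h, ← Polynomial.smul_eq_C_mul, algebraMap_smul]⟩
  -- If `W` divides `Q` over the fraction field, clearing denominators costs a nonzero constant,
  -- which `W` cannot divide. If not, a Bézout relation would put a nonzero constant into `𝔭`.
  by_cases hd : W.map (algebraMap A F) ∣ Q.map (algebraMap A F)
  · obtain ⟨u, hu⟩ := hd
    obtain ⟨a, ha, u', hu'⟩ := clear u
    have h1 : Polynomial.C a * Q = W * u' := hinj (by
      simp only [map_mul, Polynomial.coe_mapRingHom, hu, hu', Polynomial.map_C]; ring)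
    rcases hW.dvd_or_dvd (h1 ▸ Dvd.intro u' rfl) with h2 | h2
    · exact absurd (h𝔭 a (𝔭.mem_of_dvd h2 hWp)) ha
    · exact h2
  · exfalso
    obtain ⟨u, v, huv⟩ := hWirr.coprime_iff_not_dvd.2 hd
    obtain ⟨a, ha, u', hu'⟩ := clear u
    obtain ⟨b, hb, v', hv'⟩ := clear v
    have h1 : Polynomial.C (a * b) = Polynomial.C b * u' * W + Polynomial.C a * v' * Q := hinj (by
      simp only [map_mul, map_add, Polynomial.coe_mapRingHom, hu', hv', Polynomial.map_C]
      rw [← mul_one (Polynomial.C (algebraMap A F a) * _), ← huv]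
      ring)
    have h2 := h𝔭 (a * b) (h1 ▸ 𝔭.add_mem (𝔭.mul_mem_left _ hWp) (𝔭.mul_mem_left _ hQ))
    exact mul_ne_zero ha hb h2

/-- A prime ideal of polynomials over a factorial ring, without nonzero members free of the
variable `s`, is generated by any prime element in it. -/
theorem dvd_of_mem_of_forall_vars {σ B : Type*} [CommRing B] [IsDomain B]
    [UniqueFactorizationMonoid B] {𝔭 : Ideal (MvPolynomial σ B)} (s : σ)
    (h𝔭 : ∀ Q ∈ 𝔭, s ∉ Q.vars → Q = 0) {W Q : MvPolynomial σ B} (hW : Prime W)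
    (hWp : W ∈ 𝔭) (hQ : Q ∈ 𝔭) : W ∣ Q := by
  classical
  let e : MvPolynomial σ B ≃ₐ[B] Polynomial (MvPolynomial {b // b ≠ s} B) :=
    (renameEquiv B (Equiv.optionSubtypeNe s).symm).trans (optionEquivLeft B _)
  have : Nonempty (NormalizedGCDMonoid (MvPolynomial {b // b ≠ s} B)) := inferInstance
  obtain ⟨_⟩ := this
  have he : ∀ q : MvPolynomial {b // b ≠ s} B, e (rename Subtype.val q) = Polynomial.C q := by
    intro q
    have h : (e : MvPolynomial σ B →ₐ[B] Polynomial (MvPolynomial {b // b ≠ s} B)).comp (rename Subtype.val) =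
        (Algebra.ofId (MvPolynomial {b // b ≠ s} B) _).restrictScalars B := by
      apply algHom_ext
      intro b
      have h1 : e (X b.1) = Polynomial.C (X b) := by
        simp only [e, AlgEquiv.trans_apply, renameEquiv_apply, rename_X]
        rw [Equiv.optionSubtypeNe_symm_of_ne b.2, optionEquivLeft_X_some]
      rw [AlgHom.comp_apply, rename_X]
      exact h1
    exact DFunLike.congr_fun h q
  have hd := dvd_of_mem_of_disjoint (𝔭 := 𝔭.comap (e.symm : _ →+* _)) (W := e W) (Q := e Q) (by
      intro a ha
      rw [← he] at ha
      have h1 : rename Subtype.val a ∈ 𝔭 := by simpa [Ideal.mem_comap] using ha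
      have h2 := h𝔭 _ h1 (by
        intro hs
        obtain ⟨b, -, hb⟩ := mem_vars_rename _ _ hs
        exact b.2 hb)
      exact (map_eq_zero_iff _ (rename_injective _ Subtype.val_injective)).1 h2)
    ((MulEquiv.prime_iff e).2 hW) (by simpa [Ideal.mem_comap] using hWp)
    (by simpa [Ideal.mem_comap] using hQ)
  exact (map_dvd_iff e).1 hd

/-- The coefficients after elimination are polynomials over `K` in `t`: divisibility by a linear
form with pivot 1 is an algebraic condition on that form, stable under specialization. -/
lemma elimVar_eq_map_generic {σ : Type*} [Fintype σ] [DecidableEq σ] {K N : Type*} [Field K]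
    [Field N] [Algebra K N] (t : σ → N) (s : σ) (R : MvPolynomial σ K) :
    elimVar s t (map (algebraMap K N) R) =
      map (aeval (R := K) t).toRingHom (elimVar s X (map C R)) := by
  have h1 : (fun a => (aeval (R := K) t).toRingHom (X a)) = t := by funext a; simp
  have h2 : (aeval (R := K) t).toRingHom.comp C = algebraMap K N := by ext a; simp
  rw [← elimVar_map, map_map, h1, h2]

/-- A linear factor over some extension gives one over an algebraically closed field. -/
lemma exists_lin_dvd_of_isAlgClosed {σ : Type*} [Fintype σ] [DecidableEq σ] {K M Ω : Type*}
    [Field K] [Field M]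
    [Field Ω] [IsAlgClosed Ω] [Algebra K M] [Algebra K Ω] {R : MvPolynomial σ K} {x : σ → M}
    {s : σ} (hs : x s = 1) (h : lin x ∣ map (algebraMap K M) R) :
    ∃ z : σ → Ω, z s = 1 ∧ lin z ∣ map (algebraMap K Ω) R := by
  obtain ⟨z, hz⟩ := exists_specialization K Ω x
  have hzs : z s = 1 := by
    have := hz (X s - 1) (by simp [hs])
    simpa [sub_eq_zero] using this
  refine ⟨z, hzs, ?_⟩
  rw [lin_dvd_iff hzs]
  rw [lin_dvd_iff hs, elimVar_eq_map_generic] at h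
  rw [elimVar_eq_map_generic]
  ext β
  rw [coeff_map, coeff_zero]
  refine hz _ ?_
  have := congrArg (coeff β) h
  rwa [coeff_map, coeff_zero] at this

/-- Some product of powers of conjugates of a linear form has coefficients in the ground field. -/
lemma exists_map_eq_prod_lin {σ : Type*} [Fintype σ] {K Ω : Type*} [Field K] [Field Ω]
    [Algebra K Ω] [IsAlgClosure K Ω] {z : σ → Ω} (hz : z ≠ 0) :
    ∃ (P : MvPolynomial σ K) (m : Multiset (σ → Ω)), (∀ x ∈ m, x ≠ 0) ∧
      map (algebraMap K Ω) P = (m.map lin).prod ∧ lin z ∣ map (algebraMap K Ω) P := by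
  classical
  have : Algebra.IsAlgebraic K Ω := IsAlgClosure.isAlgebraic
  obtain ⟨p, hp⟩ := ExpChar.exists K
  have hpΩ : ExpChar Ω p := expChar_of_injective_algebraMap (algebraMap K Ω).injective p
  have hq : ∃ e, ∀ a, IsSeparable K (z a ^ p ^ e) := by
    choose e he using fun a => IsPurelyInseparable.pow_mem (separableClosure K Ω) p (z a)
    refine ⟨∑ a, e a, fun a => ?_⟩
    rw [← mem_separableClosure_iff, ← Finset.add_sum_erase _ _ (Finset.mem_univ a), pow_add,
      pow_mul]
    obtain ⟨w, hw⟩ := he a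
    exact pow_mem (hw ▸ w.2) _
  obtain ⟨e, he⟩ := hq
  have hpe : p ^ e ≠ 0 := pow_ne_zero _ (expChar_pos Ω p).ne'
  let O : Set (σ → Ω) := Set.range fun τ : Ω ≃ₐ[K] Ω => fun a => τ (z a)
  have hO : O.Finite := by
    refine (Set.Finite.pi (t := fun a => ((minpoly K (z a)).rootSet Ω)) fun a =>
      Polynomial.rootSet_finite _ _).subset ?_
    rintro _ ⟨τ, rfl⟩ a -
    rw [Polynomial.mem_rootSet]
    refine ⟨minpoly.ne_zero (Algebra.IsIntegral.isIntegral _), ?_⟩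
    change Polynomial.aeval (τ (z a)) _ = 0
    rw [← AlgEquiv.coe_toAlgHom, Polynomial.aeval_algHom_apply, minpoly.aeval, map_zero]
  let S := hO.toFinset
  have hS : ∀ x ∈ S, ∃ τ : Ω ≃ₐ[K] Ω, (fun a => τ (z a)) = x := fun x hx => hO.mem_toFinset.1 hx
  have hfix : ∀ (τ : Ω ≃ₐ[K] Ω), S.image (fun x a => τ (x a)) = S := by
    intro τ
    refine Finset.eq_of_subset_of_card_le ?_ (le_of_eq (Finset.card_image_of_injective _ ?_).symm)
    · intro x hx
      obtain ⟨x', hx', rfl⟩ := Finset.mem_image.1 hx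
      obtain ⟨τ', rfl⟩ := hS _ hx'
      exact hO.mem_toFinset.2 ⟨τ'.trans τ, rfl⟩
    · intro x x' h
      funext a
      exact τ.injective (congrFun h a)
  -- A Frobenius power makes the coordinates separable, and the product over the finite Galois orbit
  -- is invariant, hence rational. Expanding in `X ^ p ^ e` afterwards restores powers of the forms
  -- themselves.
  have hN : ∏ x ∈ S, lin (fun a => x a ^ p ^ e) ∈ (map (σ := σ) (algebraMap K Ω)).range := by
    rw [mem_range_map_iff_coeff]
    intro β
    refine mem_range_of_fixed_of_isSeparable ?_ fun τ => ?_
    · have hr : ∏ x ∈ S, lin (fun a => x a ^ p ^ e) ∈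
          (map (σ := σ) (algebraMap (separableClosure K Ω) Ω)).range := by
        refine prod_mem fun x hx => ?_
        obtain ⟨τ, rfl⟩ := hS x hx
        refine ⟨lin fun a => ⟨τ (z a) ^ p ^ e, ?_⟩, ?_⟩
        · rw [← map_pow, mem_separableClosure_iff]
          exact IsSeparable.map (τ : Ω →ₐ[K] Ω) τ.injective (he a)
        · change map _ _ = _
          rw [map_lin]
          rfl
      obtain ⟨w, hw⟩ := mem_range_map_iff_coeff.1 hr β
      rw [← hw]
      exact mem_separableClosure_iff.1 w.2
    · have h1 : map (τ : Ω →+* Ω) (∏ x ∈ S, lin (fun a => x a ^ p ^ e)) =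
          ∏ x ∈ S, lin (fun a => x a ^ p ^ e) := by
        conv_rhs => rw [← hfix τ]
        rw [Finset.prod_image (fun x _ x' _ h => funext fun a => τ.injective (congrFun h a)),
          map_prod]
        simp
      conv_rhs => rw [← h1]
      rw [coeff_map]
      rfl
  obtain ⟨P, hP⟩ := hN
  change map _ _ = _ at hP
  have hPm : map (algebraMap K Ω) (expand (p ^ e) P) = ∏ x ∈ S, lin x ^ p ^ e := by
    rw [map_expand, hP, map_prod]
    exact Finset.prod_congr rfl fun x _ => (lin_pow_expChar p e x).symm
  refine ⟨expand (p ^ e) P, p ^ e • S.val, ?_, ?_, ?_⟩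
  · intro x hx
    obtain ⟨τ, rfl⟩ := hS x (Multiset.mem_of_mem_nsmul hx)
    intro h
    exact hz (funext fun a => τ.injective (by simpa using congrFun h a))
  · rw [hPm, Multiset.map_nsmul, Multiset.prod_nsmul, Finset.prod_pow]
    rfl
  · rw [hPm]
    exact (dvd_pow_self _ hpe).trans
      (Finset.dvd_prod_of_mem (fun x => lin x ^ p ^ e) (hO.mem_toFinset.2 ⟨1, rfl⟩))

/-- A prime polynomial with a linear factor over some extension splits. -/
theorem exists_splitting_of_lin_dvd {σ : Type*} [Fintype σ] [DecidableEq σ] {B K M Ω : Type*}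
    [CommRing B] [IsDomain B] [UniqueFactorizationMonoid B] [Field K] [Field M] [Field Ω]
    [Algebra B K] [IsFractionRing B K] [Algebra K M] [Algebra K Ω] [IsAlgClosure K Ω]
    {R : MvPolynomial σ B} (hR : Prime R) {x : σ → M} {s : σ} (hs : x s = 1)
    (h : lin x ∣ map ((algebraMap K M).comp (algebraMap B K)) R) :
    ∃ (D : ℕ) (y : Ω) (x' : Fin D → σ → Ω),
      map ((algebraMap K Ω).comp (algebraMap B K)) R = C y * ∏ t, lin (x' t) := by
  have : IsAlgClosed Ω := IsAlgClosure.isAlgClosed K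
  have hinj : Function.Injective ((algebraMap K Ω).comp (algebraMap B K)) :=
    (algebraMap K Ω).injective.comp (IsFractionRing.injective B K)
  rw [← map_map] at h
  obtain ⟨z, hzs, hz⟩ := exists_lin_dvd_of_isAlgClosed (Ω := Ω) hs h
  rw [map_map] at hz
  obtain ⟨P, m, hm, hP, hzP⟩ := exists_map_eq_prod_lin (K := K) (z := z) (by
    rintro rfl; simp at hzs)
  let _ : Algebra (MvPolynomial σ B) (MvPolynomial σ K) := algebraMvPolynomial
  obtain ⟨⟨P', b⟩, hb⟩ := IsLocalization.surj ((nonZeroDivisors B).map (C (σ := σ))) P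
  obtain ⟨b', hb', hbb⟩ := b.2
  have hP' : map ((algebraMap K Ω).comp (algebraMap B K)) P' =
      C (algebraMap K Ω (algebraMap B K b')) * (m.map lin).prod := by
    rw [← map_map, ← hP, mul_comm]
    have h2 : map (algebraMap B K) P' = P * C (algebraMap B K b') := by
      rw [← map_C (algebraMap B K), hbb]
      exact hb.symm
    rw [h2, map_mul, map_C]
  have hb0 : algebraMap K Ω (algebraMap B K b') ≠ 0 := by
    rw [← RingHom.comp_apply, Ne, map_eq_zero_iff _ hinj]
    exact nonZeroDivisors.ne_zero hb'
  have hlz := lin_prime_of_eq_one hzs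
  -- The polynomials over `B` divisible by `lin z` over `Ω` form an ideal in which no nonzero member
  -- is free of `X s`, as `z s = 1`. The prime `R` in it therefore divides the product of conjugates
  -- `P'`.
  have hRP : R ∣ P' := by
    refine dvd_of_mem_of_forall_vars
      (𝔭 := (Ideal.span {lin z}).comap (map ((algebraMap K Ω).comp (algebraMap B K)))) s
      ?_ hR (Ideal.mem_comap.2 (Ideal.mem_span_singleton.2 hz))
      (Ideal.mem_comap.2 (Ideal.mem_span_singleton.2 ?_))
    · intro Q hQ hsQ
      have h1 := Ideal.mem_span_singleton.1 (Ideal.mem_comap.1 hQ)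
      have h2 := eq_zero_of_lin_dvd hzs h1 fun hs' => hsQ (vars_map _ _ hs')
      exact map_injective _ hinj (by rw [h2, map_zero])
    · rw [hP', ← hP]
      exact hzP.mul_left _
  have h1 := map_dvd (map ((algebraMap K Ω).comp (algebraMap B K))) hRP
  rw [hP', ((isUnit_iff_ne_zero.2 hb0).map C).dvd_mul_left] at h1
  obtain ⟨c, -, m', -, h2⟩ := exists_eq_prod_lin_of_dvd hm h1
  obtain ⟨x', hx'⟩ := exists_fin_map_eq m'
  exact ⟨_, c, x', by rw [h2, prod_fin_lin, hx']⟩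

end HeightOne

/-! ### The wedge of an irreducible polynomial with a generic form -/

section OneGroup

variable {n : ℕ}

lemma eval₂_coeff_lin_vero {A S : Type*} [CommRing A] [CommRing S] (φ : A →+* S) {d : ℕ}
    {G : MvPolynomial (Fin (n + 1)) S} (hG : G.IsHomogeneous d) (z : Fin (n + 1) → A) :
    eval₂ φ (fun α : Expo n d => coeff α.1 G) (lin (vero d z)) = eval (fun a => φ (z a)) G := by
  rw [eval_eq_sum_vero hG, lin, eval₂_sum]
  refine Finset.sum_congr rfl fun α _ => ?_
  rw [eval₂_mul, eval₂_C, eval₂_X, map_vero]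

/-- The value of a wedge with a generic form at the coefficients of a form. -/
lemma eval₂_coeff_wedge {A S : Type*} [CommRing A] [CommRing S] (φ : A →+* S) {d D : ℕ}
    {G : MvPolynomial (Fin (n + 1)) S} (hG : G.IsHomogeneous d) (y : A)
    (z : Fin D → Fin (n + 1) → A) :
    eval₂ φ (fun α : Expo n d => coeff α.1 G) (C y * ∏ t, lin (vero d (z t))) =
      φ y * ∏ t, eval (fun a => φ (z t a)) G := by
  rw [eval₂_mul, eval₂_C, eval₂_prod]
  exact congrArg _ (Finset.prod_congr rfl fun t _ => eval₂_coeff_lin_vero φ hG (z t))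

/-- The irreducible polynomial whose multiples are the polynomials divisible, over `Ω`, by a given
linear form. -/
structure IsLinGen {B Ω : Type*} [CommRing B] [Field Ω] {σ : Type*} [Fintype σ] (i : B →+* Ω)
    (R : MvPolynomial σ B) (x : σ → Ω) : Prop where
  ne_zero : R ≠ 0
  dvd_iff : ∀ Q, R ∣ Q ↔ lin x ∣ map i Q

variable {B Ω : Type*} [CommRing B] [IsDomain B] [Field Ω] {i : B →+* Ω}

lemma IsLinGen.prime {σ : Type*} [Fintype σ] [DecidableEq σ] {R : MvPolynomial σ B} {x : σ → Ω}
    {s : σ} (hs : x s = 1) (h : IsLinGen i R x) : Prime R := by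
  have hl := lin_prime_of_eq_one hs
  refine ⟨h.ne_zero, fun hu => ?_, fun p q hpq => ?_⟩
  · have := (h.dvd_iff 1).1 hu.dvd
    rw [map_one] at this
    exact hl.not_isUnit (isUnit_of_dvd_one this)
  · rw [h.dvd_iff, map_mul] at hpq
    rw [h.dvd_iff, h.dvd_iff]
    exact hl.dvd_or_dvd hpq

lemma IsLinGen.not_dvd_C {σ : Type*} [Fintype σ] [DecidableEq σ] {R : MvPolynomial σ B} {x : σ → Ω}
    {s : σ} (hs : x s = 1) (hi : Function.Injective i) (h : IsLinGen i R x) {b : B} (hb : b ≠ 0) :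
    ¬ R ∣ C b := by
  rw [h.dvd_iff, map_C]
  intro h1
  refine (lin_prime_of_eq_one hs).not_isUnit (isUnit_of_dvd_unit h1 (IsUnit.map C ?_))
  exact isUnit_iff_ne_zero.2 ((map_ne_zero_iff i hi).2 hb)

variable [UniqueFactorizationMonoid B] [IsAlgClosed Ω]

/-- `Ω` need not be algebraic over the fraction field of `B`; the Galois arguments take place in an
algebraic closure `Ω₀`, and `j` transports the outcome. -/
lemma IsLinGen.exists_splitting_aux {K Ω₀ : Type*} [Field K] [Field Ω₀] [Algebra B K]
    [IsFractionRing B K] [Algebra K Ω] [Algebra K Ω₀] [IsAlgClosure K Ω₀]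
    (hKi : (algebraMap K Ω).comp (algebraMap B K) = i) (j : Ω₀ →ₐ[K] Ω)
    {R : MvPolynomial (Fin (n + 1)) B} {x : Fin (n + 1) → Ω}
    {s : Fin (n + 1)} (hs : x s = 1) (h : IsLinGen i R x) :
    ∃ (D : ℕ) (y : Ω) (x' : Fin D → Fin (n + 1) → Ω), map i R = C y * ∏ t, lin (x' t) ∧
      ∀ d, ∃ W : MvPolynomial (Expo n d) B, map i W = C (y ^ d) * ∏ t, lin (vero d (x' t)) := by
  let _ : Algebra B Ω₀ := ((algebraMap K Ω₀).comp (algebraMap B K)).toAlgebra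
  have : IsScalarTower B K Ω₀ := IsScalarTower.of_algebraMap_eq fun _ => rfl
  have hj : (j : Ω₀ →+* Ω).comp (algebraMap B Ω₀) = i := by
    rw [← hKi, ← AlgHom.comp_algebraMap j, RingHom.comp_assoc]
    rfl
  obtain ⟨D, y, x', hx'⟩ := exists_splitting_of_lin_dvd (K := K) (Ω := Ω₀) (h.prime hs) hs (by
    rw [hKi]; exact (h.dvd_iff R).1 dvd_rfl)
  change map (algebraMap B Ω₀) R = _ at hx'
  refine ⟨D, j y, fun t a => j (x' t a), ?_, fun d => ?_⟩
  · rw [← hj, ← map_map, hx', map_mul, map_prod, map_C]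
    simp only [map_lin]
    rfl
  · obtain ⟨W, hW⟩ := exists_wedge_of_isIntegrallyClosed (K := K) d h.ne_zero hx'
    refine ⟨W, ?_⟩
    have h1 : ∀ t, map (j : Ω₀ →+* Ω) (lin (vero d (x' t))) = lin (vero d fun a => j (x' t a)) := by
      intro t
      rw [map_lin]
      exact congrArg lin (map_vero (j : Ω₀ →+* Ω) d (x' t)).symm
    rw [← hj, ← map_map, hW, map_mul, map_prod, map_C, map_pow, Finset.prod_congr rfl fun t _ => h1 t]
    rfl

/-- The splitting of an irreducible polynomial with a linear factor, with its generic wedges. -/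
theorem IsLinGen.exists_splitting {R : MvPolynomial (Fin (n + 1)) B} {x : Fin (n + 1) → Ω}
    {s : Fin (n + 1)} (hs : x s = 1) (hi : Function.Injective i) (h : IsLinGen i R x) :
    ∃ (D : ℕ) (y : Ω) (x' : Fin D → Fin (n + 1) → Ω), 0 < D ∧
      map i R = C y * ∏ t, lin (x' t) ∧
      ∀ d, ∃ W : MvPolynomial (Expo n d) B, map i W = C (y ^ d) * ∏ t, lin (vero d (x' t)) := by
  let _ : Algebra (FractionRing B) Ω := (IsFractionRing.lift hi : FractionRing B →+* Ω).toAlgebra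
  have hKi : (algebraMap (FractionRing B) Ω).comp (algebraMap B (FractionRing B)) = i := by
    ext b
    exact IsFractionRing.lift_algebraMap hi b
  obtain ⟨D, y, x', hR, hW⟩ := IsLinGen.exists_splitting_aux hKi
    (IsAlgClosed.lift : AlgebraicClosure (FractionRing B) →ₐ[FractionRing B] Ω) hs h
  -- In degree zero `R` would be a nonzero constant, which has no linear factor.
  refine ⟨D, y, x', Nat.pos_of_ne_zero ?_, hR, hW⟩
  rintro rfl
  have h1 : R = C (coeff 0 R) := by
    apply map_injective _ hi
    rw [map_C, ← coeff_map, hR]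
    simp
  refine h.not_dvd_C hs hi (b := coeff 0 R) (fun h0 => h.ne_zero ?_) (h1 ▸ dvd_rfl)
  rw [h1, h0, map_zero]

/-- The form `(a · X) ^ e * (b · X)` with indeterminate `a` and `b`. -/
def twoForm (B : Type*) [CommRing B] (n e : ℕ) :
    MvPolynomial (Fin (n + 1)) (MvPolynomial (Fin (n + 1)) (MvPolynomial (Fin (n + 1)) B)) :=
  lin X ^ e *
    lin (fun a => (C (X a) : MvPolynomial (Fin (n + 1)) (MvPolynomial (Fin (n + 1)) B)))

lemma twoForm_isHomogeneous (B : Type*) [CommRing B] (n e : ℕ) :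
    (twoForm B n e).IsHomogeneous (e + 1) := by
  have h := ((lin_isHomogeneous (X : Fin (n + 1) →
    MvPolynomial (Fin (n + 1)) (MvPolynomial (Fin (n + 1)) B))).pow e).mul
    (lin_isHomogeneous fun a => C (X a))
  rw [one_mul] at h
  exact h

lemma eval_twoForm {A : Type*} [CommRing A] (e : ℕ) (z : Fin (n + 1) → A) :
    eval (fun a => C (C (z a))) (twoForm A n e) = map C (lin z) ^ e * C (lin z) := by
  rw [twoForm, map_mul, map_pow, eval_lin, eval_lin, map_lin, lin, lin, map_sum]
  simp [mul_comm]

lemma map_twoForm {A A' : Type*} [CommRing A] [CommRing A'] (φ : A →+* A') (n e : ℕ) :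
    map (map (map φ)) (twoForm A n e) = twoForm A' n e := by
  simp [twoForm]

/-- The substitution of the coefficients of `(a · X) ^ e * (b · X)` for the indeterminates. -/
def twoSubst (A : Type*) [CommRing A] (n e : ℕ) : MvPolynomial (Expo n (e + 1)) A →+*
    MvPolynomial (Fin (n + 1)) (MvPolynomial (Fin (n + 1)) A) :=
  eval₂Hom (C.comp C) fun α => coeff α.1 (twoForm A n e)

lemma map_twoSubst {A A' : Type*} [CommRing A] [CommRing A'] (φ : A →+* A') (e : ℕ)
    (p : MvPolynomial (Expo n (e + 1)) A) :
    map (map φ) (twoSubst A n e p) = twoSubst A' n e (map φ p) := by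
  have h : (map (map φ)).comp (twoSubst A n e) = (twoSubst A' n e).comp (map φ) := by
    refine ringHom_ext (fun a => by simp [twoSubst]) fun α => ?_
    simp only [twoSubst, RingHom.comp_apply, coe_eval₂Hom, eval₂_X, map_X]
    rw [← map_twoForm φ, coeff_map]
  exact DFunLike.congr_fun h p

lemma twoSubst_lin_vero {A : Type*} [CommRing A] (e : ℕ) (z : Fin (n + 1) → A) :
    twoSubst A n e (lin (vero (e + 1) z)) = map C (lin z) ^ e * C (lin z) := by
  rw [twoSubst, coe_eval₂Hom, eval₂_coeff_lin_vero _ (twoForm_isHomogeneous A n e)]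
  exact eval_twoForm e z

/-- At `(a · X) ^ e * (b · X)` the wedge becomes `R(a) ^ e * R(b)`. The factor of exponent one is
what controls the factors of the wedge. -/
lemma twoSubst_wedge {A : Type*} [CommRing A] (e : ℕ) {D : ℕ} (y : A) (z : Fin D → Fin (n + 1) → A) :
    twoSubst A n e (C (y ^ (e + 1)) * ∏ t, lin (vero (e + 1) (z t))) =
      map C (C y * ∏ t, lin (z t)) ^ e * C (C y * ∏ t, lin (z t)) := by
  rw [map_mul, map_prod, Finset.prod_congr rfl fun t _ => twoSubst_lin_vero e (z t),
    Finset.prod_mul_distrib, map_mul, map_prod, map_mul, map_prod, map_C, mul_pow,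
    Finset.prod_pow, twoSubst, coe_eval₂Hom, eval₂_C, RingHom.comp_apply, map_pow, map_pow,
    pow_succ]
  ring

/-- The wedge of an irreducible polynomial with a generic form of positive degree is
irreducible, and belongs to the image of the point under the Veronese map. -/
theorem IsLinGen.wedge {R : MvPolynomial (Fin (n + 1)) B} {x : Fin (n + 1) → Ω}
    {s : Fin (n + 1)} (hs : x s = 1) (hi : Function.Injective i) (h : IsLinGen i R x) {D : ℕ}
    {y : Ω} {x' : Fin D → Fin (n + 1) → Ω} (hR : map i R = C y * ∏ t, lin (x' t)) {d : ℕ}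
    (hd : d ≠ 0) {W : MvPolynomial (Expo n d) B}
    (hW : map i W = C (y ^ d) * ∏ t, lin (vero d (x' t))) : IsLinGen i W (vero d x) := by
  classical
  obtain ⟨e, rfl⟩ : ∃ e, d = e + 1 := ⟨d - 1, by omega⟩
  have hR0 : map i R ≠ 0 := (map_ne_zero_iff _ (map_injective _ hi)).2 h.ne_zero
  have hy : y ≠ 0 := by rintro rfl; simp [hR] at hR0
  have hx' : ∀ t, x' t ≠ 0 := fun t ht => hR0 (by
    rw [hR, Finset.prod_eq_zero (Finset.mem_univ t) (by rw [ht, lin_zero]), mul_zero])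
  have hvs : vero (e + 1) x (expoSingle (e + 1) s) = 1 := by rw [vero_expoSingle, hs, one_pow]
  have hvx : ∀ t, vero (e + 1) (x' t) ≠ 0 := fun t ht => by
    obtain ⟨a, ha⟩ := Function.ne_iff.1 (hx' t)
    have := congrFun ht (expoSingle (e + 1) a)
    rw [vero_expoSingle] at this
    exact pow_ne_zero _ ha this
  have hl := lin_prime_of_eq_one hvs
  have hx0 : x ≠ 0 := by rintro rfl; simp at hs
  have hW0 : map i W ≠ 0 := by
    rw [hW]
    refine mul_ne_zero ?_ (Finset.prod_ne_zero_iff.2 fun t _ => ?_)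
    · rw [Ne, C_eq_zero]; exact pow_ne_zero _ hy
    · rw [Ne, lin_eq_zero]; exact hvx t
  have hWl : lin (vero (e + 1) x) ∣ map i W := by
    have h1 := (h.dvd_iff R).1 dvd_rfl
    rw [hR, prod_fin_lin] at h1
    obtain ⟨z, hz, c, rfl⟩ := exists_smul_of_lin_dvd_prod hx0 hy h1
    obtain ⟨t, -, ht⟩ := Multiset.mem_map.1 hz
    rw [hW]
    refine Dvd.dvd.mul_left ?_ _
    refine Dvd.dvd.trans ?_ (Finset.dvd_prod_of_mem _ (Finset.mem_univ t))
    rw [ht, vero_smul, lin_smul]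
    exact dvd_mul_left _ _
  let 𝔭 : Ideal (MvPolynomial (Expo n (e + 1)) B) :=
    (Ideal.span {lin (vero (e + 1) x)}).comap (map i)
  have hp : ∀ Q, Q ∈ 𝔭 ↔ lin (vero (e + 1) x) ∣ map i Q := fun Q => Ideal.mem_span_singleton
  have hprime : 𝔭.IsPrime := by
    have := (Ideal.span_singleton_prime hl.ne_zero).2 hl
    exact Ideal.comap_isPrime _ _
  -- A prime `W₀` of this ideal generates it, because a nonzero member cannot avoid the variable at
  -- which the Veronese vector is 1. It remains to see that the cofactor `v` of `W₀` in `W` is a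
  -- unit.
  obtain ⟨W₀, hW₀p, hW₀⟩ := hprime.exists_mem_prime_of_ne_bot fun h => hW0 (by
    have : W ∈ 𝔭 := (hp W).2 hWl
    rw [h, Ideal.mem_bot] at this
    rw [this, map_zero])
  have hgen : ∀ Q, W₀ ∣ Q ↔ lin (vero (e + 1) x) ∣ map i Q := by
    intro Q
    rw [← hp]
    refine ⟨fun hd => 𝔭.mem_of_dvd hd hW₀p, fun hQ => ?_⟩
    refine dvd_of_mem_of_forall_vars (expoSingle (e + 1) s) (fun Q hQ hsQ => ?_) hW₀ hW₀p hQ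
    have h2 := eq_zero_of_lin_dvd hvs ((hp Q).1 hQ) fun hs' => hsQ (vars_map _ _ hs')
    exact map_injective _ hi (by rw [h2, map_zero])
  obtain ⟨v, hv⟩ := (hgen W).2 hWl
  suffices hvu : IsUnit v by
    refine ⟨fun h0 => hW0 (by rw [h0, map_zero]), fun Q => ?_⟩
    rw [← hgen, hv, hvu.mul_right_dvd]
  -- the substitution of the coefficients of `(a · X) ^ e * (b · X)`
  have hsubW : twoSubst B n e W = map C R ^ e * C R := by
    apply map_injective _ (map_injective _ hi)
    rw [map_twoSubst, hW, twoSubst_wedge, ← hR, map_mul, map_pow, map_C, map_map, map_map]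
    congr 3
    congr 1
    ext a
    simp
  -- The form `lin (vero (e + 1) x)` divides `W₀` and goes to `lin x (a) ^ e * lin x (b)`. So each
  -- coefficient with respect to `a` is divisible by `lin x (b)`, hence by `R(b)`. After cancelling
  -- `R(b)`, the image of `v` divides `R(a) ^ e`, which is free of `b`.
  have hdvd : C R ∣ twoSubst B n e W₀ := by
    rw [C_dvd_iff_dvd_coeff]
    intro β
    rw [h.dvd_iff, ← coeff_map]
    obtain ⟨q, hq⟩ := (hgen W₀).1 dvd_rfl
    rw [map_twoSubst, hq, map_mul, twoSubst_lin_vero]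
    refine (C_dvd_iff_dvd_coeff _ _).1 ?_ β
    exact ((dvd_mul_left _ _).mul_right _)
  obtain ⟨q, hq⟩ := hdvd
  have hCR : (C R : MvPolynomial (Fin (n + 1)) (MvPolynomial (Fin (n + 1)) B)) ≠ 0 := by
    rw [Ne, C_eq_zero]; exact h.ne_zero
  have hqv : map C R ^ e = q * twoSubst B n e v := by
    apply mul_right_cancel₀ hCR
    rw [← hsubW, hv, map_mul, hq]
    ring
  have hiv : map i v ∣ map i W := map_dvd _ ⟨W₀, by rw [hv, mul_comm]⟩
  rw [hW, show ∏ t, lin (vero (e + 1) (x' t)) =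
    ((Finset.univ.val.map fun t => vero (e + 1) (x' t)).map lin).prod from prod_fin_lin _] at hiv
  have hW1 := hW ▸ hW0
  rw [show ∏ t, lin (vero (e + 1) (x' t)) =
    ((Finset.univ.val.map fun t => vero (e + 1) (x' t)).map lin).prod from prod_fin_lin _] at hW1
  obtain ⟨c, hc, m, hm, -, hvm⟩ := exists_eq_prod_lin_of_dvd_C_mul hW1 hiv
  -- A linear factor of `v` would give `R(a) ^ e` a factor `lin (x' t)` in the variables `b`, which
  -- it does not contain. So `v` is a constant.
  have hm0 : m = 0 := by
    rcases Multiset.empty_or_exists_mem m with h0 | ⟨z, hz⟩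
    · exact h0
    exfalso
    obtain ⟨t, -, rfl⟩ := Multiset.mem_map.1 (Multiset.mem_of_le hm hz)
    have h1 : lin (vero (e + 1) (x' t)) ∣ map i v :=
      hvm ▸ (Multiset.dvd_prod (Multiset.mem_map_of_mem _ hz)).mul_left _
    have h2 : C (lin (x' t)) ∣ map (map i) (map C R ^ e) := by
      rw [hqv, map_mul, map_twoSubst]
      refine Dvd.dvd.mul_left ((Dvd.dvd.trans ?_ (map_dvd (twoSubst Ω n e) h1))) _
      rw [twoSubst_lin_vero]
      exact dvd_mul_left _ _
    have h3 : map (map i) (map (C (σ := Fin (n + 1))) R ^ e) =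
        map (C (σ := Fin (n + 1))) (map i R ^ e) := by
      rw [map_pow, map_pow, map_map, map_map]
      congr 3
      ext a
      simp
    rw [h3, C_dvd_iff_dvd_coeff] at h2
    obtain ⟨β, hβ⟩ := MvPolynomial.ne_zero_iff.1 (pow_ne_zero e hR0)
    have h4 := h2 β
    rw [coeff_map] at h4
    exact (lin_prime (hx' t)).not_isUnit
      (isUnit_of_dvd_unit h4 ((isUnit_iff_ne_zero.2 hβ).map C))
  have hvC : v = C (coeff 0 v) := by
    apply map_injective _ hi
    rw [map_C, ← coeff_map, hvm, hm0]
    simp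
  rw [hvC]
  refine IsUnit.map C ?_
  by_contra hnu
  have hv0 : coeff 0 v ≠ 0 := fun h0 => hW0 (by rw [hv, hvC, h0, map_zero, mul_zero, map_zero])
  -- An irreducible factor of this constant would divide `R(a) ^ e`, hence `R`, hence be associated
  -- with `R`; but `R` divides no nonzero constant.
  obtain ⟨π, hπ, hπv⟩ := WfDvdMonoid.exists_irreducible_factor hnu hv0
  have h1 : (C (C π) : MvPolynomial (Fin (n + 1)) (MvPolynomial (Fin (n + 1)) B)) ∣ map C R ^ e := by
    rw [hqv, hvC]
    refine Dvd.dvd.mul_left ?_ _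
    have : twoSubst B n e (C (coeff 0 v)) = C (C (coeff 0 v)) := by simp [twoSubst]
    rw [this]
    exact map_dvd C (map_dvd C hπv)
  have h2 : C π ∣ R := by
    have hp : Prime (C π : MvPolynomial (Fin (n + 1)) B) := (prime_C_iff _).2 hπ.prime
    have h3 := ((prime_C_iff (Fin (n + 1))).2 hp).dvd_of_dvd_pow h1
    rw [C_dvd_iff_dvd_coeff] at h3
    rw [C_dvd_iff_dvd_coeff]
    intro β
    have h4 := h3 β
    rw [coeff_map, C_dvd_iff_dvd_coeff] at h4
    simpa using h4 0
  have hpr := h.prime hs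
  have hCπ : ¬ IsUnit (C π : MvPolynomial (Fin (n + 1)) B) := ((prime_C_iff _).2 hπ.prime).not_isUnit
  exact h.not_dvd_C hs hi hπ.ne_zero ((hpr.irreducible.dvd_iff.1 h2).resolve_left hCπ).dvd

/-- The wedge at the coefficients of the power of a linear form. -/
lemma eval₂_wedge_lin_pow {R : MvPolynomial (Fin (n + 1)) B} (hi : Function.Injective i) {D : ℕ}
    {y : Ω} {x' : Fin D → Fin (n + 1) → Ω} (hR : map i R = C y * ∏ t, lin (x' t)) {d : ℕ}
    {W : MvPolynomial (Expo n d) B} (hW : map i W = C (y ^ d) * ∏ t, lin (vero d (x' t))) :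
    eval₂ C (fun α : Expo n d =>
      coeff α.1 (lin (X : Fin (n + 1) → MvPolynomial (Fin (n + 1)) B) ^ d)) W = R ^ d := by
  apply map_injective _ hi
  have h1 : map i (eval₂ C (fun α : Expo n d =>
      coeff α.1 (lin (X : Fin (n + 1) → MvPolynomial (Fin (n + 1)) B) ^ d)) W) =
      eval₂ C (fun α : Expo n d =>
        coeff α.1 (lin (X : Fin (n + 1) → MvPolynomial (Fin (n + 1)) Ω) ^ d)) (map i W) := by
    rw [eval₂_comp_left, eval₂_map]
    congr 1
    · ext a; simp
    · funext α
      change map i (coeff _ _) = _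
      rw [← coeff_map, map_pow, map_lin]
      simp
  have hhom : (lin (X : Fin (n + 1) → MvPolynomial (Fin (n + 1)) Ω) ^ d).IsHomogeneous d := by
    simpa using (lin_isHomogeneous (X : Fin (n + 1) → MvPolynomial (Fin (n + 1)) Ω)).pow d
  rw [h1, hW, eval₂_coeff_wedge C hhom, map_pow (map i) R, hR, mul_pow, ← Finset.prod_pow, map_pow]
  refine congrArg _ (Finset.prod_congr rfl fun t _ => ?_)
  rw [map_pow, eval_lin]
  simp [lin, mul_comm]

end OneGroup

/-! ### Wedges over reduced rings -/

section Wedge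

/-- Each quotient by a prime embeds in an algebraically closed field, so the difference lies in
every prime and is nilpotent. -/
lemma eq_of_forall_isAlgClosed {A : Type u} [CommRing A] [IsReduced A] {a b : A}
    (h : ∀ (K : Type u) [Field K] [IsAlgClosed K] (ψ : A →+* K), ψ a = ψ b) : a = b := by
  rw [← sub_eq_zero]
  refine IsNilpotent.eq_zero (nilpotent_iff_mem_prime.2 fun 𝔭 h𝔭 => ?_)
  let K := AlgebraicClosure (FractionRing (A ⧸ 𝔭))
  let ψ : A →+* K := (algebraMap (FractionRing (A ⧸ 𝔭)) K).comp
    ((algebraMap (A ⧸ 𝔭) _).comp (Ideal.Quotient.mk 𝔭))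
  have h1 : ψ (a - b) = 0 := by rw [map_sub, h K ψ, sub_self]
  have h2 : Function.Injective ((algebraMap (FractionRing (A ⧸ 𝔭)) K).comp
    (algebraMap (A ⧸ 𝔭) (FractionRing (A ⧸ 𝔭)))) :=
    (algebraMap (FractionRing (A ⧸ 𝔭)) K).injective.comp (IsFractionRing.injective _ _)
  rw [← Ideal.Quotient.eq_zero_iff_mem]
  exact h2 (h1.trans (map_zero _).symm)

variable {n : ℕ} {A : Type u} [CommRing A]

/-- Over a reduced ring, a form is splittable if it splits over algebraically closed fields. -/
lemma isSplittable_of_forall [IsReduced A] {D : ℕ} {g : MvPolynomial (Fin (n + 1)) A}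
    (hhom : g.IsHomogeneous D)
    (h : ∀ (K : Type u) [Field K] [IsAlgClosed K] (ψ : A →+* K),
      ∃ (y : K) (x : Fin D → Fin (n + 1) → K), map ψ g = C y * ∏ t, lin (x t)) :
    IsSplittable D g := by
  refine ⟨hhom, fun hD P hP => eq_of_forall_isAlgClosed fun K _ _ ψ => ?_⟩
  obtain ⟨y, x, hx⟩ := h K ψ
  have h1 := (isSplittable_of_splitting (i := RingHom.id K) Function.injective_id
    (g := map ψ g) (by rw [MvPolynomial.map_id]; exact hx)).2 hD P hP
  rw [map_zero, ← h1]
  have h2 : (aeval (R := ℤ) fun α : Expo n D => coeff α.1 (map ψ g)).toRingHom =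
      ψ.comp (aeval (R := ℤ) fun α : Expo n D => coeff α.1 g).toRingHom :=
    ringHom_ext (fun a => by simp) fun α => by simp [coeff_map]
  exact (DFunLike.congr_fun h2 P).symm

lemma prod_lin_append {K : Type*} [CommRing K] {σ : Type*} [Fintype σ] {D D' : ℕ}
    (x : Fin D → σ → K) (x' : Fin D' → σ → K) :
    ∏ t, lin (Fin.append x x' t) = (∏ t, lin (x t)) * ∏ t, lin (x' t) := by
  rw [Fin.prod_univ_add]
  simp

lemma IsSplittable.mul [IsReduced A] {D D' : ℕ} {g g' : MvPolynomial (Fin (n + 1)) A}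
    (hg : IsSplittable D g) (hg' : IsSplittable D' g') : IsSplittable (D + D') (g * g') := by
  refine isSplittable_of_forall (hg.1.mul hg'.1) fun K _ _ ψ => ?_
  obtain ⟨y, x, h⟩ := hg.exists_splitting ψ
  obtain ⟨y', x', h'⟩ := hg'.exists_splitting ψ
  refine ⟨y * y', Fin.append x x', ?_⟩
  rw [prod_lin_append, map_mul, h, h', C_mul]
  ring

lemma IsWedge.unique [IsReduced A] {d D : ℕ} {f g : MvPolynomial (Fin (n + 1)) A} {w w' : A}
    (hg : IsSplittable D g) (h : IsWedge d D f g w) (h' : IsWedge d D f g w') : w = w' := by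
  refine eq_of_forall_isAlgClosed fun K _ _ ψ => ?_
  obtain ⟨y, x, hx⟩ := hg.exists_splitting ψ
  rw [h K ψ y x hx, h' K ψ y x hx]

/-- Splittings of the factors concatenate, and any other splitting of the product gives the same
value. -/
lemma IsWedge.mul {d D D' : ℕ} {f g g' : MvPolynomial (Fin (n + 1)) A} {w w' : A}
    (hf : f.IsHomogeneous d) (hg : IsSplittable D g) (hg' : IsSplittable D' g')
    (h : IsWedge d D f g w) (h' : IsWedge d D' f g' w') : IsWedge d (D + D') f (g * g') (w * w') := by
  intro K _ _ ψ y₀ x₀ h₀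
  obtain ⟨y, x, hx⟩ := hg.exists_splitting ψ
  obtain ⟨y', x', hx'⟩ := hg'.exists_splitting ψ
  have h1 : C y₀ * ∏ t, lin (x₀ t) = C (y * y') * ∏ t, lin (Fin.append x x' t) := by
    rw [prod_lin_append]
    refine h₀.symm.trans ?_
    rw [map_mul, hx, hx', C_mul]
    ring
  rw [eval_vero_unique h1 (hf.map ψ), map_mul, h K ψ y x hx, h' K ψ y' x' hx', Fin.prod_univ_add]
  simp
  ring

lemma isWedge_C_right {d : ℕ} (f : MvPolynomial (Fin (n + 1)) A) (r : A) :
    IsWedge d 0 f (C r) (r ^ d) := by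
  intro K _ _ ψ y x h
  have h1 : ψ r = y := by simpa using h
  simp [h1]

lemma isWedge_C_left {D : ℕ} (g : MvPolynomial (Fin (n + 1)) A) (a : A) :
    IsWedge 0 D (C a) g (a ^ D) := by
  intro K _ _ ψ y x h
  simp

lemma eq_C_of_isHomogeneous_zero {σ : Type*} {f : MvPolynomial σ A} (hf : f.IsHomogeneous 0) :
    f = C (coeff 0 f) := by
  have h := hf.totalDegree_le
  rwa [Nat.le_zero, totalDegree_eq_zero_iff_eq_C] at h

lemma isSplittable_zero_C (a : A) : IsSplittable 0 (C a : MvPolynomial (Fin (n + 1)) A) :=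
  ⟨isHomogeneous_C _ a, fun h => absurd h (lt_irrefl 0)⟩

end Wedge

/-! ### Wedges with respect to a group of indeterminates -/

section Groups

variable {ι : Type w} [DecidableEq ι] {n : ι → ℕ} {A : Type u} [CommRing A]

/-- `asPolyIn` as a ring morphism. -/
def asPolyHom (A : Type u) [CommRing A] (n : ι → ℕ) (i : ι) : MvPolynomial (Vars n) A →+*
    MvPolynomial (Fin (n i + 1)) (MvPolynomial (Vars n) A) :=
  eval₂Hom (C.comp C) fun p : Vars n =>
    if h : p.1 = i then X (Fin.cast (congrArg (fun j => n j + 1) h) p.2) else C (X p)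

lemma asPolyHom_apply (i : ι) (R : MvPolynomial (Vars n) A) : asPolyHom A n i R = asPolyIn i R :=
  rfl

lemma asPolyHom_C (i : ι) (a : A) : asPolyHom A n i (C a) = C (C a) := by simp [asPolyHom]

lemma asPolyHom_X_self (i : ι) (a : Fin (n i + 1)) : asPolyHom A n i (X ⟨i, a⟩) = X a := by
  simp [asPolyHom]

lemma asPolyHom_X_of_ne {i : ι} {p : Vars n} (h : p.1 ≠ i) :
    asPolyHom A n i (X p) = C (X p) := by
  simp [asPolyHom, h]

lemma eval_asPolyHom (i : ι) (R : MvPolynomial (Vars n) A) :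
    eval (fun a => X ⟨i, a⟩) (asPolyHom A n i R) = R := by
  have h : (eval fun a => (X ⟨i, a⟩ : MvPolynomial (Vars n) A)).comp (asPolyHom A n i) =
      RingHom.id _ := by
    refine ringHom_ext (fun a => by simp [asPolyHom]) fun p => ?_
    rcases p with ⟨j, a⟩
    by_cases hj : j = i
    · subst hj
      simp [asPolyHom_X_self]
    · simp [asPolyHom_X_of_ne (p := ⟨j, a⟩) hj]
  exact DFunLike.congr_fun h R

lemma asPolyHom_eq_C {i : ι} {R : MvPolynomial (Vars n) A} (h : IsSplittable 0 (asPolyHom A n i R)) :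
    asPolyHom A n i R = C R := by
  have h1 := eq_C_of_isHomogeneous_zero h.1
  have h2 := eval_asPolyHom i R
  rw [h1, eval_C] at h2
  rw [h1, h2]

lemma isWedgeAt_iff {i : ι} {d D : ℕ} {f : MvPolynomial (Fin (n i + 1)) A}
    {R w : MvPolynomial (Vars n) A} :
    IsWedgeAt i d D f R w ↔ IsWedge d D (map C f) (asPolyHom A n i R) w := Iff.rfl

lemma isWedgeAt_of_degree_eq_zero {i : ι} {d : ℕ} {f : MvPolynomial (Fin (n i + 1)) A}
    {R : MvPolynomial (Vars n) A} (h : IsSplittable 0 (asPolyHom A n i R)) :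
    IsWedgeAt i d 0 f R (R ^ d) := by
  rw [isWedgeAt_iff, asPolyHom_eq_C h]
  exact isWedge_C_right _ _

lemma isWedgeAt_zero_left {i : ι} {D : ℕ} {f : MvPolynomial (Fin (n i + 1)) A}
    (hf : f.IsHomogeneous 0) (R : MvPolynomial (Vars n) A) :
    IsWedgeAt i 0 D f R (C (coeff 0 f) ^ D) := by
  rw [isWedgeAt_iff, eq_C_of_isHomogeneous_zero hf, map_C, coeff_C, if_pos rfl]
  exact isWedge_C_left _ _

lemma IsWedgeAt.mul {i : ι} {d D D' : ℕ} {f : MvPolynomial (Fin (n i + 1)) A}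
    {R R' w w' : MvPolynomial (Vars n) A}
    (hf : f.IsHomogeneous d) (hg : IsSplittable D (asPolyHom A n i R))
    (hg' : IsSplittable D' (asPolyHom A n i R')) (h : IsWedgeAt i d D f R w)
    (h' : IsWedgeAt i d D' f R' w') : IsWedgeAt i d (D + D') f (R * R') (w * w') := by
  rw [isWedgeAt_iff, map_mul]
  exact IsWedge.mul (hf.map C) hg hg' h h'

lemma IsWedgeAt.unique [IsReduced A] {i : ι} {d D : ℕ} {f : MvPolynomial (Fin (n i + 1)) A}
    {R w w' : MvPolynomial (Vars n) A} (hg : IsSplittable D (asPolyHom A n i R))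
    (h : IsWedgeAt i d D f R w) (h' : IsWedgeAt i d D f R w') : w = w' :=
  IsWedge.unique hg h h'

lemma isResultantOfDegree_iff {J : Finset ι} {D : ι → ℕ} {R : MvPolynomial (Vars n) A} :
    IsResultantOfDegree J A D R ↔ ∀ i ∈ J,
    IsSplittable (D i) (asPolyHom A n i R) ∧
    ∀ (B : Type u) [CommRing B] [IsReduced B] [Algebra A B] (d : ℕ)
      (f : MvPolynomial (Fin (n i + 1)) B), f.IsHomogeneous d →
      (∃ w : MvPolynomial (Vars n) B,
        IsWedgeAt i d (D i) f (map (algebraMap A B) R) w ∧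
        IsResultantOfDegree (J.erase i) B (fun j => d * D j) w) ∧
      ∀ j ∈ J.erase i, ∀ (e : ℕ) (g : MvPolynomial (Fin (n j + 1)) B), g.IsHomogeneous e →
        ∀ w₁ w₂ z₁ z₂ : MvPolynomial (Vars n) B,
          IsWedgeAt i d (D i) f (map (algebraMap A B) R) w₁ →
          IsWedgeAt j e (d * D j) g w₁ z₁ →
          IsWedgeAt j e (D j) g (map (algebraMap A B) R) w₂ →
          IsWedgeAt i d (e * D i) f w₂ z₂ →
          z₁ = z₂ := by
  rw [IsResultantOfDegree]
  rfl

lemma asPolyHom_map {B : Type u} [CommRing B] (φ : A →+* B) (i : ι) (R : MvPolynomial (Vars n) A) :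
    asPolyHom B n i (map φ R) = map (map φ) (asPolyHom A n i R) := by
  have h : (asPolyHom B n i).comp (map φ) = (map (map φ)).comp (asPolyHom A n i) := by
    refine ringHom_ext (fun a => by simp [asPolyHom]) fun p => ?_
    rcases p with ⟨j, a⟩
    by_cases hj : j = i
    · subst hj
      simp [asPolyHom_X_self]
    · simp [asPolyHom_X_of_ne (p := ⟨j, a⟩) hj]
  exact DFunLike.congr_fun h R

/-- Wedges commute in degenerate degrees. -/
lemma wedge_comm_of_degenerate [IsReduced A] {i j : ι} {d e Di Dj : ℕ}
    {f : MvPolynomial (Fin (n i + 1)) A} {g : MvPolynomial (Fin (n j + 1)) A}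
    (hf : f.IsHomogeneous d) (hg : g.IsHomogeneous e) (hde : d = 0 ∨ Di = 0)
    {R w₁ w₂ z₁ z₂ : MvPolynomial (Vars n) A} (hRi : IsSplittable Di (asPolyHom A n i R))
    (hRj : IsSplittable Dj (asPolyHom A n j R))
    (hw₂i : IsSplittable (e * Di) (asPolyHom A n i w₂))
    (h₁ : IsWedgeAt i d Di f R w₁) (h₁' : IsWedgeAt j e (d * Dj) g w₁ z₁)
    (h₂ : IsWedgeAt j e Dj g R w₂) (h₂' : IsWedgeAt i d (e * Di) f w₂ z₂) : z₁ = z₂ := by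
  -- For `d = 0` both sides are the same power of the constant `f`. For `Di = 0` wedging with `f`
  -- raises to the power `d`, which commutes with the other wedge by multiplicativity.
  rcases hde with rfl | rfl
  · obtain rfl := h₁.unique hRi (isWedgeAt_zero_left hf R)
    obtain rfl := h₂'.unique hw₂i (isWedgeAt_zero_left hf w₂)
    have hs : IsSplittable 0 (asPolyHom A n j (C (coeff 0 f) ^ Di)) := by
      rw [← map_pow C, asPolyHom_C]
      exact isSplittable_zero_C _
    rw [zero_mul] at h₁'
    rw [h₁'.unique hs (isWedgeAt_of_degree_eq_zero hs), ← pow_mul, mul_comm]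
  · obtain rfl := h₁.unique hRi (isWedgeAt_of_degree_eq_zero hRi)
    rw [mul_zero] at hw₂i h₂'
    obtain rfl := h₂'.unique hw₂i (isWedgeAt_of_degree_eq_zero hw₂i)
    have hp : ∀ d, IsSplittable (d * Dj) (asPolyHom A n j (R ^ d)) ∧
        IsWedgeAt j e (d * Dj) g (R ^ d) (w₂ ^ d) := by
      intro d
      induction d with
      | zero =>
        have hs : IsSplittable 0 (asPolyHom A n j (R ^ 0)) := by
          rw [pow_zero, ← C_1, asPolyHom_C]
          exact isSplittable_zero_C _
        rw [zero_mul]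
        refine ⟨hs, ?_⟩
        simpa using isWedgeAt_of_degree_eq_zero (d := e) (f := g) hs
      | succ d ih =>
        rw [Nat.succ_mul, pow_succ, pow_succ]
        refine ⟨?_, ih.2.mul hg ih.1 hRj h₂⟩
        rw [map_mul]
        exact ih.1.mul hRj
    exact h₁'.unique (hp d).1 (hp d).2

/-- In degree zero the wedge with a form of degree `d` is the `d`-th power, so constants stay
constant throughout the recursion. The case of the constant 0 takes care of `R = 0`. -/
lemma isResultantOfDegree_C {J : Finset ι} {A : Type u} [CommRing A] {D : ι → ℕ}
    (hD : ∀ j ∈ J, D j = 0) (a : A) : IsResultantOfDegree (n := n) J A D (C a) := by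
  induction hN : J.card generalizing J A D a with
  | zero =>
    rw [Finset.card_eq_zero] at hN
    subst hN
    rw [isResultantOfDegree_iff]
    simp
  | succ N ih =>
  rw [isResultantOfDegree_iff]
  intro i hi
  have hs : ∀ {B : Type u} [CommRing B] (b : B) (i : ι),
      IsSplittable 0 (asPolyHom B n i (C b)) := fun b i => by
    rw [asPolyHom_C]; exact isSplittable_zero_C _
  rw [hD i hi]
  refine ⟨hs _ _, fun B _ _ _ d f hf => ⟨⟨C (algebraMap A B a ^ d), ?_, ?_⟩, ?_⟩⟩
  · rw [map_C, map_pow]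
    exact isWedgeAt_of_degree_eq_zero (hs _ _)
  · refine ih (fun j hj => ?_) _ (by rw [Finset.card_erase_of_mem hi, hN]; rfl)
    rw [hD j (Finset.mem_of_mem_erase hj), mul_zero]
  · intro j hj e g hg w₁ w₂ z₁ z₂
    have hDj := hD j (Finset.mem_of_mem_erase hj)
    rw [map_C, hDj]
    intro h₁ h₁' h₂ h₂'
    refine wedge_comm_of_degenerate hf hg (Or.inr rfl) (hs _ _) (hs _ _) ?_ h₁ h₁' h₂ h₂'
    rw [h₂.unique (hs _ _) (isWedgeAt_of_degree_eq_zero (hs _ _)), ← map_pow, mul_zero]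
    exact hs _ _

/-- Wedges are multiplicative, and unique over reduced rings: every wedge of the product is the
product of the wedges of the factors, to which the induction applies. -/
lemma IsResultantOfDegree.mul {J : Finset ι} {A : Type u} [CommRing A] [IsReduced A] {D D' : ι → ℕ}
    {R R' : MvPolynomial (Vars n) A} (h : IsResultantOfDegree J A D R)
    (h' : IsResultantOfDegree J A D' R') :
    IsResultantOfDegree J A (fun j => D j + D' j) (R * R') := by
  induction hN : J.card generalizing J A D D' R R' with
  | zero =>
    rw [Finset.card_eq_zero] at hN
    subst hN
    rw [isResultantOfDegree_iff]
    simp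
  | succ N ih =>
  rw [isResultantOfDegree_iff] at h h' ⊢
  intro i hi
  obtain ⟨hs, h1⟩ := h i hi
  obtain ⟨hs', h1'⟩ := h' i hi
  refine ⟨by rw [map_mul]; exact hs.mul hs', fun B _ _ _ d f hf => ?_⟩
  obtain ⟨⟨w, hw, hwr⟩, hc⟩ := h1 B d f hf
  obtain ⟨⟨w', hw', hwr'⟩, hc'⟩ := h1' B d f hf
  have hsB : ∀ i ∈ J, IsSplittable (D i) (asPolyHom B n i (map (algebraMap A B) R)) :=
    fun i hi => by rw [asPolyHom_map]; exact (h i hi).1.map _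
  have hsB' : ∀ i ∈ J, IsSplittable (D' i) (asPolyHom B n i (map (algebraMap A B) R')) :=
    fun i hi => by rw [asPolyHom_map]; exact (h' i hi).1.map _
  have hsBm : ∀ i ∈ J, IsSplittable (D i + D' i)
      (asPolyHom B n i (map (algebraMap A B) (R * R'))) := fun i hi => by
    rw [map_mul, map_mul]; exact (hsB i hi).mul (hsB' i hi)
  have hww : IsWedgeAt i d (D i + D' i) f (map (algebraMap A B) (R * R')) (w * w') := by
    rw [map_mul]
    exact hw.mul hf (hsB i hi) (hsB' i hi) hw'
  refine ⟨⟨w * w', hww, ?_⟩, ?_⟩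
  · have := ih hwr hwr' (by rw [Finset.card_erase_of_mem hi, hN]; rfl)
    simpa only [mul_add] using this
  · intro j hj e g hg w₁ w₂ z₁ z₂ h₁ h₁' h₂ h₂'
    have hjJ := Finset.mem_of_mem_erase hj
    have hij : i ∈ J.erase j := Finset.mem_erase.2 ⟨(Finset.ne_of_mem_erase hj).symm, hi⟩
    obtain rfl := h₁.unique (hsBm i hi) hww
    obtain ⟨⟨v, hv, hvr⟩, -⟩ := (h j hjJ).2 B e g hg
    obtain ⟨⟨v', hv', hvr'⟩, -⟩ := (h' j hjJ).2 B e g hg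
    have hvv : IsWedgeAt j e (D j + D' j) g (map (algebraMap A B) (R * R')) (v * v') := by
      rw [map_mul]
      exact hv.mul hg (hsB j hjJ) (hsB' j hjJ) hv'
    obtain rfl := h₂.unique (hsBm j hjJ) hvv
    rw [isResultantOfDegree_iff] at hwr hwr' hvr hvr'
    obtain ⟨hw_s, hw_w⟩ := hwr j hj
    obtain ⟨hw_s', hw_w'⟩ := hwr' j hj
    obtain ⟨hv_s, hv_w⟩ := hvr i hij
    obtain ⟨hv_s', hv_w'⟩ := hvr' i hij
    obtain ⟨⟨a, ha, -⟩, -⟩ := hw_w B e g hg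
    obtain ⟨⟨a', ha', -⟩, -⟩ := hw_w' B e g hg
    obtain ⟨⟨b, hb, -⟩, -⟩ := hv_w B d f hf
    obtain ⟨⟨b', hb', -⟩, -⟩ := hv_w' B d f hf
    rw [Algebra.algebraMap_self, MvPolynomial.map_id] at ha ha' hb hb'
    have e1 := hc j hj e g hg w v a b hw ha hv hb
    have e2 := hc' j hj e g hg w' v' a' b' hw' ha' hv' hb'
    have e3 : z₁ = a * a' := h₁'.unique (by
      rw [map_mul, mul_add]; exact hw_s.mul hw_s')
      (by rw [mul_add]; exact ha.mul hg hw_s hw_s' ha')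
    have e4 : z₂ = b * b' := h₂'.unique (by
      rw [map_mul, mul_add]; exact hv_s.mul hv_s')
      (by rw [mul_add]; exact hb.mul hf hv_s hv_s' hb')
    rw [e3, e4, e1, e2]

lemma IsResultantOfDegree.pow {J : Finset ι} {A : Type u} [CommRing A] [IsReduced A] {D : ι → ℕ}
    {R : MvPolynomial (Vars n) A} (h : IsResultantOfDegree J A D R) (d : ℕ) :
    IsResultantOfDegree J A (fun j => d * D j) (R ^ d) := by
  induction d with
  | zero =>
    rw [pow_zero, ← C_1]
    exact isResultantOfDegree_C (fun j _ => zero_mul _) 1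
  | succ d ih =>
    rw [pow_succ]
    simpa only [Nat.succ_mul] using ih.mul h

end Groups

/-! ### Generators of vanishing ideals -/

section Generators

variable {k : Type*} {L : Type*} [Field k] [Field L] [Algebra k L] [Infinite L]

/-- `R` generates the ideal of the polynomials over `k` that vanish on `E`. -/
structure IsGen {V : Type*} (E : Set (V → L)) (R : MvPolynomial V k) : Prop where
  ne_zero : R ≠ 0
  dvd_iff : ∀ P, R ∣ P ↔ ∀ e ∈ E, aeval e P = 0

lemma aeval_sumElim {S V : Type*} (μ : S → L) (e : V → L) (P : MvPolynomial (S ⊕ V) k) :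
    aeval (Sum.elim μ e) P =
      eval μ (map (aeval (R := k) e).toRingHom (sumAlgEquiv k S V P)) := by
  have h : (aeval (R := k) (Sum.elim μ e)).toRingHom =
      ((eval μ).comp (map (aeval (R := k) e).toRingHom)).comp
        (sumAlgEquiv k S V : _ →+* MvPolynomial S (MvPolynomial V k)) := by
    refine ringHom_ext (fun a => ?_) fun p => ?_
    · simp [sumAlgEquiv_C_inl]
    · rcases p with p | p
      · simp [sumAlgEquiv_X_inl]
      · simp [sumAlgEquiv_X_inr]
  exact DFunLike.congr_fun h P

/-- A polynomial over the infinite field `L` vanishes when all its values do; this separates free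
coordinates from constrained ones. -/
lemma forall_coeff_aeval_eq_zero_iff {S V : Type*} (e : V → L)
    (P : MvPolynomial (S ⊕ V) k) :
    (∀ β, aeval e (coeff β (sumAlgEquiv k S V P)) = 0) ↔
      ∀ μ : S → L, aeval (Sum.elim μ e) P = 0 := by
  have h1 : (∀ β, aeval e (coeff β (sumAlgEquiv k S V P)) = 0) ↔
      map (aeval (R := k) e).toRingHom (sumAlgEquiv k S V P) = 0 := by
    rw [MvPolynomial.ext_iff]
    simp only [coeff_map, coeff_zero]
    rfl
  rw [h1]
  constructor
  · intro h μ
    rw [aeval_sumElim, h, map_zero]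
  · intro h
    refine MvPolynomial.funext fun μ => ?_
    rw [← aeval_sumElim, h, map_zero]

lemma vars_subset_of_dvd {V : Type*} {P R : MvPolynomial V k} (h : R ∣ P) (hP : P ≠ 0) :
    R.vars ⊆ P.vars := by
  obtain ⟨Q, rfl⟩ := h
  intro v hv
  rw [mem_vars_iff_degreeOf_ne_zero] at hv ⊢
  rw [degreeOf_mul_eq (left_ne_zero_of_mul hP) (right_ne_zero_of_mul hP)]
  omega

/-- A nonzero relation can be freed of a coordinate on which there is no constraint. -/
lemma exists_relation_notMem_vars {V : Type*} [DecidableEq V] {E : Set (V → L)} {v : V}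
    (hv : ∀ e ∈ E, ∀ c, Function.update e v c ∈ E) {P : MvPolynomial V k} (hP : P ≠ 0)
    (h : ∀ e ∈ E, aeval e P = 0) :
    ∃ P₀ : MvPolynomial V k, P₀ ≠ 0 ∧ v ∉ P₀.vars ∧ ∀ e ∈ E, aeval e P₀ = 0 := by
  let f : {u // u = v} ⊕ {u // u ≠ v} ≃ V := Equiv.sumCompl (fun u => u = v)
  let P' := sumAlgEquiv k {u // u = v} {u // u ≠ v} (rename f.symm P)
  have hP' : P' ≠ 0 := by
    intro h0
    apply hP
    apply rename_injective _ f.symm.injective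
    apply (sumAlgEquiv k {u // u = v} {u // u ≠ v}).injective
    rw [map_zero, map_zero]
    exact h0
  obtain ⟨β, hβ⟩ := MvPolynomial.ne_zero_iff.1 hP'
  refine ⟨rename Subtype.val (coeff β P'), ?_, ?_, fun e he => ?_⟩
  · rw [Ne, map_eq_zero_iff _ (rename_injective _ Subtype.val_injective)]
    exact hβ
  · intro hm
    obtain ⟨u, -, hu⟩ := mem_vars_rename _ _ hm
    exact u.2 hu
  · rw [aeval_rename]
    refine (forall_coeff_aeval_eq_zero_iff (e ∘ Subtype.val) (rename f.symm P)).2 (fun μ => ?_) β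
    rw [aeval_rename]
    have : (Sum.elim μ (e ∘ Subtype.val)) ∘ f.symm = Function.update e v (μ ⟨v, rfl⟩) := by
      funext u
      by_cases hu : u = v
      · subst hu
        simp only [Function.comp_apply, f, Function.update_self]
        rw [Equiv.sumCompl_symm_apply_of_pos (p := fun w => w = u) rfl]
        rfl
      · simp only [Function.comp_apply, f, Function.update_of_ne hu]
        rw [Equiv.sumCompl_symm_apply_of_neg (p := fun w => w = v) hu]
        rfl
    rw [this]
    exact h _ (hv e he _)

/-- There is a nonzero relation free of `v`; it is a multiple of `R`, and degrees in `v` add up. -/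
lemma IsGen.notMem_vars {V : Type*} [DecidableEq V] {E : Set (V → L)} {v : V}
    {R : MvPolynomial V k} (hR : IsGen E R) (hv : ∀ e ∈ E, ∀ c, Function.update e v c ∈ E) :
    v ∉ R.vars := by
  obtain ⟨P, hP, hPv, h⟩ := exists_relation_notMem_vars hv hR.ne_zero ((hR.dvd_iff R).1 dvd_rfl)
  exact fun hm => hPv (vars_subset_of_dvd ((hR.dvd_iff P).2 h) hP hm)

lemma IsGen.rename_equiv {V V' : Type*} {E : Set (V → L)} {R : MvPolynomial V k} (hR : IsGen E R)
    (f : V ≃ V') : IsGen {e | e ∘ f ∈ E} (rename f R) := by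
  refine ⟨by rw [Ne, map_eq_zero_iff _ (rename_injective _ f.injective)]; exact hR.ne_zero,
    fun P => ?_⟩
  have h1 : rename f R ∣ P ↔ R ∣ rename f.symm P := by
    rw [← map_dvd_iff (renameEquiv k f)]
    simp
  rw [h1, hR.dvd_iff]
  constructor
  · intro h e he
    have := h _ he
    rw [aeval_rename] at this
    simpa [Function.comp_assoc] using this
  · intro h e he
    rw [aeval_rename]
    refine h _ ?_
    simpa [Function.comp_assoc] using he

/-- A relation involving additional free coordinates is a polynomial in them whose coefficients are
relations. -/
lemma IsGen.rename_inr {S V : Type*} {E : Set (V → L)} {R : MvPolynomial V k} (hR : IsGen E R) :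
    IsGen {e : S ⊕ V → L | e ∘ Sum.inr ∈ E} (rename Sum.inr R) := by
  refine ⟨by rw [Ne, map_eq_zero_iff _ (rename_injective _ Sum.inr_injective)]; exact hR.ne_zero,
    fun P => ?_⟩
  have h1 : rename Sum.inr R ∣ P ↔ C R ∣ sumAlgEquiv k S V P := by
    rw [← map_dvd_iff (sumAlgEquiv k S V)]
    have : sumAlgEquiv k S V (rename Sum.inr R) = C R :=
      DFunLike.congr_fun (sumAlgEquiv_comp_rename_inr k S V) R
    rw [this]
  rw [h1, C_dvd_iff_dvd_coeff]
  simp only [hR.dvd_iff]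
  rw [forall_comm]
  constructor
  · intro h e he
    have := (forall_coeff_aeval_eq_zero_iff _ P).1 (fun β => h (e ∘ Sum.inr) β he) (e ∘ Sum.inl)
    rwa [Sum.elim_comp_inl_inr] at this
  · intro h e β he
    exact (forall_coeff_aeval_eq_zero_iff e P).2 (fun μ => h _ (by simpa using he)) β

lemma IsGen.rename {V V' : Type*} {E : Set (V → L)} {R : MvPolynomial V k} (hR : IsGen E R)
    {f : V → V'} (hf : Function.Injective f) :
    IsGen {e | e ∘ f ∈ E} (MvPolynomial.rename f R) := by
  classical
  let g : {u // u ∉ Set.range f} ⊕ V ≃ V' :=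
    ((Equiv.sumComm _ _).trans (Equiv.sumCongr (Equiv.ofInjective f hf) (Equiv.refl _))).trans
      (Equiv.sumCompl fun u => u ∈ Set.range f)
  have hg : g ∘ Sum.inr = f := by
    funext v
    simp [g]
  have h := (hR.rename_inr (S := {u // u ∉ Set.range f})).rename_equiv g
  rw [rename_rename, hg] at h
  convert h using 2
  ext e
  simp only [Set.mem_ofPred_eq, Function.comp_assoc, hg]

lemma IsGen.associated {V : Type*} {E : Set (V → L)} {R R' : MvPolynomial V k} (h : IsGen E R)
    (h' : IsGen E R') : Associated R R' :=
  associated_of_dvd_dvd ((h.dvd_iff _).2 ((h'.dvd_iff _).1 dvd_rfl))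
    ((h'.dvd_iff _).2 ((h.dvd_iff _).1 dvd_rfl))

end Generators

/-! ### The generic point of a linear subspace -/

section GenericPoint

variable {L : Type v} [Field L] [Infinite L]

/-- A linear projection onto a subspace, on the level of polynomials. -/
lemma exists_projection {V : Type*} [Finite V] (E : Submodule L (V → L)) :
    ∃ (θ : MvPolynomial V L →ₐ[L] MvPolynomial V L) (p : (V → L) → V → L),
      (∀ e, p e ∈ E) ∧ (∀ e ∈ E, p e = e) ∧ ∀ P e, eval e (θ P) = eval (p e) P := by
  classical
  have := Fintype.ofFinite V
  obtain ⟨q, hq⟩ := E.subtype.exists_leftInverse_of_injective (LinearMap.ker_eq_bot.2 E.subtype_injective)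
  refine ⟨aeval fun v => ∑ u, C ((q (Pi.single u 1) : V → L) v) * X u, fun e => q e,
    fun e => (q e).2, fun e he => ?_, fun P e => ?_⟩
  · exact congrArg Subtype.val (LinearMap.congr_fun hq ⟨e, he⟩)
  · have h : ((eval e).comp (aeval (R := L)
        fun v => ∑ u, C ((q (Pi.single u 1) : V → L) v) * X u).toRingHom) =
        eval (q e : V → L) := by
      refine ringHom_ext (fun a => by simp) fun v => ?_
      have h2 : (q e : V → L) = ∑ u, e u • (q (Pi.single u 1) : V → L) := by
        conv_lhs => rw [pi_eq_sum_univ' e]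
        rw [map_sum, Submodule.coe_sum]
        simp only [map_smul, Submodule.coe_smul]
      rw [eval_X, h2]
      simp [mul_comm]
    exact DFunLike.congr_fun h P

/-- The polynomials with a linear factor over the function field of a linear subspace. -/
theorem exists_genericPoint {k : Type u} [Field k] [Algebra k L] {V : Type w} [Finite V]
    (E : Submodule L (V → L))
    (hE : ∀ P : MvPolynomial V k, (∀ e ∈ E, aeval e P = 0) → P = 0) :
    ∃ (Ω : Type (max w v)) (_ : Field Ω) (_ : IsAlgClosed Ω) (i : MvPolynomial V k →+* Ω)
      (j : L →+* Ω), Function.Injective i ∧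
      ∀ {σ : Type} [Fintype σ] [DecidableEq σ] (z : σ → L) (s : σ), z s = 1 →
        ∀ Q : MvPolynomial σ (MvPolynomial V k), lin (fun a => j (z a)) ∣ map i Q ↔
          ∀ e ∈ E, ∀ μ : σ → L, ∑ a, z a * μ a = 0 →
            eval μ (map (aeval (R := k) e).toRingHom Q) = 0 := by
  obtain ⟨θ, p, hpE, hp, hθ⟩ := exists_projection E
  let Ω := AlgebraicClosure (FractionRing (MvPolynomial V L))
  obtain ⟨a, ha⟩ : ∃ a : MvPolynomial V L →+* Ω, Function.Injective a :=
    ⟨(algebraMap (FractionRing (MvPolynomial V L)) Ω).comp (algebraMap _ _),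
      (algebraMap (FractionRing (MvPolynomial V L)) Ω).injective.comp (IsFractionRing.injective _ _)⟩
  -- Evaluation at the generic point of `E`, the projection of the vector of indeterminates.
  let i₀ : MvPolynomial V k →+* MvPolynomial V L := (θ : _ →+* _).comp (map (algebraMap k L))
  have hi₀ : ∀ e, (eval e).comp i₀ = (aeval (R := k) (p e)).toRingHom := fun e => by
    refine ringHom_ext (fun c => ?_) fun v => ?_
    · simp [i₀]
    · simp [i₀, hθ]
  refine ⟨Ω, inferInstance, inferInstance, a.comp i₀, a.comp C, ha.comp ?_, ?_⟩
  · rw [injective_iff_map_eq_zero]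
    intro P hP
    refine hE P fun e he => ?_
    have h := DFunLike.congr_fun (hi₀ e) P
    rw [RingHom.comp_apply, hP, map_zero, hp e he] at h
    exact h.symm
  · intro σ _ _ z s hs Q
    have hjs : (fun b => (a.comp C) (z b)) s = 1 := by simp [hs]
    rw [lin_dvd_iff (x := fun b => (a.comp C) (z b)) hjs]
    have h1 : elimVar s (fun b => (a.comp C) (z b)) (map (a.comp i₀) Q) =
        map a (elimVar s (fun b => C (z b)) (map i₀ Q)) := by
      have := elimVar_map a s (fun b => C (z b)) (map i₀ Q)
      rw [map_map] at this
      exact this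
    rw [h1, map_eq_zero_iff _ (map_injective _ ha)]
    -- Evaluating coefficients at `e` amounts to evaluating at the point `p e` of `E`, so
    -- divisibility at the generic point means divisibility at every point of `E`.
    have h2 : ∀ e : V → L, map (eval e) (elimVar s (fun b => C (z b)) (map i₀ Q)) =
        elimVar s z (map (aeval (R := k) (p e)).toRingHom Q) := by
      intro e
      have := elimVar_map (eval e) s (fun b => C (z b)) (map i₀ Q)
      rw [map_map, hi₀] at this
      rw [← this]
      simp
    constructor
    · intro h e he
      rw [← lin_dvd_iff_forall hs, lin_dvd_iff hs]
      have h3 := h2 e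
      rw [h, map_zero, hp e he] at h3
      exact h3.symm
    · intro h
      ext β : 1
      refine MvPolynomial.funext fun e => ?_
      rw [coeff_zero, map_zero, ← coeff_map, h2,
        (lin_dvd_iff hs).1 ((lin_dvd_iff_forall hs).2 (h (p e) (hpE e))), coeff_zero]

end GenericPoint

/-! ### Resultants of families of points, with auxiliary indeterminates -/

section Flat

variable {ι : Type w} [DecidableEq ι] {n : ι → ℕ} {τ : Type} {A B : Type*} [CommRing A] [CommRing B]

/-- Duplicates the indeterminates of the group `i`. -/
def dupVars (n : ι → ℕ) (τ : Type) (i : ι) : Vars n ⊕ τ → Fin (n i + 1) ⊕ (Vars n ⊕ τ) :=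
  Sum.elim (fun p => if h : p.1 = i then Sum.inl (Fin.cast (congrArg (fun j => n j + 1) h) p.2)
    else Sum.inr (Sum.inl p)) fun t => Sum.inr (Sum.inr t)

lemma dupVars_inr (i : ι) (t : τ) : dupVars n τ i (Sum.inr t) = Sum.inr (Sum.inr t) := rfl

lemma dupVars_self (i : ι) (a : Fin (n i + 1)) :
    dupVars n τ i (Sum.inl ⟨i, a⟩) = Sum.inl a := by simp [dupVars]

lemma dupVars_of_ne {i : ι} {p : Vars n} (h : p.1 ≠ i) :
    dupVars n τ i (Sum.inl p) = Sum.inr (Sum.inl p) := by simp [dupVars, h]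

lemma dupVars_injective (i : ι) : Function.Injective (dupVars n τ i) := by
  have h : ∀ u, Sum.elim (fun a => Sum.inl ⟨i, a⟩) id (dupVars n τ i u) = u := by
    rintro (⟨j, a⟩ | t)
    · by_cases hj : j = i
      · subst hj
        simp [dupVars_self]
      · simp [dupVars_of_ne (p := ⟨j, a⟩) hj]
    · simp [dupVars_inr]
  exact Function.LeftInverse.injective h

/-- A polynomial in several groups of variables and auxiliary ones, as a polynomial in the group
`i`. -/
def flatPoly (A : Type*) [CommRing A] (n : ι → ℕ) (τ : Type) (i : ι) : MvPolynomial (Vars n ⊕ τ) A →+*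
    MvPolynomial (Fin (n i + 1)) (MvPolynomial (Vars n ⊕ τ) A) :=
  (sumAlgEquiv A (Fin (n i + 1)) (Vars n ⊕ τ) : _ →+* _).comp (rename (dupVars n τ i)).toRingHom

lemma flatPoly_C (i : ι) (a : A) : flatPoly A n τ i (C a) = C (C a) := by
  simp [flatPoly, sumAlgEquiv_C_inl]

lemma flatPoly_self (i : ι) (a : Fin (n i + 1)) :
    flatPoly A n τ i (X (Sum.inl ⟨i, a⟩)) = X a := by
  simp [flatPoly, dupVars_self, sumAlgEquiv_X_inl]

lemma flatPoly_of_ne {i : ι} {p : Vars n} (h : p.1 ≠ i) :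
    flatPoly A n τ i (X (Sum.inl p)) = C (X (Sum.inl p)) := by
  simp [flatPoly, dupVars_of_ne h, sumAlgEquiv_X_inr]

lemma flatPoly_inr (i : ι) (t : τ) : flatPoly A n τ i (X (Sum.inr t)) = C (X (Sum.inr t)) := by
  simp [flatPoly, dupVars_inr, sumAlgEquiv_X_inr]

lemma flatPoly_injective (i : ι) : Function.Injective (flatPoly A n τ i) :=
  (sumAlgEquiv A (Fin (n i + 1)) (Vars n ⊕ τ)).injective.comp
    (rename_injective _ (dupVars_injective i))

/-- Two ring morphisms on polynomials in `Vars n ⊕ τ` agree if they do in three cases. -/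
lemma flat_ringHom_ext {S : Type*} [CommSemiring S] (i : ι) {f g : MvPolynomial (Vars n ⊕ τ) A →+* S}
    (hC : ∀ a, f (C a) = g (C a)) (hi : ∀ a, f (X (Sum.inl ⟨i, a⟩)) = g (X (Sum.inl ⟨i, a⟩)))
    (hne : ∀ p : Vars n, p.1 ≠ i → f (X (Sum.inl p)) = g (X (Sum.inl p)))
    (ht : ∀ t, f (X (Sum.inr t)) = g (X (Sum.inr t))) : f = g := by
  refine ringHom_ext hC ?_
  rintro (⟨j, a⟩ | t)
  · by_cases hj : j = i
    · subst hj; exact hi a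
    · exact hne _ hj
  · exact ht t

lemma eval_flatPoly (i : ι) (R : MvPolynomial (Vars n ⊕ τ) A) :
    eval (fun a => X (Sum.inl ⟨i, a⟩)) (flatPoly A n τ i R) = R := by
  have h : (eval fun a => (X (Sum.inl ⟨i, a⟩) : MvPolynomial (Vars n ⊕ τ) A)).comp
      (flatPoly A n τ i) = RingHom.id _ := by
    refine flat_ringHom_ext i (fun a => ?_) (fun a => ?_) (fun p hp => ?_) fun t => ?_
    · simp [flatPoly_C]
    · simp [flatPoly_self]
    · simp [flatPoly_of_ne hp]
    · simp [flatPoly_inr]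
  exact DFunLike.congr_fun h R

lemma flatPoly_eq_C {i : ι} {R : MvPolynomial (Vars n ⊕ τ) A}
    (h : ∀ a, Sum.inl ⟨i, a⟩ ∉ R.vars) : flatPoly A n τ i R = C R := by
  refine hom_congr_vars (f₁ := flatPoly A n τ i) (f₂ := C) ?_ ?_ rfl
  · ext a : 1
    simp [flatPoly_C]
  · rintro (⟨j, a⟩ | t) hm -
    · by_cases hj : j = i
      · subst hj; exact absurd hm (h a)
      · exact flatPoly_of_ne (p := ⟨j, a⟩) hj
    · exact flatPoly_inr i t

/-- The specialization of the ground ring and of the auxiliary indeterminates. -/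
def spec (φ : A →+* B) (c : τ → B) : MvPolynomial (Vars n ⊕ τ) A →+* MvPolynomial (Vars n) B :=
  eval₂Hom (C.comp φ) (Sum.elim X fun t => C (c t))

lemma spec_C (φ : A →+* B) (c : τ → B) (a : A) : spec (n := n) φ c (C a) = C (φ a) := by
  simp [spec]

lemma spec_inl (φ : A →+* B) (c : τ → B) (p : Vars n) : spec φ c (X (Sum.inl p)) = X p := by
  simp [spec]

lemma spec_inr (φ : A →+* B) (c : τ → B) (t : τ) :
    spec (n := n) φ c (X (Sum.inr t)) = C (c t) := by
  simp [spec]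

lemma map_spec {B' : Type*} [CommRing B'] (ψ : B →+* B') (φ : A →+* B) (c : τ → B)
    (R : MvPolynomial (Vars n ⊕ τ) A) :
    map ψ (spec φ c R) = spec (ψ.comp φ) (fun t => ψ (c t)) R := by
  have h : (map ψ).comp (spec φ c) = spec (n := n) (ψ.comp φ) (fun t => ψ (c t)) := by
    refine ringHom_ext (fun a => by simp [spec_C]) ?_
    rintro (p | t)
    · simp [spec_inl]
    · simp [spec_inr]
  exact DFunLike.congr_fun h R

/-- The index of the auxiliary indeterminates, extended by the coefficients of a form. -/
def shuffle {E : Type} : E ⊕ (Vars n ⊕ τ) ≃ Vars n ⊕ (E ⊕ τ) where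
  toFun := Sum.elim (fun α => Sum.inr (Sum.inl α)) (Sum.elim Sum.inl fun t => Sum.inr (Sum.inr t))
  invFun := Sum.elim (fun p => Sum.inr (Sum.inl p))
    (Sum.elim Sum.inl fun t => Sum.inr (Sum.inr t))
  left_inv := by rintro (_ | _ | _) <;> rfl
  right_inv := by rintro (_ | _ | _) <;> rfl

/-- Considers the coefficients of a form as auxiliary indeterminates. -/
def flatten (A : Type*) [CommRing A] (n : ι → ℕ) (τ E : Type) :
    MvPolynomial (Vars n ⊕ (E ⊕ τ)) A ≃ₐ[A] MvPolynomial E (MvPolynomial (Vars n ⊕ τ) A) :=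
  (renameEquiv A shuffle.symm).trans (sumAlgEquiv A E (Vars n ⊕ τ))

section

variable {E : Type}

lemma flatten_inl (p : Vars n) : flatten A n τ E (X (Sum.inl p)) = C (X (Sum.inl p)) := by
  simp [flatten, shuffle, sumAlgEquiv_X_inr]

lemma flatten_inr_inl (α : E) : flatten A n τ E (X (Sum.inr (Sum.inl α))) = X α := by
  simp [flatten, shuffle, sumAlgEquiv_X_inl]

lemma flatten_inr_inr (t : τ) :
    flatten A n τ E (X (Sum.inr (Sum.inr t))) = C (X (Sum.inr t)) := by
  simp [flatten, shuffle, sumAlgEquiv_X_inr]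

lemma flatten_C (a : A) : flatten A n τ E (C a) = C (C a) := by
  simp [flatten, sumAlgEquiv_C_inl]

lemma spec_eq_flatten (φ : A →+* B) (c : τ → B) (c' : E → B)
    (P : MvPolynomial (Vars n ⊕ (E ⊕ τ)) A) :
    spec φ (Sum.elim c' c) P = eval₂ (spec φ c) (fun α => C (c' α)) (flatten A n τ E P) := by
  have h : spec (n := n) φ (Sum.elim c' c) = (eval₂Hom (spec φ c) (fun α => C (c' α))).comp
      (flatten A n τ E : _ →+* _) := by
    refine ringHom_ext (fun a => by simp [spec_C, flatten_C]) ?_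
    rintro (p | α | t)
    · simp [spec_inl, flatten_inl]
    · simp [spec_inr, flatten_inr_inl]
    · simp [spec_inr, flatten_inr_inr]
  exact DFunLike.congr_fun h P

lemma aeval_flatten {k L : Type*} [Field k] [Field L] [Algebra k L] [Infinite L] (e : Vars n ⊕ τ → L) (t : E → L)
    (P : MvPolynomial (Vars n ⊕ (E ⊕ τ)) k) :
    eval t (map (aeval (R := k) e).toRingHom (flatten k n τ E P)) =
      aeval (Sum.elim t e ∘ shuffle.symm) P := by
  rw [← aeval_rename, aeval_sumElim]
  rfl

/-- The substitution of the coefficients of `(X_i · Y) ^ d`. -/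
def powSubst (A : Type*) [CommRing A] (n : ι → ℕ) (τ : Type) (i : ι) (d : ℕ) :
    MvPolynomial (Vars n ⊕ (Expo (n i) d ⊕ τ)) A →+* MvPolynomial (Vars n ⊕ τ) A :=
  eval₂Hom C (Sum.elim (fun p => X (Sum.inl p)) (Sum.elim
    (fun α => rename (fun a => Sum.inl ⟨i, a⟩)
      (coeff α.1 (lin (X : Fin (n i + 1) → MvPolynomial (Fin (n i + 1)) A) ^ d)))
    fun t => X (Sum.inr t)))

lemma powSubst_C (i : ι) (d : ℕ) (a : A) : powSubst A n τ i d (C a) = C a := by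
  simp [powSubst]

lemma powSubst_inl (i : ι) (d : ℕ) (p : Vars n) :
    powSubst A n τ i d (X (Sum.inl p)) = X (Sum.inl p) := by
  simp [powSubst]

lemma powSubst_inr_inl (i : ι) (d : ℕ) (α : Expo (n i) d) :
    powSubst A n τ i d (X (Sum.inr (Sum.inl α))) = rename (fun a => Sum.inl ⟨i, a⟩)
      (coeff α.1 (lin (X : Fin (n i + 1) → MvPolynomial (Fin (n i + 1)) A) ^ d)) := by
  simp [powSubst]

lemma powSubst_inr_inr (i : ι) (d : ℕ) (t : τ) :
    powSubst A n τ i d (X (Sum.inr (Sum.inr t))) = X (Sum.inr t) := by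
  simp [powSubst]

lemma powSubst_rename (i : ι) (d : ℕ) {σ : Type*} (f : σ → Vars n) (P : MvPolynomial σ A) :
    powSubst A n τ i d (rename (fun a => Sum.inl (f a)) P) =
      rename (fun a => Sum.inl (f a)) P := by
  have h : (powSubst A n τ i d).comp (rename (R := A) (fun a => Sum.inl (f a))).toRingHom =
      (rename (R := A) (fun a => Sum.inl (f a))).toRingHom :=
    ringHom_ext (fun a => by simp [powSubst_C]) fun a => by simp [powSubst_inl]
  exact DFunLike.congr_fun h P

lemma flatPoly_rename {i j : ι} (h : i ≠ j) (P : MvPolynomial (Fin (n i + 1)) A) :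
    flatPoly A n τ j (rename (fun a => Sum.inl ⟨i, a⟩) P) =
      C (rename (fun a => Sum.inl ⟨i, a⟩) P) := by
  have h1 : (flatPoly A n τ j).comp (rename (R := A) (fun a => Sum.inl ⟨i, a⟩)).toRingHom =
      C.comp (rename (R := A) (fun a => Sum.inl ⟨i, a⟩)).toRingHom :=
    ringHom_ext (fun a => by simp [flatPoly_C]) fun a => by
      simp [flatPoly_of_ne (τ := τ) (A := A) (p := ⟨i, a⟩) h]
  exact DFunLike.congr_fun h1 P

lemma flatPoly_powSubst {i j : ι} (h : i ≠ j) (d : ℕ)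
    (P : MvPolynomial (Vars n ⊕ (Expo (n i) d ⊕ τ)) A) :
    flatPoly A n τ j (powSubst A n τ i d P) =
      map (powSubst A n τ i d) (flatPoly A n (Expo (n i) d ⊕ τ) j P) := by
  have h1 : (flatPoly A n τ j).comp (powSubst A n τ i d) =
      (map (powSubst A n τ i d)).comp (flatPoly A n (Expo (n i) d ⊕ τ) j) := by
    refine flat_ringHom_ext j (fun a => ?_) (fun a => ?_) (fun p hp => ?_) ?_
    · simp [flatPoly_C, powSubst_C]
    · simp [flatPoly_self, powSubst_inl]
    · simp [flatPoly_of_ne hp, powSubst_inl]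
    · rintro (α | t)
      · simp [flatPoly_inr, powSubst_inr_inl, flatPoly_rename h]
      · simp [flatPoly_inr, powSubst_inr_inr]
  exact DFunLike.congr_fun h1 P

lemma rename_eq_eval₂_X {σ σ' : Type*} (f : σ → σ') (P : MvPolynomial σ A) :
    rename f P = eval₂ C (fun a => X (f a)) P := by
  have h : (rename (R := A) f).toRingHom = eval₂Hom C (fun a => X (f a)) :=
    ringHom_ext (fun a => by simp) fun a => by simp
  exact DFunLike.congr_fun h P

/-- The power of a linear form is first taken with dummy variables, to which `eval₂_wedge_lin_pow`
applies; these are then identified with the group `i`. -/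
lemma powSubst_eq_eval (i : ι) (d : ℕ) (W : MvPolynomial (Vars n ⊕ (Expo (n i) d ⊕ τ)) A) :
    powSubst A n τ i d W = eval (fun a => X (Sum.inl ⟨i, a⟩))
      (eval₂ C (fun α : Expo (n i) d => coeff α.1 (lin (X : Fin (n i + 1) →
        MvPolynomial (Fin (n i + 1)) (MvPolynomial (Vars n ⊕ τ) A)) ^ d)) (flatten A n τ _ W)) := by
  have h : powSubst A n τ i d = ((eval fun a => X (Sum.inl ⟨i, a⟩)).comp
      (eval₂Hom C (fun α : Expo (n i) d => coeff α.1 (lin (X : Fin (n i + 1) →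
        MvPolynomial (Fin (n i + 1)) (MvPolynomial (Vars n ⊕ τ) A)) ^ d)))).comp
      (flatten A n τ (Expo (n i) d) : _ →+* _) := by
    refine ringHom_ext (fun a => by simp [powSubst_C, flatten_C]) ?_
    rintro (p | α | t)
    · simp [powSubst_inl, flatten_inl]
    · rw [powSubst_inr_inl]
      simp only [RingHom.comp_apply, RingHom.coe_coe, flatten_inr_inl, coe_eval₂Hom, eval₂_X]
      have h2 : (lin (X : Fin (n i + 1) → MvPolynomial (Fin (n i + 1))
          (MvPolynomial (Vars n ⊕ τ) A)) ^ d) = map (map C)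
          (lin (X : Fin (n i + 1) → MvPolynomial (Fin (n i + 1)) A) ^ d) := by
        rw [map_pow, map_lin]
        simp
      rw [h2, coeff_map, eval_map, rename_eq_eval₂_X]
    · simp [powSubst_inr_inr, flatten_inr_inr]
  exact DFunLike.congr_fun h W

end

end Flat

/-! ### Generators for incidence spaces, and one wedge -/

section Good

variable {k : Type u} {L : Type v} [Field k] [Field L] [Algebra k L] [IsAlgClosed L]
  {ι : Type w} [DecidableEq ι] {n : ι → ℕ} {τ : Type}

/-- Families of linear forms vanishing at the points `x j`, `j ∈ J`, with auxiliary coordinates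
in `Z`. -/
def incidence (x : ∀ i, Fin (n i + 1) → L) (J : Finset ι) (Z : Submodule L (τ → L)) :
    Submodule L (Vars n ⊕ τ → L) where
  carrier := {e | (∀ j ∈ J, ∑ a, x j a * e (Sum.inl ⟨j, a⟩) = 0) ∧ (fun t => e (Sum.inr t)) ∈ Z}
  add_mem' := fun ha hb => ⟨fun j hj => by
    simp [mul_add, Finset.sum_add_distrib, ha.1 j hj, hb.1 j hj], Z.add_mem ha.2 hb.2⟩
  zero_mem' := ⟨fun j _ => by simp, Z.zero_mem⟩
  smul_mem' := fun c e he => ⟨fun j hj => by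
    simp [mul_left_comm, ← Finset.mul_sum, he.1 j hj], Z.smul_mem c he.2⟩

lemma mem_incidence {x : ∀ i, Fin (n i + 1) → L} {J : Finset ι} {Z : Submodule L (τ → L)}
    {e : Vars n ⊕ τ → L} : e ∈ incidence x J Z ↔
      (∀ j ∈ J, ∑ a, x j a * e (Sum.inl ⟨j, a⟩) = 0) ∧ (fun t => e (Sum.inr t)) ∈ Z := Iff.rfl

/-- The generator of the ideal of `incidence x J Z`, in which all groups of `J` are involved. -/
structure Good (x : ∀ i, Fin (n i + 1) → L) (J : Finset ι) (Z : Submodule L (τ → L))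
    (R : MvPolynomial (Vars n ⊕ τ) k) : Prop where
  gen : IsGen (incidence x J Z : Set (Vars n ⊕ τ → L)) R
  involves : ∀ j ∈ J, ∃ a, Sum.inl ⟨j, a⟩ ∈ R.vars

/-- The condition on the coefficients of a form of degree `d` that it vanishes at `z`. -/
def formsAt (d : ℕ) {m : ℕ} (z : Fin (m + 1) → L) (Z : Submodule L (τ → L)) :
    Submodule L (Expo m d ⊕ τ → L) where
  carrier := {e | ∑ α, vero d z α * e (Sum.inl α) = 0 ∧ (fun t => e (Sum.inr t)) ∈ Z}
  add_mem' := fun ha hb => ⟨by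
    simp only [Pi.add_apply, mul_add, Finset.sum_add_distrib]
    rw [ha.1, hb.1, add_zero], Z.add_mem ha.2 hb.2⟩
  zero_mem' := ⟨by simp, Z.zero_mem⟩
  smul_mem' := fun c e he => ⟨by
    simp only [Pi.smul_apply, smul_eq_mul, mul_left_comm _ c, ← Finset.mul_sum]
    rw [he.1, mul_zero], Z.smul_mem c he.2⟩

variable {x : ∀ i, Fin (n i + 1) → L} {J : Finset ι} {Z : Submodule L (τ → L)}
  {R : MvPolynomial (Vars n ⊕ τ) k}

lemma Good.notMem_vars (h : Good x J Z R) {i : ι} (hi : i ∉ J) (a : Fin (n i + 1)) :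
    Sum.inl ⟨i, a⟩ ∉ R.vars := by
  classical
  refine h.gen.notMem_vars fun e he c => mem_incidence.2 ⟨fun j hj => ?_, ?_⟩
  · rw [← (mem_incidence.1 he).1 j hj]
    refine Finset.sum_congr rfl fun b _ => ?_
    rw [Function.update_of_ne]
    intro h
    have : j = i := congrArg Sigma.fst (Sum.inl_injective h)
    exact hi (this ▸ hj)
  · convert (mem_incidence.1 he).2 using 2
    exact Function.update_of_ne (by simp) _ _

/-- Group `i` is free on the space without the condition at `i`, so a nonzero relation there could
be freed of a variable of group `i` occurring in `R`. It also holds on the smaller space with that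
condition, so `R` would divide it. This gives the injectivity needed at the generic point. -/
lemma Good.eq_zero_of_forall (h : Good x J Z R) {i : ι} (hi : i ∈ J)
    (P : MvPolynomial (Vars n ⊕ τ) k) (hP : ∀ e ∈ incidence x (J.erase i) Z, aeval e P = 0) :
    P = 0 := by
  classical
  by_contra h0
  obtain ⟨a, ha⟩ := h.involves i hi
  have hfree : ∀ e ∈ incidence x (J.erase i) Z, ∀ c : L,
      Function.update e (Sum.inl ⟨i, a⟩) c ∈ incidence x (J.erase i) Z := ?_
  · obtain ⟨P₀, hP₀, hv, hE⟩ := exists_relation_notMem_vars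
      (E := (incidence x (J.erase i) Z : Set (Vars n ⊕ τ → L))) (v := Sum.inl ⟨i, a⟩) hfree h0 hP
    refine hv (vars_subset_of_dvd ((h.gen.dvd_iff P₀).2 fun e he => hE e ?_) hP₀ ha)
    exact ⟨fun j hj => he.1 j (Finset.mem_of_mem_erase hj), he.2⟩
  · refine fun e he c => mem_incidence.2 ⟨fun j hj => ?_, ?_⟩
    · rw [← (mem_incidence.1 he).1 j hj]
      refine Finset.sum_congr rfl fun b _ => ?_
      rw [Function.update_of_ne]
      intro h
      have : j = i := congrArg Sigma.fst (Sum.inl_injective h)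
      exact Finset.ne_of_mem_erase hj this
    · convert (mem_incidence.1 he).2 using 2
      exact Function.update_of_ne (by simp) _ _

/-- Duplicating group `i` separates a point of the space into a point of the space without the
condition at `i` and a vector orthogonal to `x i`. The original variables of group `i` remain in the
coefficients as free dummies. -/
lemma Good.isLinGen [Finite ι] [Finite τ] (h : Good x J Z R) {i : ι} (hi : i ∈ J)
    {Ω : Type*} [Field Ω] {f : MvPolynomial (Vars n ⊕ τ) k →+* Ω} {j : L →+* Ω}
    (H : ∀ Q : MvPolynomial (Fin (n i + 1)) (MvPolynomial (Vars n ⊕ τ) k),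
      lin (fun a => j (x i a)) ∣ map f Q ↔
        ∀ e ∈ incidence x (J.erase i) Z, ∀ μ : Fin (n i + 1) → L, ∑ a, x i a * μ a = 0 →
          eval μ (map (aeval (R := k) e).toRingHom Q) = 0) :
    IsLinGen f (flatPoly k n τ i R) fun a => j (x i a) := by
  have hL : Infinite L := inferInstance
  refine ⟨by rw [Ne, map_eq_zero_iff _ (flatPoly_injective i)]; exact h.gen.ne_zero, fun Q => ?_⟩
  rw [H]
  have h1 := (h.gen.rename (dupVars_injective (n := n) (τ := τ) i)).dvd_iff
    ((sumAlgEquiv k (Fin (n i + 1)) (Vars n ⊕ τ)).symm Q)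
  rw [← map_dvd_iff (sumAlgEquiv k (Fin (n i + 1)) (Vars n ⊕ τ)), AlgEquiv.apply_symm_apply] at h1
  refine h1.trans ?_
  have h2 : ∀ (μ : Fin (n i + 1) → L) (e : Vars n ⊕ τ → L),
      aeval (Sum.elim μ e) ((sumAlgEquiv k (Fin (n i + 1)) (Vars n ⊕ τ)).symm Q) =
      eval μ (map (aeval (R := k) e).toRingHom Q) := fun μ e => by
    rw [aeval_sumElim, AlgEquiv.apply_symm_apply]
  have h3 : ∀ (μ : Fin (n i + 1) → L) (e : Vars n ⊕ τ → L),
      Sum.elim μ e ∘ dupVars n τ i ∈ incidence x J Z ↔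
        e ∈ incidence x (J.erase i) Z ∧ ∑ a, x i a * μ a = 0 := by
    intro μ e
    have h4 : ∀ j, j ≠ i → ∀ a, (Sum.elim μ e ∘ dupVars n τ i) (Sum.inl ⟨j, a⟩) =
        e (Sum.inl ⟨j, a⟩) := fun j hj a => by
      simp [dupVars_of_ne (p := ⟨j, a⟩) hj]
    have h5 : ∀ a, (Sum.elim μ e ∘ dupVars n τ i) (Sum.inl ⟨i, a⟩) = μ a := fun a => by
      simp [dupVars_self]
    have h6 : (fun t => (Sum.elim μ e ∘ dupVars n τ i) (Sum.inr t)) = fun t => e (Sum.inr t) := rfl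
    rw [mem_incidence, mem_incidence, h6]
    constructor
    · rintro ⟨h7, h8⟩
      refine ⟨⟨fun j hj => ?_, h8⟩, ?_⟩
      · have := h7 j (Finset.mem_of_mem_erase hj)
        simpa only [h4 j (Finset.ne_of_mem_erase hj)] using this
      · simpa only [h5] using h7 i hi
    · rintro ⟨⟨h7, h8⟩, h9⟩
      refine ⟨fun j hj => ?_, h8⟩
      by_cases hji : j = i
      · subst hji
        simpa only [h5] using h9
      · simpa only [h4 j hji] using h7 j (Finset.mem_erase.2 ⟨hji, hj⟩)
  constructor
  · intro h4 e he μ hμ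
    rw [← h2]
    exact h4 _ ((h3 μ e).2 ⟨he, hμ⟩)
  · intro h4 e he
    obtain ⟨μ, e', rfl⟩ : ∃ μ e', Sum.elim μ e' = e :=
      ⟨e ∘ Sum.inl, e ∘ Sum.inr, Sum.elim_comp_inl_inr e⟩
    rw [h2]
    exact h4 _ ((h3 μ e').1 he).1 _ ((h3 μ e').1 he).2

/-- The wedge of `R` with a generic form, and its main properties. -/
structure IsStep (x : ∀ i, Fin (n i + 1) → L) (J : Finset ι) (Z : Submodule L (τ → L)) (i : ι)
    (D d : ℕ) (R : MvPolynomial (Vars n ⊕ τ) k)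
    (W : MvPolynomial (Vars n ⊕ (Expo (n i) d ⊕ τ)) k) : Prop where
  gen : IsGen (incidence x (J.erase i) (formsAt d (x i) Z) :
    Set (Vars n ⊕ (Expo (n i) d ⊕ τ) → L)) W
  powSubst_eq : powSubst k n τ i d W = R ^ d
  value : ∀ {K : Type (max w u)} [Field K] [IsAlgClosed K] (Ψ : MvPolynomial (Vars n ⊕ τ) k →+* K)
    (y : K) (x' : Fin D → Fin (n i + 1) → K), map Ψ (flatPoly k n τ i R) = C y * ∏ t, lin (x' t) →
    ∀ f : MvPolynomial (Fin (n i + 1)) K, f.IsHomogeneous d →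
      eval₂ Ψ (fun α : Expo (n i) d => coeff α.1 f) (flatten k n τ _ W) =
        y ^ d * ∏ t, eval (x' t) f

/-- The one-group theory at the generic point of the space without the condition at `i`. The
coefficients of the generic form become auxiliary coordinates under the linear condition `formsAt`,
so the wedge is of the same nature as `R`. -/
lemma Good.exists_step [Finite ι] [Finite τ] (h : Good x J Z R) {i : ι} (hi : i ∈ J)
    {s : Fin (n i + 1)} (hs : x i s = 1) :
    ∃ D, 0 < D ∧ IsSplittable D (flatPoly k n τ i R) ∧ ∀ d, d ≠ 0 →
      ∃ W : MvPolynomial (Vars n ⊕ (Expo (n i) d ⊕ τ)) k, IsStep x J Z i D d R W := by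
  have hL : Infinite L := inferInstance
  obtain ⟨Ω, _, _, f, j, hf, H⟩ := exists_genericPoint (incidence x (J.erase i) Z)
    (h.eq_zero_of_forall hi)
  have hG := h.isLinGen hi (f := f) (j := j) fun Q => H (x i) s hs Q
  have hs' : (fun a => j (x i a)) s = 1 := by simp [hs]
  obtain ⟨D, y, x', hD, hsplit, hW⟩ := IsLinGen.exists_splitting (x := fun a => j (x i a)) hs' hf hG
  refine ⟨D, hD, isSplittable_of_splitting hf hsplit, fun d hd => ?_⟩
  obtain ⟨W, hW⟩ := hW d
  have hWG := IsLinGen.wedge (x := fun a => j (x i a)) hs' hf hG hsplit hd hW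
  refine ⟨(flatten k n τ _).symm W, ⟨?_, fun P => ?_⟩, ?_, ?_⟩
  · rw [Ne, EmbeddingLike.map_eq_zero_iff]
    exact hWG.ne_zero
  · rw [← map_dvd_iff (flatten k n τ (Expo (n i) d)), AlgEquiv.apply_symm_apply, hWG.dvd_iff,
      map_vero j, H (vero d (x i)) (expoSingle d s) (by rw [vero_expoSingle, hs, one_pow])]
    simp only [aeval_flatten]
    constructor
    · intro h1 e he
      have h2 := h1 (fun u => e (shuffle (Sum.inr u))) (mem_incidence.2 ⟨he.1, he.2.2⟩)
        (fun α => e (Sum.inr (Sum.inl α))) he.2.1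
      convert h2 using 2
      refine congrArg _ ?_
      funext u
      rcases u with u | u | u <;> rfl
    · intro h1 e he μ hμ
      exact h1 _ ⟨he.1, hμ, he.2⟩
  · rw [powSubst_eq_eval, AlgEquiv.apply_symm_apply, eval₂_wedge_lin_pow hf hsplit hW, map_pow,
      eval_flatPoly]
  · intro K _ _ Ψ y' x'' hΨ f' hf'
    rw [AlgEquiv.apply_symm_apply]
    have hgw : IsGenWedge f d D (flatPoly k n τ i R) W := by
      refine ⟨y, Finset.univ.val.map x', by simp, by rw [← prod_fin_lin, hsplit], ?_⟩
      rw [hW, Multiset.map_map]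
      rfl
    exact hgw.value hf Ψ hΨ hf'

end Good

/-! ### Resultants by iterated generic wedges -/

section Claim

variable {ι : Type w} [DecidableEq ι] {n : ι → ℕ} {τ : Type}

lemma asPolyHom_spec {A : Type*} [CommRing A] {B : Type u} [CommRing B] (φ : A →+* B) (c : τ → B)
    (i : ι) (R : MvPolynomial (Vars n ⊕ τ) A) :
    asPolyHom B n i (spec φ c R) = map (spec φ c) (flatPoly A n τ i R) := by
  have h : (asPolyHom B n i).comp (spec φ c) = (map (spec φ c)).comp (flatPoly A n τ i) := by
    refine flat_ringHom_ext i (fun a => ?_) (fun a => ?_) (fun p hp => ?_) fun t => ?_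
    · simp [spec_C, asPolyHom_C, flatPoly_C]
    · simp [spec_inl, asPolyHom_X_self, flatPoly_self]
    · simp [spec_inl, asPolyHom_X_of_ne hp, flatPoly_of_ne hp]
    · simp [spec_inr, asPolyHom_C, flatPoly_inr]
  exact DFunLike.congr_fun h R

variable {k : Type u} {L : Type v} [Field k] [Field L] [Algebra k L] [IsAlgClosed L]
  {x : ∀ i, Fin (n i + 1) → L} {J : Finset ι} {Z : Submodule L (τ → L)}
  {R : MvPolynomial (Vars n ⊕ τ) k} {i : ι} {D d : ℕ}

lemma IsStep.isWedgeAt {W : MvPolynomial (Vars n ⊕ (Expo (n i) d ⊕ τ)) k}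
    (h : IsStep x J Z i D d R W) {B : Type u} [CommRing B] (φ : k →+* B) (c : τ → B)
    {f : MvPolynomial (Fin (n i + 1)) B} (hf : f.IsHomogeneous d) :
    IsWedgeAt i d D f (spec φ c R)
      (spec φ (Sum.elim (fun α : Expo (n i) d => coeff α.1 f) c) W) := by
  intro K _ _ ψ y x' hx
  rw [← asPolyHom_apply, asPolyHom_spec, map_map] at hx
  have h1 := h.value (ψ.comp (spec φ c)) y x' hx (map ψ (map C f)) ((hf.map C).map ψ)
  rw [← h1, spec_eq_flatten, hom_eval₂]
  simp only [coeff_map]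

lemma Good.flatPoly_of_notMem (h : Good x J Z R) (hi : i ∉ J) : flatPoly k n τ i R = C R :=
  flatPoly_eq_C fun a => h.notMem_vars hi a

lemma Good.exists_isSplittable [Finite ι] [Finite τ] (h : Good x J Z R)
    (hx : ∀ i, ∃ s, x i s = 1) (i : ι) :
    ∃ D, IsSplittable D (flatPoly k n τ i R) ∧ (0 < D ↔ i ∈ J) := by
  by_cases hi : i ∈ J
  · obtain ⟨s, hs⟩ := hx i
    obtain ⟨D, hD, hD', -⟩ := h.exists_step hi hs
    exact ⟨D, hD', by simp [hi, hD]⟩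
  · refine ⟨0, ?_, by simp [hi]⟩
    rw [h.flatPoly_of_notMem hi]
    exact isSplittable_zero_C _

lemma Good.flatPoly_ne_zero (h : Good x J Z R) (i : ι) : flatPoly k n τ i R ≠ 0 := by
  rw [Ne, map_eq_zero_iff _ (flatPoly_injective i)]
  exact h.gen.ne_zero

lemma Good.isSplittable [Finite ι] [Finite τ] (h : Good x J Z R)
    (hx : ∀ i, ∃ s, x i s = 1) (hD : (flatPoly k n τ i R).IsHomogeneous D) :
    IsSplittable D (flatPoly k n τ i R) ∧ (D ≠ 0 ↔ i ∈ J) := by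
  obtain ⟨D', h1, h2⟩ := h.exists_isSplittable hx i
  obtain rfl := hD.inj_right h1.1 (h.flatPoly_ne_zero i)
  exact ⟨h1, by rw [← h2, Nat.pos_iff_ne_zero]⟩

/-- Substituting the power of a linear form turns `W` into `R ^ d`, which has positive degree in
every remaining group of `J`; so `W` must involve them all. -/
lemma IsStep.good [Finite ι] [Finite τ] {W : MvPolynomial (Vars n ⊕ (Expo (n i) d ⊕ τ)) k}
    (hW : IsStep x J Z i D d R W) (hR : Good x J Z R) (hx : ∀ i, ∃ s, x i s = 1) (hd : d ≠ 0) :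
    Good x (J.erase i) (formsAt d (x i) Z) W := by
  refine ⟨hW.gen, fun j hj => ?_⟩
  by_contra! hc
  have h1 := flatPoly_powSubst (Finset.ne_of_mem_erase hj).symm d W
  rw [flatPoly_eq_C hc, hW.powSubst_eq, map_C, map_pow, hW.powSubst_eq] at h1
  obtain ⟨E, hE, hE'⟩ := hR.exists_isSplittable hx j
  have h2 := (hE.1.pow d).inj_right (h1 ▸ isHomogeneous_C _ _)
    (pow_ne_zero _ (hR.flatPoly_ne_zero j))
  exact (Nat.mul_pos (hE'.2 (Finset.mem_of_mem_erase hj)) (Nat.pos_of_ne_zero hd)).ne' h2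

lemma IsStep.isHomogeneous [Finite ι] [Finite τ] {W : MvPolynomial (Vars n ⊕ (Expo (n i) d ⊕ τ)) k}
    (hW : IsStep x J Z i D d R W) (hR : Good x J Z R) (hx : ∀ i, ∃ s, x i s = 1) (hd : d ≠ 0)
    {j : ι} (hj : j ≠ i) {E : ℕ} (hE : (flatPoly k n τ j R).IsHomogeneous E) :
    (flatPoly k n _ j W).IsHomogeneous (d * E) := by
  obtain ⟨E', h1, -⟩ := (hW.good hR hx hd).exists_isSplittable hx j
  have h2 := h1.1.map (powSubst k n τ i d)
  rw [← flatPoly_powSubst hj.symm, hW.powSubst_eq, map_pow] at h2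
  have h3 := (hE.pow d).inj_right h2 (pow_ne_zero _ (hR.flatPoly_ne_zero j))
  rw [mul_comm, h3]
  exact h1.1

/-- Swaps two sets of auxiliary indeterminates. -/
def swapAux {V E F : Type*} : V ⊕ (E ⊕ (F ⊕ τ)) ≃ V ⊕ (F ⊕ (E ⊕ τ)) where
  toFun := Sum.map id (Sum.elim (fun a => Sum.inr (Sum.inl a))
    (Sum.elim Sum.inl fun t => Sum.inr (Sum.inr t)))
  invFun := Sum.map id (Sum.elim (fun a => Sum.inr (Sum.inl a))
    (Sum.elim Sum.inl fun t => Sum.inr (Sum.inr t)))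
  left_inv := by rintro (_ | _ | _ | _) <;> rfl
  right_inv := by rintro (_ | _ | _ | _) <;> rfl

lemma spec_rename_swapAux {A B : Type*} [CommRing A] [CommRing B] {E F : Type} (φ : A →+* B)
    (c : τ → B) (e : E → B) (f : F → B) (P : MvPolynomial (Vars n ⊕ (E ⊕ (F ⊕ τ))) A) :
    spec φ (Sum.elim f (Sum.elim e c)) (rename swapAux P) =
      spec φ (Sum.elim e (Sum.elim f c)) P := by
  have h : (spec φ (Sum.elim f (Sum.elim e c))).comp
      (rename (R := A) (swapAux (V := Vars n) (E := E) (F := F) (τ := τ))).toRingHom =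
      spec φ (Sum.elim e (Sum.elim f c)) := by
    refine ringHom_ext (fun a => by simp [spec_C]) ?_
    rintro (p | a | a | a) <;> simp [swapAux, spec_inl, spec_inr]
  exact DFunLike.congr_fun h P

lemma powSubst_rename_swapAux {A : Type*} [CommRing A] {j : ι} {d e : ℕ}
    (P : MvPolynomial (Vars n ⊕ (Expo (n i) d ⊕ (Expo (n j) e ⊕ τ))) A) :
    powSubst A n τ i d (powSubst A n _ j e (rename swapAux P)) =
      powSubst A n τ j e (powSubst A n _ i d P) := by
  have h : ((powSubst A n τ i d).comp (powSubst A n _ j e)).comp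
      (rename (R := A) (swapAux (V := Vars n) (E := Expo (n i) d) (F := Expo (n j) e)
        (τ := τ))).toRingHom = (powSubst A n τ j e).comp (powSubst A n _ i d) := by
    refine ringHom_ext (fun a => by simp [powSubst_C]) ?_
    rintro (p | a | a | a) <;> simp [swapAux, powSubst_inl, powSubst_inr_inl, powSubst_inr_inr,
      powSubst_rename]
  exact DFunLike.congr_fun h P

/-- Taking wedges with generic forms in two groups of indeterminates commutes. -/
lemma IsStep.comm [Finite ι] [Finite τ] {j : ι} (hR : R ≠ 0) {e Di Dj Di' Dj' : ℕ}
    {Wi : MvPolynomial (Vars n ⊕ (Expo (n i) d ⊕ τ)) k}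
    {Wj : MvPolynomial (Vars n ⊕ (Expo (n j) e ⊕ τ)) k}
    {Wij : MvPolynomial (Vars n ⊕ (Expo (n j) e ⊕ (Expo (n i) d ⊕ τ))) k}
    {Wji : MvPolynomial (Vars n ⊕ (Expo (n i) d ⊕ (Expo (n j) e ⊕ τ))) k}
    (hi : IsStep x J Z i Di d R Wi) (hj : IsStep x J Z j Dj e R Wj)
    (hij' : IsStep x (J.erase i) (formsAt d (x i) Z) j Dj' e Wi Wij)
    (hji' : IsStep x (J.erase j) (formsAt e (x j) Z) i Di' d Wj Wji) :
    Wij = rename swapAux Wji := by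
  have h1 : IsGen (incidence x ((J.erase i).erase j) (formsAt e (x j) (formsAt d (x i) Z)) :
      Set (Vars n ⊕ (Expo (n j) e ⊕ (Expo (n i) d ⊕ τ)) → L)) (rename swapAux Wji) := by
    have := hji'.gen.rename (swapAux (V := Vars n) (E := Expo (n i) d) (F := Expo (n j) e)
        (τ := τ)).injective
    convert this using 1
    ext u
    rw [Finset.erase_right_comm]
    constructor
    · rintro ⟨h, h', h'', h3⟩
      exact ⟨h, h'', h', h3⟩
    · rintro ⟨h, h', h'', h3⟩
      exact ⟨h, h'', h', h3⟩
  -- Generators of the ideal of one space differ by a constant. Substituting powers of linear forms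
  -- turns both wedges into `R ^ (d * e)`, so the constant is 1.
  obtain ⟨u, hu⟩ := h1.associated hij'.gen
  obtain ⟨a, -, ha⟩ := MvPolynomial.isUnit_iff_eq_C_of_isReduced.1 u.isUnit
  have h2 := congrArg (fun P => powSubst k n τ i d (powSubst k n _ j e P)) hu
  simp only [map_mul, powSubst_rename_swapAux, ha, powSubst_C, hij'.powSubst_eq, hji'.powSubst_eq,
    map_pow, hi.powSubst_eq, hj.powSubst_eq] at h2
  rw [← pow_mul, ← pow_mul, mul_comm d e] at h2
  have h3 := mul_left_cancel₀ (pow_ne_zero _ hR) (h2.trans (mul_one _).symm)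
  rw [← hu, ha, C_injective _ _ (h3.trans C_1.symm), C_1, mul_one]

/-- The induction runs over all auxiliary sets and all specializations at once: a wedge with a form
is a specialization of the generic wedge, whose coefficients have joined the auxiliary variables.
Groups of `J'` outside `J` have degree zero and are treated apart, as are constant forms. -/
theorem Good.isResultantOfDegree [Finite ι] (hx : ∀ i, ∃ s, x i s = 1) (J' : Finset ι) :
    ∀ {τ : Type} [Finite τ] {J : Finset ι} {Z : Submodule L (τ → L)}
      {R : MvPolynomial (Vars n ⊕ τ) k} (_ : Good x J Z R) (D : ι → ℕ)
      (_ : ∀ j ∈ J', (flatPoly k n τ j R).IsHomogeneous (D j))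
      {B : Type u} [CommRing B] [IsReduced B] (φ : k →+* B) (c : τ → B),
      IsResultantOfDegree J' B D (spec φ c R) := by
  induction hN : J'.card generalizing J' with
  | zero =>
    intro τ _ J Z R h D hD B _ _ φ c
    rw [Finset.card_eq_zero] at hN
    subst hN
    rw [isResultantOfDegree_iff]
    simp
  | succ N ih =>
  intro τ _ J Z R hR D hD B _ _ φ c
  have hs : ∀ {B : Type u} [CommRing B] (φ : k →+* B) (c : τ → B), ∀ j ∈ J',
      IsSplittable (D j) (asPolyHom B n j (spec φ c R)) := fun φ c j hj => by
    rw [asPolyHom_spec]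
    exact (hR.isSplittable hx (hD j hj)).1.map _
  have hex : ∀ {B : Type u} [CommRing B] [IsReduced B] (φ : k →+* B) (c : τ → B), ∀ i ∈ J',
      ∀ (d : ℕ) (f : MvPolynomial (Fin (n i + 1)) B), f.IsHomogeneous d →
      ∃ w : MvPolynomial (Vars n) B, IsWedgeAt i d (D i) f (spec φ c R) w ∧
        IsResultantOfDegree (J'.erase i) B (fun j => d * D j) w := by
    intro B _ _ φ c i hi d f hf
    have hcard : (J'.erase i).card = N := by rw [Finset.card_erase_of_mem hi, hN]; rfl
    by_cases hd : d = 0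
    · subst hd
      refine ⟨_, isWedgeAt_zero_left hf _, ?_⟩
      rw [← map_pow]
      exact isResultantOfDegree_C (by simp) _
    by_cases hiJ : i ∈ J
    · obtain ⟨s, hsx⟩ := hx i
      obtain ⟨Di, -, hDi, hW⟩ := hR.exists_step hiJ hsx
      obtain ⟨W, hW⟩ := hW d hd
      obtain rfl := hDi.1.inj_right (hD i hi) (hR.flatPoly_ne_zero i)
      refine ⟨_, hW.isWedgeAt φ c hf, ?_⟩
      exact ih _ hcard (hW.good hR hx hd) _ (fun j hj => hW.isHomogeneous hR hx hd
        (Finset.ne_of_mem_erase hj) (hD j (Finset.mem_of_mem_erase hj))) φ _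
    · have hDi : D i = 0 := by
        have := (hR.isSplittable hx (hD i hi)).2.not.2 hiJ
        simpa using this
      have h0 := hs φ c i hi
      rw [hDi] at h0 ⊢
      exact ⟨_, isWedgeAt_of_degree_eq_zero h0,
        (ih _ hcard hR _ (fun j hj => hD j (Finset.mem_of_mem_erase hj)) φ c).pow d⟩
  rw [isResultantOfDegree_iff]
  intro i hi
  refine ⟨hs φ c i hi, fun B' _ _ _ d f hf => ?_⟩
  rw [map_spec]
  refine ⟨hex _ _ i hi d f hf, ?_⟩
  intro j hj e g hg w₁ w₂ z₁ z₂ h₁ h₁' h₂ h₂'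
  set φ' := (algebraMap B B').comp φ
  set c' := fun t => algebraMap B B' (c t)
  have hjJ := Finset.mem_of_mem_erase hj
  have hji := Finset.ne_of_mem_erase hj
  have hij : i ∈ J'.erase j := Finset.mem_erase.2 ⟨hji.symm, hi⟩
  have hw₁ : IsSplittable (d * D j) (asPolyHom B' n j w₁) := by
    obtain ⟨w, hw, hw'⟩ := hex φ' c' i hi d f hf
    obtain rfl := h₁.unique (hs φ' c' i hi) hw
    exact (isResultantOfDegree_iff.1 hw' j hj).1
  have hw₂ : IsSplittable (e * D i) (asPolyHom B' n i w₂) := by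
    obtain ⟨w, hw, hw'⟩ := hex φ' c' j hjJ e g hg
    obtain rfl := h₂.unique (hs φ' c' j hjJ) hw
    exact (isResultantOfDegree_iff.1 hw' i hij).1
  by_cases hd : d = 0 ∨ D i = 0
  · exact wedge_comm_of_degenerate hf hg hd (hs φ' c' i hi) (hs φ' c' j hjJ) hw₂ h₁ h₁' h₂ h₂'
  by_cases he : e = 0 ∨ D j = 0
  · exact (wedge_comm_of_degenerate hg hf he (hs φ' c' j hjJ) (hs φ' c' i hi) hw₁ h₂ h₂' h₁ h₁').symm
  push Not at hd he
  have hiJ := (hR.isSplittable hx (hD i hi)).2.1 hd.2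
  have hjJ0 := (hR.isSplittable hx (hD j hjJ)).2.1 he.2
  obtain ⟨s, hsx⟩ := hx i
  obtain ⟨t, htx⟩ := hx j
  obtain ⟨Di, -, hDi, hW⟩ := hR.exists_step hiJ hsx
  obtain ⟨Wi, hWi⟩ := hW d hd.1
  obtain rfl := hDi.1.inj_right (hD i hi) (hR.flatPoly_ne_zero i)
  obtain ⟨Dj, -, hDj, hW⟩ := hR.exists_step hjJ0 htx
  obtain ⟨Wj, hWj⟩ := hW e he.1
  obtain rfl := hDj.1.inj_right (hD j hjJ) (hR.flatPoly_ne_zero j)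
  have hGi := hWi.good hR hx hd.1
  have hGj := hWj.good hR hx he.1
  have hhj := hWi.isHomogeneous hR hx hd.1 hji (hD j hjJ)
  have hhi := hWj.isHomogeneous hR hx he.1 hji.symm (hD i hi)
  obtain ⟨Dij, -, hDij, hW⟩ := hGi.exists_step (Finset.mem_erase.2 ⟨hji, hjJ0⟩) htx
  obtain ⟨Wij, hWij⟩ := hW e he.1
  obtain rfl := hDij.1.inj_right hhj (hGi.flatPoly_ne_zero j)
  obtain ⟨Dji, -, hDji, hW⟩ := hGj.exists_step (Finset.mem_erase.2 ⟨hji.symm, hiJ⟩) hsx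
  obtain ⟨Wji, hWji⟩ := hW d hd.1
  obtain rfl := hDji.1.inj_right hhi (hGj.flatPoly_ne_zero i)
  obtain rfl := h₁.unique (hs φ' c' i hi) (hWi.isWedgeAt φ' c' hf)
  obtain rfl := h₂.unique (hs φ' c' j hjJ) (hWj.isWedgeAt φ' c' hg)
  -- All four wedges are specializations of generic ones, which agree up to the order of the
  -- auxiliary variables.
  rw [h₁'.unique hw₁ (hWij.isWedgeAt φ' _ hg), h₂'.unique hw₂ (hWji.isWedgeAt φ' _ hf),
    hWi.comm hR.gen.ne_zero hWj hWij hWji, spec_rename_swapAux]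

end Claim

/-! ### Resultants of minimally constrained families -/

section Families

variable {k : Type u} {L : Type v} [Field k] [Field L] [Algebra k L] {ι : Type w} {n : ι → ℕ}

lemma IsGenericDual.aeval_eq_zero_iff {ξ : ∀ i, ℙ L (Fin (n i + 1) → L)} {l : Vars n → L}
    (hl : IsGenericDual k ξ l) (P : MvPolynomial (Vars n) k) :
    aeval l P = 0 ↔ ∀ m ∈ dualVariety ξ, aeval m P = 0 := by
  refine ⟨fun h m hm => ?_, fun h => h l hl.1⟩
  have := hl.2 (map (algebraMap k (fieldOf k ξ)) P) (by rwa [aeval_map_algebraMap]) m hm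
  rwa [aeval_map_algebraMap] at this

lemma exists_irreducible_dvd_of_aeval_eq_zero {V : Type*} (l : V → L) {P : MvPolynomial V k}
    (hP : P ≠ 0) (h : aeval l P = 0) : ∃ Q, Irreducible Q ∧ Q ∣ P ∧ aeval l Q = 0 := by
  induction P using WfDvdMonoid.induction_on_irreducible with
  | zero => exact absurd rfl hP
  | unit u hu => exact absurd h (hu.map (aeval (R := k) l)).ne_zero
  | mul a i ha hi ih =>
    rw [map_mul, mul_eq_zero] at h
    rcases h with h | h
    · exact ⟨i, hi, dvd_mul_right _ _, h⟩
    · obtain ⟨Q, h1, h2, h3⟩ := ih ha h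
      exact ⟨Q, h1, h2.mul_left _, h3⟩

/-- The relations satisfied by `l` form a prime ideal, so each nonzero one has an irreducible factor
in it, which is associated with `Q`. -/
lemma isGen_of_forall_associated {V : Type*} {E : Set (V → L)} {l : V → L}
    (hl : ∀ P : MvPolynomial V k, aeval l P = 0 ↔ ∀ m ∈ E, aeval m P = 0)
    {Q : MvPolynomial V k} (hQ : Irreducible Q) (h0 : aeval l Q = 0)
    (h : ∀ P : MvPolynomial V k, Irreducible P → aeval l P = 0 → Associated P Q) : IsGen E Q := by
  refine ⟨hQ.ne_zero, fun P => ?_⟩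
  rw [← hl]
  constructor
  · rintro ⟨P, rfl⟩
    rw [map_mul, h0, zero_mul]
  · intro hP
    by_cases hP0 : P = 0
    · rw [hP0]; exact dvd_zero _
    obtain ⟨Q', h1, h2, h3⟩ := exists_irreducible_dvd_of_aeval_eq_zero l hP0 hP
    exact (h Q' h1 h3).symm.dvd.trans h2

/-- A generator free of group `j` would be a nonzero relation for the subfamily without `j`, which
is unconstrained; zero serves as the linear form at `j` when a subfamily is extended. -/
lemma IsMinimallyConstrained.involves {ξ : ∀ i, ℙ L (Fin (n i + 1) → L)}
    (h : IsMinimallyConstrained k ξ) {Q : MvPolynomial (Vars n) k} (hQ : IsGen (dualVariety ξ) Q)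
    (j : ι) : ∃ a, ⟨j, a⟩ ∈ Q.vars := by
  classical
  by_contra! hc
  obtain ⟨l, hl, hind⟩ := h.2 {j}ᶜ (by simp)
  let f : Vars (fun s : ({j}ᶜ : Set ι) => n s) → Vars n := fun p => ⟨p.1.1, p.2⟩
  have hf : Function.Injective f := by
    rintro ⟨⟨a, ha⟩, b⟩ ⟨⟨a', ha'⟩, b'⟩ hab
    obtain ⟨rfl, h2⟩ := Sigma.mk.inj_iff.1 hab
    obtain rfl := eq_of_heq h2
    rfl
  obtain ⟨Q', hQ'⟩ := exists_rename_eq_of_vars_subset_range Q f hf (by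
    rintro ⟨i, a⟩ hi
    refine ⟨⟨⟨i, ?_⟩, a⟩, rfl⟩
    rintro rfl
    exact hc a hi)
  have h1 : Q' = 0 := by
    refine (injective_iff_map_eq_zero _).1 hind Q' ((hl.aeval_eq_zero_iff Q').2 fun m hm => ?_)
    let m' : Vars n → L := fun p => if hp : p.1 ∈ ({j}ᶜ : Set ι) then m ⟨⟨p.1, hp⟩, p.2⟩ else 0
    have hm' : m' ∘ f = m := by
      funext p
      simp only [m', f, Function.comp]
      rw [dif_pos p.1.2]
    have h2 := (hQ.dvd_iff Q).1 dvd_rfl m' fun i => ?_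
    · rwa [← hQ', aeval_rename, hm'] at h2
    · by_cases hi : i ∈ ({j}ᶜ : Set ι)
      · rw [← hm ⟨i, hi⟩]
        refine Finset.sum_congr rfl fun a _ => ?_
        simp only [m']
        rw [dif_pos hi]
      · refine Finset.sum_eq_zero fun a _ => ?_
        simp only [m']
        rw [dif_neg hi, zero_mul]
  rw [h1, map_zero] at hQ'
  exact hQ.ne_zero hQ'.symm

lemma IsResultantOf.isGen {ξ : ∀ i, ℙ L (Fin (n i + 1) → L)} {Q : MvPolynomial (Vars n) k}
    (h : IsResultantOf k ξ Q) : IsGen (dualVariety ξ) Q := by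
  obtain ⟨l, hl, h1, h2, h3⟩ := h
  exact isGen_of_forall_associated hl.aeval_eq_zero_iff h1 h2 h3

lemma exists_normalized {m : ℕ} (p : ℙ L (Fin (m + 1) → L)) :
    ∃ (x : Fin (m + 1) → L) (c : L), c ≠ 0 ∧ (∃ s, x s = 1) ∧ ∀ a, x a = p.rep a * c := by
  obtain ⟨s, hs⟩ := Function.ne_iff.1 p.rep_nonzero
  refine ⟨fun a => p.rep a * (p.rep s)⁻¹, _, inv_ne_zero hs, ⟨s, mul_inv_cancel₀ hs⟩, fun a => rfl⟩

variable [DecidableEq ι] [IsAlgClosed L]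

theorem IsMinimallyConstrained.exists_isResultantOfDegree [Finite ι] {S : Set ι}
    {ξ : ∀ j : S, ℙ L (Fin (n j + 1) → L)}
    (h : IsMinimallyConstrained k (n := fun j : S => n j) ξ)
    {Q : MvPolynomial (Vars (fun j : S => n j)) k}
    (hQ : IsResultantOf k (n := fun j : S => n j) ξ Q) (J : Finset ι) :
    ∃ D : ι → ℕ, IsResultantOfDegree J k D (inclVars (n := n) S Q) := by
  classical
  have := Fintype.ofFinite ι
  have hL : Infinite L := inferInstance
  choose y c hc hy hyc using fun j : S => exists_normalized (ξ j)
  -- Outside `S` any vector with a coordinate 1 would do, as the incidence space imposes no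
  -- condition there.
  let x : ∀ i, Fin (n i + 1) → L := fun i => if hi : i ∈ S then y ⟨i, hi⟩ else 1
  have hx : ∀ i, ∃ s, x i s = 1 := fun i => by
    by_cases hi : i ∈ S
    · obtain ⟨s, hs⟩ := hy ⟨i, hi⟩
      refine ⟨s, ?_⟩
      simp only [x, dif_pos hi]
      exact hs
    · exact ⟨0, by simp [x, hi]⟩
  let f : Vars (fun j : S => n j) → Vars n ⊕ Empty := fun p => Sum.inl ⟨p.1.1, p.2⟩
  have hf : Function.Injective f := by
    rintro ⟨⟨a, ha⟩, b⟩ ⟨⟨a', ha'⟩, b'⟩ hab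
    obtain ⟨rfl, h2⟩ := Sigma.mk.inj_iff.1 (Sum.inl_injective hab)
    obtain rfl := eq_of_heq h2
    rfl
  have hG : Good (k := k) x (Finset.univ.filter (· ∈ S)) (⊤ : Submodule L (Empty → L))
      (rename f Q) := by
    refine ⟨?_, fun j hj => ?_⟩
    · convert hQ.isGen.rename hf using 1
      ext e
      change _ ↔ ∀ i : S, _
      rw [SetLike.mem_coe, mem_incidence]
      simp only [Finset.mem_filter, Finset.mem_univ, true_and, Submodule.mem_top, and_true,
        Subtype.forall]
      refine forall₂_congr fun j hj => ?_
      have h1 : ∑ a, x j a * e (Sum.inl ⟨j, a⟩) =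
          c ⟨j, hj⟩ * ∑ a, (e ∘ f) ⟨⟨j, hj⟩, a⟩ * (ξ ⟨j, hj⟩).rep a := by
        rw [Finset.mul_sum]
        refine Finset.sum_congr rfl fun a _ => ?_
        simp only [x, dif_pos hj, hyc, f, Function.comp]
        ring
      rw [h1, mul_eq_zero, or_iff_right (hc _)]
    · obtain ⟨a, ha⟩ := h.involves hQ.isGen ⟨j, by simpa using hj⟩
      refine ⟨a, ?_⟩
      rw [mem_vars_iff_degreeOf_ne_zero] at ha ⊢
      rwa [← degreeOf_rename_of_injective hf] at ha
  choose D hD using fun i => hG.exists_isSplittable hx i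
  refine ⟨D, ?_⟩
  convert hG.isResultantOfDegree hx J D (fun j _ => (hD j).1.1) (RingHom.id k) Empty.elim using 1
  have h1 : (spec (RingHom.id k) (Empty.elim : Empty → k)).comp (rename (R := k) f).toRingHom =
      (rename fun p : Vars (fun j : S => n j) => (⟨p.1.1, p.2⟩ : Vars n)).toRingHom :=
    ringHom_ext (fun a => by simp [spec_C]) fun p => by simp [f, spec_inl]
  exact (DFunLike.congr_fun h1 Q).symm

/-- Factorization, with constants as resultants of degrees zero. The case of zero is separate, since
every irreducible polynomial divides it. -/
theorem isResultant_of_forall_irreducible [Fintype ι] (R : MvPolynomial (Vars n) k)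
    (h : R ≠ 0 → ∀ P : MvPolynomial (Vars n) k, Irreducible P → P ∣ R →
      ∃ D : ι → ℕ, IsResultantOfDegree Finset.univ k D P) : IsResultant R := by
  induction R using WfDvdMonoid.induction_on_irreducible with
  | zero =>
    refine ⟨0, ?_⟩
    rw [← C_0]
    exact isResultantOfDegree_C (fun _ _ => rfl) 0
  | unit u hu =>
    obtain ⟨a, -, rfl⟩ := MvPolynomial.isUnit_iff_eq_C_of_isReduced.1 hu
    exact ⟨0, isResultantOfDegree_C (fun _ _ => rfl) a⟩
  | mul a i ha hi ih =>
    have hia := mul_ne_zero hi.ne_zero ha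
    obtain ⟨D, hD⟩ := h hia i hi (dvd_mul_right _ _)
    obtain ⟨D', hD'⟩ := ih fun _ P hP hPa => h hia P hP (hPa.mul_left _)
    exact ⟨_, hD.mul hD'⟩

end Families

/-! ### Algebraic closure and independence in an extension field -/

section Acl

open IntermediateField Set

variable (k : Type u) {L : Type v} [Field k] [Field L] [Algebra k L]

/-- The elements of `L` that are algebraic over `k(S)`. -/
def acl (S : Set L) : IntermediateField k L :=
  (algebraicClosure (adjoin k S) L).restrictScalars k

/-- `b` is algebraically independent over `k(S)`. -/
abbrev Ind {V : Type*} (S : Set L) (b : V → L) : Prop := AlgebraicIndependent (adjoin k S) b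

variable {k}

lemma mem_acl {S : Set L} {y : L} : y ∈ acl k S ↔ IsAlgebraic (adjoin k S) y := by
  rw [acl, IntermediateField.mem_restrictScalars, mem_algebraicClosure_iff]

/-- Makes the closure and exchange properties of the matroid of algebraic independence available. -/
lemma coe_acl (S : Set L) : (acl k S : Set L) = (AlgebraicIndependent.matroid k L).closure S := by
  rw [AlgebraicIndependent.matroid_closure_eq]
  ext y
  rw [SetLike.mem_coe, mem_acl, isAlgebraic_adjoin_iff]
  rfl

lemma subset_acl (S : Set L) : S ⊆ acl k S := by
  rw [coe_acl]
  exact (AlgebraicIndependent.matroid k L).subset_closure S (subset_univ _)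

lemma acl_mono {S T : Set L} (h : S ⊆ T) : acl k S ≤ acl k T := by
  rw [← SetLike.coe_subset_coe, coe_acl, coe_acl]
  exact Matroid.closure_subset_closure _ h

lemma acl_le {S T : Set L} (h : S ⊆ acl k T) : acl k S ≤ acl k T := by
  rw [coe_acl] at h
  rw [← SetLike.coe_subset_coe, coe_acl, coe_acl]
  exact Matroid.closure_subset_closure_of_subset_closure h

lemma mem_acl_exchange {S : Set L} {y z : L} (h : y ∈ acl k (insert z S)) (h' : y ∉ acl k S) :
    z ∈ acl k (insert y S) := by
  rw [← SetLike.mem_coe, coe_acl] at h h' ⊢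
  exact (Matroid.closure_exchange ⟨h, h'⟩).1

lemma acl_adjoin {S T : Set L} {y : L} : y ∈ acl (adjoin k S) T ↔ y ∈ acl k (S ∪ T) := by
  rw [mem_acl, mem_acl, ← adjoin_adjoin_left]
  rfl

lemma isAlgClosed_algebraicClosure (F E : Type*) [Field F] [Field E] [Algebra F E]
    [IsAlgClosed E] : IsAlgClosed (algebraicClosure F E) :=
  (algebraicClosure.isAlgClosure F E).isAlgClosed

instance isAlgClosed_acl [IsAlgClosed L] (S : Set L) : IsAlgClosed (acl k S) :=
  isAlgClosed_algebraicClosure (adjoin k S) L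

variable {V : Type*} {S T : Set L} {b : V → L}

lemma Ind.notMem (h : Ind k S b) {s : Set V} {v : V} (hv : v ∉ s) : b v ∉ acl k (S ∪ b '' s) := by
  rw [← acl_adjoin, mem_acl, isAlgebraic_adjoin_iff]
  exact h.transcendental_adjoin hv

lemma ind_of_notMem (h : ∀ v, b v ∉ acl k (S ∪ b '' {v}ᶜ)) : Ind k S b := by
  refine algebraicIndependent_of_finite_type' (algebraMap (adjoin k S) L).injective
    fun t _ _ i hi => ?_
  rw [← transcendental_adjoin_iff]
  intro hc
  refine h i (acl_mono (union_subset_union_right _ (image_mono ?_)) (acl_adjoin.1 (mem_acl.2 hc)))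
  rintro j hj rfl
  exact hi hj

lemma ind_iff : Ind k S b ↔ ∀ v, b v ∉ acl k (S ∪ b '' {v}ᶜ) :=
  ⟨fun h _ => h.notMem (by simp), ind_of_notMem⟩

lemma ind_empty_iff : Ind k (∅ : Set L) b ↔ AlgebraicIndependent k b := by
  rw [Ind, algebraicIndependent_adjoin_iff]
  rw [Algebra.adjoin_empty]
  exact (Algebra.IsAlgebraic.algebraicIndependent_iff k (⊥ : Subalgebra k L)).symm

lemma Ind.anti (h : Ind k T b) (hS : S ⊆ acl k T) : Ind k S b := by
  refine ind_of_notMem fun v hv => h.notMem (s := {v}ᶜ) (by simp) (acl_le ?_ hv)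
  refine union_subset (hS.trans (acl_mono subset_union_left)) ?_
  exact subset_union_right.trans (subset_acl _)

lemma ind_adjoin {b : V → L} : Ind (adjoin k S) T b ↔ Ind k (S ∪ T) b := by
  simp only [ind_iff, acl_adjoin, union_assoc]

lemma ind_sumElim_iff {U : Type*} {c : U → L} :
    Ind k S (Sum.elim b c) ↔ Ind k S b ∧ Ind k (S ∪ range b) c := by
  rw [← ind_adjoin]
  simp only [Ind]
  rw [algebraicIndependent_adjoin_iff (F := adjoin k S), ← AlgebraicIndependent.sumElim_iff,
    ← algebraicIndependent_equiv (Equiv.sumComm U V)]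
  have : Sum.elim b c ∘ ⇑(Equiv.sumComm U V) = Sum.elim c b := by ext (_ | _) <;> rfl
  rw [this]

/-- Rank count: `c` generates, up to algebraicity, at least as many independent elements as it has
members, so it is independent without repetitions. Most independence statements below come from such
a count. -/
lemma Ind.of_card_le {U : Type*} [Fintype V] [Fintype U] {c : U → L} (h : Ind k S b)
    (hbc : ∀ v, b v ∈ acl k (S ∪ range c)) (hcard : Fintype.card U ≤ Fintype.card V) :
    Ind k S c := by
  set F := adjoin k S
  let M := AlgebraicIndependent.matroid F L
  have h1 : M.Indep (range b) := AlgebraicIndependent.matroid_indep_iff.2 h.to_subtype_range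
  have h2 : (Fintype.card V : ℕ∞) ≤ M.eRk (range c) := by
    rw [← M.eRk_closure_eq]
    have h3 : range b ⊆ M.closure (range c) := by
      rw [← coe_acl]
      rintro _ ⟨v, rfl⟩
      exact acl_adjoin.2 (hbc v)
    refine le_trans ?_ (h1.encard_le_eRk_of_subset h3)
    rw [← image_univ, h.injective.encard_image, encard_univ, ENat.card_eq_coe_fintype_card]
  have h4 : (range c).encard ≤ Fintype.card U := by
    rw [← image_univ, ← ENat.card_eq_coe_fintype_card, ← encard_univ]
    exact encard_image_le _ _
  have h5 := M.eRk_le_encard (range c)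
  have hcard' : (Fintype.card U : ℕ∞) ≤ Fintype.card V := by exact_mod_cast hcard
  have h6 : M.Indep (range c) := by
    rw [Matroid.indep_iff_eRk_eq_encard_of_finite (finite_range c)]
    exact le_antisymm h5 (h4.trans (hcard'.trans h2))
  have h7 : Function.Injective c := by
    rw [← injOn_univ]
    refine (finite_univ).injOn_of_encard_image_eq ?_
    rw [image_univ, encard_univ, ENat.card_eq_coe_fintype_card]
    exact le_antisymm h4 (hcard'.trans (h2.trans h5))
  exact (algebraicIndependent_subtype_range h7).1 (AlgebraicIndependent.matroid_indep_iff.1 h6)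

lemma Ind.card_le {U : Type*} [Fintype V] [Fintype U] {c : U → L} (h : Ind k S b)
    (hbc : ∀ v, b v ∈ acl k (S ∪ range c)) : Fintype.card V ≤ Fintype.card U := by
  by_contra! hlt
  let d : Option U → L := fun o => o.elim 0 c
  have h1 : Ind k S d := h.of_card_le (fun v => acl_mono (union_subset_union_right _ (by
    rintro _ ⟨u, rfl⟩; exact ⟨some u, rfl⟩)) (hbc v)) (by rw [Fintype.card_option]; exact hlt)
  refine h1.notMem (s := ∅) (v := none) (by simp) ?_
  exact zero_mem _

/-- The members of `b` are removed one by one. If `y` really needed `b v`, exchange would make `b v`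
algebraic over `S ∪ T` and the remaining members. -/
lemma Ind.mem_acl_of_mem (h : Ind k (S ∪ T) b) [Finite V] {y : L}
    (h1 : y ∈ acl k (S ∪ range b)) (h2 : y ∈ acl k (S ∪ T)) : y ∈ acl k S := by
  classical
  have := Fintype.ofFinite V
  have key : ∀ s : Finset V, y ∈ acl k (S ∪ b '' s) → y ∈ acl k S := by
    intro s
    induction s using Finset.induction_on with
    | empty => simp
    | insert v s hv ih =>
      intro hy
      by_contra hc
      rw [Finset.coe_insert, image_insert_eq, union_insert] at hy
      have h3 := mem_acl_exchange hy fun h => hc (ih h)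
      refine h.notMem (s := s) (v := v) (by simpa using hv) (acl_le ?_ h3)
      refine insert_subset ?_ (union_subset ?_ ?_)
      · exact acl_mono subset_union_left h2
      · exact (subset_union_left.trans subset_union_left).trans (subset_acl _)
      · exact subset_union_right.trans (subset_acl _)
  exact key Finset.univ (by simpa using h1)

/-- If a transcendence basis over `k(S)` were finite, `L` would have finite transcendence degree
over `k`. -/
lemma exists_ind (hL : Cardinal.aleph0 ≤ Algebra.trdeg k L) (hS : S.Finite) (V : Type*)
    [Finite V] : ∃ b : V → L, Ind k S b := by
  set F := adjoin k S
  obtain ⟨s, hs⟩ := exists_isTranscendenceBasis F L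
  have hinf : Infinite s := by
    by_contra hfin
    rw [not_infinite_iff_finite] at hfin
    have hfin' : (S ∪ s).Finite := hS.union (toFinite s)
    have : Algebra.IsAlgebraic (Algebra.adjoin k (S ∪ s)) L := by
      have h1 := hs.isAlgebraic
      rw [Subtype.range_coe] at h1
      refine ⟨fun y => ?_⟩
      rw [← isAlgebraic_adjoin_iff, ← mem_acl, ← acl_adjoin, mem_acl, isAlgebraic_adjoin_iff]
      exact h1.isAlgebraic y
    have h2 := Algebra.IsAlgebraic.trdeg_le_cardinalMk k (S ∪ s : Set L)
    exact absurd (hL.trans h2) (not_le.2 (Cardinal.lt_aleph0_iff_finite.2 hfin'))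
  obtain ⟨f⟩ : Nonempty (V ↪ s) :=
    ⟨((Finite.equivFin V).toEmbedding.trans Fin.valEmbedding).trans (Infinite.natEmbedding s)⟩
  exact ⟨fun v => f v, hs.1.comp _ f.injective⟩

lemma Ind.algebraicIndependent_acl (h : Ind k S b) : AlgebraicIndependent (acl k S) b :=
  AlgebraicIndependent.algebraicClosure h

lemma mem_acl_acl {y : L} (h : y ∈ acl k (S ∪ T)) : y ∈ acl (acl k S) T := by
  rw [mem_acl] at h ⊢
  have h1 : adjoin k (S ∪ T) ≤ (adjoin (acl k S) T).restrictScalars k := by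
    rw [adjoin_le_iff]
    refine union_subset (fun a ha => ?_) (subset_adjoin _ _)
    exact (adjoin (acl k S) T).algebraMap_mem ⟨a, subset_acl S ha⟩
  exact IsAlgebraic.ringHom_of_comp_eq (S := adjoin (acl k S) T)
    (IntermediateField.inclusion h1).toRingHom (RingHom.id L) h
    (IntermediateField.inclusion h1).toRingHom.injective (RingHom.ext fun _ => rfl)

/-- `K` is algebraic over the polynomial ring in `b`, so the embedding of this ring given by `b'`
extends to the algebraically closed field `N`. -/
lemma exists_algHom_of_algebraicIndependent {M K N : Type*} [Field M] [Field K] [Field N]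
    [Algebra M K] [Algebra M N] [Algebra K N] [IsScalarTower M K N] [IsAlgClosed N]
    {b : V → K} {b' : V → N} (hN : AlgebraicIndependent M fun v => algebraMap K N (b v))
    (h' : AlgebraicIndependent M b') (halg : ∀ y : K,
      IsAlgebraic (Algebra.adjoin M (range fun v => algebraMap K N (b v))) (algebraMap K N y)) :
    ∃ σ : K →ₐ[M] N, ∀ v, σ (b v) = b' v := by
  have h : AlgebraicIndependent M b := (AlgHom.algebraicIndependent_iff
    (IsScalarTower.toAlgHom M K N) (algebraMap K N).injective).1 hN
  have hP : ∀ p, algebraMap K N (aeval b p) = aeval (fun v => algebraMap K N (b v)) p :=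
    fun p => (aeval_algebraMap_apply (R := M) N b p).symm
  let P := MvPolynomial V M
  let _ : Algebra P K := (aeval (R := M) b).toRingHom.toAlgebra
  let _ : Algebra P N := (aeval (R := M) b').toRingHom.toAlgebra
  have : IsScalarTower M P K := .of_algebraMap_eq fun a => (aeval_C b a).symm
  have : IsScalarTower M P N := .of_algebraMap_eq fun a => (aeval_C b' a).symm
  have : Module.IsTorsionFree P K := (Module.isTorsionFree_iff_algebraMap_injective).2 h
  have : Module.IsTorsionFree P N := (Module.isTorsionFree_iff_algebraMap_injective).2 h'
  have : Algebra.IsAlgebraic P K := ⟨fun y =>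
    IsAlgebraic.of_ringHom_of_comp_eq
      (S := Algebra.adjoin M (range fun v => algebraMap K N (b v)))
      (hN.aevalEquiv : P →+* Algebra.adjoin M (range fun v => algebraMap K N (b v)))
      (algebraMap K N) (halg y) hN.aevalEquiv.surjective
      (algebraMap K N).injective (RingHom.ext fun p => (hP p).symm)⟩
  let σ : K →ₐ[P] N := IsAlgClosed.lift
  refine ⟨σ.restrictScalars M, fun v => ?_⟩
  have h1 : algebraMap P K (X v) = b v := aeval_X (R := M) b v
  have h2 : algebraMap P N (X v) = b' v := aeval_X (R := M) b' v
  rw [← h1, ← h2]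
  exact σ.commutes (X v)

lemma exists_algHom_of_le [IsAlgClosed L] {M K : IntermediateField k L}
    (hMK : M ≤ K) {b b' : V → L} (hb : ∀ v, b v ∈ K) (h : AlgebraicIndependent M b)
    (h' : AlgebraicIndependent M b')
    (halg : ∀ y ∈ K, IsAlgebraic (Algebra.adjoin M (range b)) y) :
    ∃ σ : K →ₐ[k] L, (∀ y (hy : y ∈ M), σ ⟨y, hMK hy⟩ = y) ∧ ∀ v, σ ⟨b v, hb v⟩ = b' v := by
  let _ : Algebra M K := (IntermediateField.inclusion hMK).toRingHom.toAlgebra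
  have : IsScalarTower M K L := .of_algebraMap_eq fun _ => rfl
  have : IsScalarTower k M K := .of_algebraMap_eq fun _ => rfl
  obtain ⟨σ, hσ⟩ := exists_algHom_of_algebraicIndependent (K := K)
    (b := fun v => ⟨b v, hb v⟩) h h' fun y => halg y y.2
  exact ⟨σ.restrictScalars k, fun y hy => σ.commutes ⟨y, hy⟩, hσ⟩

lemma mem_acl_image_iff {K : Type*} [Field K] [Algebra k K] (σ : K →ₐ[k] L) {B : Set K} {y : K} :
    σ y ∈ acl k (σ '' B) ↔ y ∈ acl k B := by
  have hmap : (adjoin k B).map σ = adjoin k (σ '' B) := adjoin_map k B σ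
  let f : adjoin k B →+* adjoin k (σ '' B) :=
    ((σ : K →+* L).comp (algebraMap (adjoin k B) K)).codRestrict (adjoin k (σ '' B)) fun y => by
      rw [← hmap]
      exact ⟨y, y.2, rfl⟩
  have hf : Function.Surjective f := by
    rintro ⟨y, hy⟩
    rw [← hmap] at hy
    obtain ⟨z, hz, rfl⟩ := hy
    exact ⟨⟨z, hz⟩, rfl⟩
  rw [mem_acl, mem_acl]
  constructor
  · intro h
    exact IsAlgebraic.of_ringHom_of_comp_eq (S := adjoin k (σ '' B)) f (σ : K →+* L) h hf
      (σ : K →+* L).injective (RingHom.ext fun _ => rfl)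
  · intro h
    exact IsAlgebraic.ringHom_of_comp_eq (S := adjoin k (σ '' B)) f (σ : K →+* L) h
      f.injective (RingHom.ext fun _ => rfl)

lemma exists_algHom_transport {S : Set L} {M : IntermediateField k L}
    (σ : M →ₐ[k] L) (hS : S ⊆ M) {y : L} (hy : y ∈ acl k S) (hyM : y ∈ M) :
    σ ⟨y, hyM⟩ ∈ acl k {z | ∃ u, ∃ hu : u ∈ S, z = σ ⟨u, hS hu⟩} := by
  have h1 : M.val '' (M.val ⁻¹' S) = S := by
    rw [image_preimage_eq_iff]
    intro u hu
    exact ⟨⟨u, hS hu⟩, rfl⟩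
  rw [← h1] at hy
  have h2 := (mem_acl_image_iff M.val (B := M.val ⁻¹' S) (y := ⟨y, hyM⟩)).1 hy
  refine acl_mono ?_ ((mem_acl_image_iff σ).2 h2)
  rintro _ ⟨u, hu, rfl⟩
  exact ⟨u, hu, rfl⟩

/-- Independent families can be exchanged by a morphism. -/
lemma Ind.exists_algHom [IsAlgClosed L] {b' : V → L} (h : Ind k S b) (h' : Ind k S b') :
    ∃ σ : acl k (S ∪ range b) →ₐ[k] L, (∀ y (hy : y ∈ acl k S),
      σ ⟨y, acl_mono subset_union_left hy⟩ = y) ∧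
      ∀ A : Set L, A ⊆ acl k S → ∀ y, y ∈ acl k (A ∪ range b) →
        ∀ hy : y ∈ acl k (S ∪ range b), σ ⟨y, hy⟩ ∈ acl k (A ∪ range b') := by
  obtain ⟨σ, h1, h2⟩ := exists_algHom_of_le (K := acl k (S ∪ range b))
    (acl_mono subset_union_left) (fun v => subset_acl _ (Or.inr ⟨v, rfl⟩))
    h.algebraicIndependent_acl h'.algebraicIndependent_acl fun y hy => by
      rw [← isAlgebraic_adjoin_iff, ← mem_acl]
      exact mem_acl_acl hy
  refine ⟨σ, h1, fun A hA y hy hyM => ?_⟩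
  have hsub : A ∪ range b ⊆ acl k (S ∪ range b) := union_subset
    (hA.trans (acl_mono subset_union_left)) (subset_union_right.trans (subset_acl _))
  refine acl_mono ?_ (exists_algHom_transport σ hsub hy hyM)
  rintro _ ⟨u, hu | ⟨v, rfl⟩, rfl⟩
  · rw [h1 u (hA hu)]
    exact Or.inl hu
  · exact Or.inr ⟨v, (h2 v).symm⟩

lemma Ind.eq_zero_of_sum [Fintype V] (h : Ind k S b) {c : V → L} (hc : ∀ v, c v ∈ acl k S)
    (h0 : ∑ v, c v * b v = 0) (v : V) : c v = 0 := by
  have h1 := Fintype.linearIndependent_iff.1 h.algebraicIndependent_acl.linearIndependent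
    (fun v => ⟨c v, hc v⟩) h0 v
  exact congrArg Subtype.val h1

lemma Ind.comm {U : Type*} {c : U → L} (hb : Ind k S b) (hc : Ind k (S ∪ range b) c) :
    Ind k (S ∪ range c) b := by
  have h1 := ind_sumElim_iff.2 ⟨hb, hc⟩
  have h2 : Sum.elim b c ∘ (Equiv.sumComm U V) = Sum.elim c b := by ext (_ | _) <;> rfl
  have h3 : Ind k S (Sum.elim c b) := by
    rw [← h2]
    exact h1.comp _ (Equiv.sumComm U V).injective
  exact (ind_sumElim_iff.1 h3).2

lemma mem_of_sum_mul_eq_zero {M : IntermediateField k L} [Fintype V] {z μ : V → L}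
    {s : V} (hz : ∀ a, z a ∈ M) (hs : z s = 1) (hμ : ∀ a, a ≠ s → μ a ∈ M)
    (h : ∑ a, z a * μ a = 0) : μ s ∈ M := by
  classical
  rw [← Finset.add_sum_erase _ _ (Finset.mem_univ s), hs, one_mul] at h
  rw [eq_neg_of_add_eq_zero_left h]
  exact neg_mem (sum_mem fun a ha => mul_mem (hz a) (hμ a (Finset.ne_of_mem_erase ha)))

end Acl

/-! ### Splittings inside algebraically closed subfields -/

section Value

/-- Over a domain, the formula that defines the wedge holds in every universe. -/
theorem IsWedge.value {n : ℕ} {A : Type u} [CommRing A] [IsDomain A] {d D : ℕ}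
    {f g : MvPolynomial (Fin (n + 1)) A} {w : A} (h : IsWedge d D f g w) (hg : IsSplittable D g)
    (hf : f.IsHomogeneous d) {K : Type*} [Field K] [IsAlgClosed K] (ψ : A →+* K) {y : K}
    {x : Fin D → Fin (n + 1) → K} (hψ : map ψ g = C y * ∏ t, lin (x t)) :
    ψ w = y ^ d * ∏ t, eval (x t) (map ψ f) := by
  let i : A →+* AlgebraicClosure (FractionRing A) := (algebraMap (FractionRing A) _).comp
    (algebraMap A (FractionRing A))
  have hi : Function.Injective i := (algebraMap (FractionRing A) _).injective.comp
    (IsFractionRing.injective A (FractionRing A))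
  -- The definition is used in an algebraic closure of the fraction field of `A`, which lies in the
  -- right universe; that splitting then specializes to `K`.
  obtain ⟨y₀, x₀, h₀⟩ := hg.exists_splitting i
  obtain ⟨y', x', h1, h2⟩ := exists_splitting_specialization i ψ
    (by rw [(RingHom.injective_iff_ker_eq_bot i).1 hi]; exact bot_le) h₀
  rw [h2 d f w hf (h _ i y₀ x₀ h₀)]
  exact eval_vero_unique (h1.symm.trans hψ) (hf.map ψ)

variable {k : Type u} {L : Type v} [Field k] [Field L] [Algebra k L] [IsAlgClosed L]

/-- The relative algebraic closure is itself algebraically closed, so the splitting is found inside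
it. -/
lemma IsSplittable.exists_splitting_acl {m D : ℕ} {A : Type*} [CommRing A]
    {g : MvPolynomial (Fin (m + 1)) A} (hg : IsSplittable D g) {S : Set L} (ψ : A →+* L)
    (hψ : ∀ a, ψ a ∈ acl k S) : ∃ (y : L) (x : Fin D → Fin (m + 1) → L),
      (∀ t a, x t a ∈ acl k S) ∧ MvPolynomial.map ψ g = C y * ∏ t, lin (x t) := by
  obtain ⟨y, x, h⟩ := hg.exists_splitting (ψ.codRestrict (acl k S) hψ)
  refine ⟨y, fun t a => x t a, fun t a => (x t a).2, ?_⟩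
  have h1 := congrArg (MvPolynomial.map (algebraMap (acl k S) L)) h
  rw [map_map, map_mul, map_prod, map_C] at h1
  simp only [map_lin] at h1
  exact h1

lemma exists_normalized_of_ne_zero {m : ℕ} {M : IntermediateField k L} {x : Fin (m + 1) → L}
    (hx : x ≠ 0) (hM : ∀ a, x a ∈ M) :
    ∃ (z : Fin (m + 1) → L) (s : Fin (m + 1)) (c : L), c ≠ 0 ∧ z s = 1 ∧ x = c • z ∧
      ∀ a, z a ∈ M := by
  obtain ⟨s, hs⟩ := Function.ne_iff.1 hx
  refine ⟨fun a => x a / x s, s, x s, hs, div_self hs, ?_, fun a => div_mem (hM a) (hM s)⟩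
  funext a
  exact (mul_div_cancel₀ _ hs).symm

lemma eval₂Hom_mem {A V : Type*} [CommRing A] {M : IntermediateField k L} {φ : A →+* L}
    {c : V → L} (hφ : ∀ a, φ a ∈ M) (hc : ∀ v, c v ∈ M) (P : MvPolynomial V A) :
    eval₂Hom φ c P ∈ M := by
  induction P using MvPolynomial.induction_on with
  | C a => rw [eval₂Hom_C]; exact hφ a
  | add p q hp hq => rw [map_add]; exact add_mem hp hq
  | mul_X p v hp => rw [map_mul, eval₂Hom_X']; exact mul_mem hp (hc v)

lemma exists_point_of_eval_eq_zero {m D : ℕ} {y : L} {x : Fin D → Fin (m + 1) → L}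
    {M : IntermediateField k L} (hM : ∀ t a, x t a ∈ M) {μ : Fin (m + 1) → L}
    (h0 : C y * ∏ t, lin (x t) ≠ 0) (hμ : eval μ (C y * ∏ t, lin (x t)) = 0) :
    ∃ (z : Fin (m + 1) → L) (s : Fin (m + 1)) (t : Fin D) (c : L), z s = 1 ∧ x t = c • z ∧
      (∀ a, z a ∈ M) ∧ ∑ a, z a * μ a = 0 := by
  have hy : y ≠ 0 := by rintro rfl; simp at h0
  rw [map_mul, eval_C, map_prod, mul_eq_zero, or_iff_right hy, Finset.prod_eq_zero_iff] at hμ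
  obtain ⟨t, -, ht⟩ := hμ
  have hxt : x t ≠ 0 := fun h => h0 (by
    rw [Finset.prod_eq_zero (Finset.mem_univ t) (lin_eq_zero.2 h), mul_zero])
  obtain ⟨z, s, c, hc, hs, hz, hzM⟩ := exists_normalized_of_ne_zero hxt (hM t)
  refine ⟨z, s, t, c, hs, hz, hzM, ?_⟩
  rw [eval_lin, hz] at ht
  simp only [Pi.smul_apply, smul_eq_mul, mul_assoc, ← Finset.mul_sum] at ht
  exact (mul_eq_zero.1 ht).resolve_left hc

end Value

/-! ### Replacing the values of one group -/

section SetGroup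

variable {ι : Type w} [DecidableEq ι] {n : ι → ℕ} {A : Type u} [CommRing A]
  {B : Type*} [CommRing B]

/-- Replaces the group `i` of values of the indeterminates. -/
def setGroup (c : Vars n → B) (i : ι) (μ : Fin (n i + 1) → B) : Vars n → B := fun p =>
  if h : p.1 = i then μ (Fin.cast (congrArg (fun j => n j + 1) h) p.2) else c p

lemma setGroup_self (c : Vars n → B) (i : ι) (μ : Fin (n i + 1) → B) (a : Fin (n i + 1)) :
    setGroup c i μ ⟨i, a⟩ = μ a := by simp [setGroup]

lemma setGroup_of_ne (c : Vars n → B) {i : ι} (μ : Fin (n i + 1) → B) {p : Vars n}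
    (h : p.1 ≠ i) : setGroup c i μ p = c p := by simp [setGroup, h]

lemma map_asPolyHom_eq {i : ι} (φ : A →+* B) {c c' : Vars n → B} (h : ∀ p, p.1 ≠ i → c p = c' p)
    (R : MvPolynomial (Vars n) A) : map (eval₂Hom φ c) (asPolyHom A n i R) =
      map (eval₂Hom φ c') (asPolyHom A n i R) := by
  have h1 : (map (eval₂Hom φ c)).comp (asPolyHom A n i) =
      (map (eval₂Hom φ c')).comp (asPolyHom A n i) := by
    refine ringHom_ext (fun a => by simp [asPolyHom_C]) ?_
    rintro ⟨j, a⟩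
    by_cases hj : j = i
    · subst hj
      simp [asPolyHom_X_self]
    · simp [asPolyHom_X_of_ne (p := ⟨j, a⟩) hj, h ⟨j, a⟩ hj]
  exact DFunLike.congr_fun h1 R

lemma eval_map_asPolyHom {i : ι} (φ : A →+* B) (c : Vars n → B) (μ : Fin (n i + 1) → B)
    (R : MvPolynomial (Vars n) A) : eval μ (map (eval₂Hom φ c) (asPolyHom A n i R)) =
      eval₂Hom φ (setGroup c i μ) R := by
  have h1 : ((eval μ).comp (map (eval₂Hom φ c))).comp (asPolyHom A n i) =
      eval₂Hom φ (setGroup c i μ) := by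
    refine ringHom_ext (fun a => by simp [asPolyHom_C]) ?_
    rintro ⟨j, a⟩
    by_cases hj : j = i
    · subst hj
      simp [asPolyHom_X_self, setGroup_self]
    · simp [asPolyHom_X_of_ne (p := ⟨j, a⟩) hj, setGroup_of_ne (p := ⟨j, a⟩) c μ hj]
  exact DFunLike.congr_fun h1 R

lemma card_ne_add [Fintype ι] (i : ι) :
    Fintype.card {p : Vars n // p.1 ≠ i} + (n i + 1) = Fintype.card (Vars n) := by
  rw [← Fintype.card_congr (Equiv.sumCompl fun p : Vars n => p.1 = i), Fintype.card_sum, add_comm]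
  refine congrArg (· + _) ?_
  rw [← Fintype.card_fin (n i + 1)]
  refine Fintype.card_congr ⟨fun a => ⟨⟨i, a⟩, rfl⟩,
    fun p => Fin.cast (congrArg (fun j => n j + 1) p.2) p.1.2, fun a => rfl, ?_⟩
  rintro ⟨⟨j, a⟩, rfl⟩
  rfl

lemma card_ne_ne_add [Fintype ι] {i j : ι} (hij : i ≠ j) :
    Fintype.card {p : Vars n // p.1 ≠ i ∧ p.1 ≠ j} + (n j + 1) =
      Fintype.card {p : Vars n // p.1 ≠ i} := by
  rw [← Fintype.card_congr (Equiv.sumCompl fun p : {p : Vars n // p.1 ≠ i} => p.1.1 = j),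
    Fintype.card_sum, add_comm]
  refine congrArg₂ (· + ·) ?_ ?_
  swap
  · exact Fintype.card_congr ⟨fun p => ⟨⟨p.1, p.2.1⟩, p.2.2⟩, fun p => ⟨p.1.1, p.1.2, p.2⟩,
      fun _ => rfl, fun _ => rfl⟩
  · rw [← Fintype.card_fin (n j + 1)]
    refine Fintype.card_congr ⟨fun a => ⟨⟨⟨j, a⟩, hij.symm⟩, rfl⟩,
      fun p => Fin.cast (congrArg (fun j => n j + 1) p.2) p.1.1.2, fun a => rfl, ?_⟩
    rintro ⟨⟨⟨l, a⟩, hl⟩, rfl⟩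
    rfl

lemma card_fin_ne {m : ℕ} (s : Fin (m + 1)) : Fintype.card {r : Fin (m + 1) // r ≠ s} = m := by
  simp

end SetGroup

/-! ### The point attached to a group of a zero of `R` -/

section Point

variable {k : Type u} {L : Type v} [Field k] [Field L] [Algebra k L] [IsAlgClosed L]
  {ι : Type w} [DecidableEq ι] {n : ι → ℕ}

/-- The values of the indeterminates outside the group `i`. -/
def offGroup (l : Vars n → L) (i : ι) : {p : Vars n // p.1 ≠ i} → L := fun p => l p

/-- The values of the indeterminates outside the groups `i` and `j`. -/
def offGroups (l : Vars n → L) (i j : ι) : {p : Vars n // p.1 ≠ i ∧ p.1 ≠ j} → L := fun p => l p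

/-- The values of the indeterminates in the group `i`. -/
def group (l : Vars n → L) (i : ι) : Fin (n i + 1) → L := fun a => l ⟨i, a⟩

lemma setGroup_group (l : Vars n → L) (i : ι) : setGroup l i (group l i) = l := by
  funext ⟨j, a⟩
  by_cases hj : j = i
  · subst hj
    exact setGroup_self _ _ _ _
  · exact setGroup_of_ne (p := ⟨j, a⟩) _ _ hj

lemma mem_range_offGroup {l : Vars n → L} {i : ι} {p : Vars n} (h : p.1 ≠ i) :
    l p ∈ Set.range (offGroup l i) := ⟨⟨p, h⟩, rfl⟩

lemma mem_range_offGroups {l : Vars n → L} {i j : ι} {p : Vars n} (h : p.1 ≠ i) (h' : p.1 ≠ j) :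
    l p ∈ Set.range (offGroups l i j) := ⟨⟨p, h, h'⟩, rfl⟩

lemma range_offGroup_subset (l : Vars n → L) (i : ι) :
    Set.range (offGroup l i) ⊆ Set.range l := by
  rintro _ ⟨p, rfl⟩
  exact ⟨p, rfl⟩

lemma offGroup_eq (l : Vars n → L) {i j : ι} (h : i ≠ j) :
    Set.range (offGroup l i) = Set.range (offGroups l i j) ∪ Set.range (group l j) := by
  ext y
  constructor
  · rintro ⟨⟨⟨a, b⟩, hp⟩, rfl⟩
    by_cases ha : a = j
    · subst ha
      exact Or.inr ⟨b, rfl⟩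
    · exact Or.inl ⟨⟨⟨a, b⟩, hp, ha⟩, rfl⟩
  · rintro (⟨p, rfl⟩ | ⟨a, rfl⟩)
    · exact ⟨⟨p, p.2.1⟩, rfl⟩
    · exact ⟨⟨⟨j, a⟩, h.symm⟩, rfl⟩

lemma ind_setGroup [Fintype ι] {l : Vars n → L} {i : ι} {S : Set L} (h : Ind k S (offGroup l i))
    {μ : Fin (n i + 1) → L} (hμ : Ind k (S ∪ Set.range (offGroup l i)) μ) :
    Ind k S (setGroup l i μ) := by
  refine (ind_sumElim_iff.2 ⟨h, hμ⟩).of_card_le ?_ ?_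
  · rintro (⟨p, hp⟩ | a)
    · refine subset_acl _ (Or.inr ⟨p, ?_⟩)
      rw [setGroup_of_ne l μ hp]
      rfl
    · exact subset_acl _ (Or.inr ⟨⟨i, a⟩, setGroup_self l i μ a⟩)
  · rw [Fintype.card_sum, Fintype.card_fin, card_ne_add]

/-- Independent values in group `i` complete the given ones to a point at which no nonzero
polynomial over `k` vanishes. -/
lemma map_asPolyHom_ne_zero [Fintype ι] (hL : Cardinal.aleph0 ≤ Algebra.trdeg k L)
    {R : MvPolynomial (Vars n) k} (hR : R ≠ 0) {l : Vars n → L} {i : ι}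
    (h : Ind k (∅ : Set L) (offGroup l i)) :
    map (eval₂Hom (algebraMap k L) l) (asPolyHom k n i R) ≠ 0 := by
  intro h0
  obtain ⟨μ, hμ⟩ := exists_ind hL (S := ∅ ∪ Set.range (offGroup l i))
    (by simpa using Set.finite_range _) (Fin (n i + 1))
  have h1 := eval_map_asPolyHom (algebraMap k L) l μ R
  rw [h0, map_zero] at h1
  exact hR ((injective_iff_map_eq_zero _).1 (ind_empty_iff.1 (ind_setGroup h hμ)) R h1.symm)

/-- A point of projective space at which the values of a group vanish. -/
structure IsPoint (l : Vars n → L) (i : ι) (x : Fin (n i + 1) → L) (s : Fin (n i + 1)) : Prop where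
  mem : ∀ a, x a ∈ acl k (Set.range (offGroup l i))
  pivot : x s = 1
  sum_eq_zero : ∑ a, x a * l ⟨i, a⟩ = 0

/-- In group `i`, and over the algebraic closure of the field of the other values, `R` is a nonzero
product of linear factors; one of them vanishes at `l`. -/
lemma exists_isPoint [Fintype ι] (hL : Cardinal.aleph0 ≤ Algebra.trdeg k L)
    {R : MvPolynomial (Vars n) k} (hR : R ≠ 0) {l : Vars n → L} (hl : aeval l R = 0) {i : ι}
    (h : Ind k (∅ : Set L) (offGroup l i)) {D : ℕ} (hD : IsSplittable D (asPolyHom k n i R)) :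
    ∃ x s, IsPoint (k := k) l i x s ∧ ∃ (y : L) (x' : Fin D → Fin (n i + 1) → L) (t : Fin D) (c : L),
      map (eval₂Hom (algebraMap k L) l) (asPolyHom k n i R) = C y * ∏ t, lin (x' t) ∧
      x' t = c • x := by
  -- The coefficients do not involve group `i`; zeros there keep every value in the required field.
  let c₀ : Vars n → L := setGroup l i 0
  have hc₀ : map (eval₂Hom (algebraMap k L) l) (asPolyHom k n i R) =
      map (eval₂Hom (algebraMap k L) c₀) (asPolyHom k n i R) :=
    map_asPolyHom_eq _ (fun p hp => (setGroup_of_ne l 0 hp).symm) R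
  obtain ⟨y, x', hx', hs⟩ := IsSplittable.exists_splitting_acl hD (k := k) (S := Set.range (offGroup l i))
    (eval₂Hom (algebraMap k L) c₀) (eval₂Hom_mem (fun a => (acl k _).algebraMap_mem a)
      fun p => by
        by_cases hp : p.1 = i
        · obtain ⟨j, a⟩ := p
          obtain rfl := hp
          simp only [c₀, setGroup_self, Pi.zero_apply]
          exact zero_mem _
        · simp only [c₀, setGroup_of_ne l 0 hp]
          exact subset_acl _ (mem_range_offGroup hp))
  rw [← hc₀] at hs
  have h0 := map_asPolyHom_ne_zero hL hR h
  rw [hs] at h0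
  obtain ⟨x, s, t, c, h1, h2, h3, h4⟩ := exists_point_of_eval_eq_zero hx' h0
    (μ := group l i) (by
      rw [← hs, eval_map_asPolyHom, setGroup_group]
      exact hl)
  exact ⟨x, s, ⟨h3, h1, h4⟩, y, x', t, c, hs, h2⟩

end Point

/-! ### Forms that vanish at a point -/

section Forms

open Set

/-- The exponent `d - q` at the coordinate `s` and `q` at the coordinate `r`. -/
def expoPair {m : ℕ} (d : ℕ) (s r : Fin (m + 1)) (q : Fin (d + 1)) : Expo m d :=
  ⟨Finsupp.single s (d - q) + Finsupp.single r q.1, by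
    rw [Finset.mem_finsuppAntidiag]
    refine ⟨?_, Finset.subset_univ _⟩
    change ∑ a, (Finsupp.single s (d - q.1) + Finsupp.single r q.1 : Fin (m + 1) →₀ ℕ) a = d
    have h : ∀ (t : Fin (m + 1)) (p : ℕ), ∑ a, Finsupp.single t p a = p := fun t p => by
      simp [Finsupp.single_apply]
    simp only [Finsupp.add_apply, Finset.sum_add_distrib, h]
    have := q.2
    omega⟩

lemma vero_expoPair {A : Type*} [CommRing A] {m d : ℕ} (s r : Fin (m + 1)) (q : Fin (d + 1))
    (x : Fin (m + 1) → A) : vero d x (expoPair d s r q) = x s ^ (d - q.1) * x r ^ q.1 := by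
  have h : ∀ (t : Fin (m + 1)) (p : ℕ), ∏ a, x a ^ (Finsupp.single t p a) = x t ^ p := fun t p => by
    rw [Finset.prod_eq_single t]
    · simp
    · intro b _ hb
      simp [hb.symm]
    · simp
  simp only [vero, expoPair, Finsupp.add_apply, pow_add, Finset.prod_mul_distrib, h]

lemma expoPair_injective {m d : ℕ} {s r : Fin (m + 1)} (h : r ≠ s) :
    Function.Injective (expoPair d s r) := by
  intro q q' hq
  have := DFunLike.congr_fun (congrArg Subtype.val hq) r
  simp only [expoPair, Finsupp.add_apply, Finsupp.single_apply, if_neg h.symm, if_true,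
    zero_add] at this
  exact Fin.ext this

variable {k : Type u} {L : Type v} [Field k] [Field L] [Algebra k L]

/-- Modifies the coordinate `s` so that the linear relation with coefficients `v` holds. -/
def onPerp {E : Type*} [Fintype E] [DecidableEq E] (v : E → L) (s : E) (T : E → L) : E → L :=
  fun e => if e = s then -∑ e' ∈ Finset.univ.erase s, v e' * T e' else T e

lemma sum_mul_onPerp {E : Type*} [Fintype E] [DecidableEq E] {v : E → L} {s : E} (hs : v s = 1)
    (T : E → L) : ∑ e, v e * onPerp v s T e = 0 := by
  rw [← Finset.add_sum_erase _ _ (Finset.mem_univ s), hs, one_mul, onPerp, if_pos rfl,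
    neg_add_eq_zero]
  refine Finset.sum_congr rfl fun e he => ?_
  rw [onPerp, if_neg (Finset.ne_of_mem_erase he)]

lemma onPerp_of_ne {E : Type*} [Fintype E] [DecidableEq E] {v : E → L} {s e : E} (h : e ≠ s)
    (T : E → L) : onPerp v s T e = T e := if_neg h

lemma vero_mem {m d : ℕ} {M : IntermediateField k L} {x : Fin (m + 1) → L} (h : ∀ a, x a ∈ M)
    (β : Expo m d) : vero d x β ∈ M := prod_mem fun a _ => pow_mem (h a) _

variable {ι : Type w} [DecidableEq ι] {n : ι → ℕ} {l : Vars n → L} {i j : ι}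

lemma ind_group (hij : i ≠ j) (hi : Ind k (∅ : Set L) (offGroup l i)) :
    Ind k (range (offGroups l i j)) (group l j) := by
  refine ind_of_notMem fun r hr => hi.notMem (v := ⟨⟨j, r⟩, hij.symm⟩)
    (s := {p | p.1 ≠ ⟨j, r⟩}) (by simp) (acl_mono ?_ hr)
  rintro _ (⟨p, rfl⟩ | ⟨a, ha, rfl⟩)
  · refine Or.inr ⟨⟨p, p.2.1⟩, ?_, rfl⟩
    rintro h
    exact p.2.2 (congrArg Sigma.fst h)
  · refine Or.inr ⟨⟨⟨j, a⟩, hij.symm⟩, ?_, rfl⟩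
    intro h
    exact ha (by simpa using h)

/-- Otherwise the linear relation at `x` would make `l ⟨i, s⟩` algebraic over the other values
outside group `j`. -/
lemma IsPoint.exists_notMem {x : Fin (n i + 1) → L} {s : Fin (n i + 1)}
    (hx : IsPoint (k := k) l i x s) (hij : i ≠ j) (hj : Ind k (∅ : Set L) (offGroup l j)) :
    ∃ r, x r ∉ acl k (range (offGroups l i j)) := by
  by_contra! hc
  refine hj.notMem (v := ⟨⟨i, s⟩, hij⟩) (s := {p | p.1 ≠ ⟨i, s⟩}) (by simp)
    (mem_of_sum_mul_eq_zero (s := s) (μ := group l i) (z := x) (fun a => ?_) hx.pivot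
      (fun a ha => ?_) hx.sum_eq_zero)
  · refine acl_mono ?_ (hc a)
    rintro _ ⟨p, rfl⟩
    refine Or.inr ⟨⟨p, p.2.2⟩, ?_, rfl⟩
    rintro h
    exact p.2.1 (congrArg Sigma.fst h)
  · refine subset_acl _ (Or.inr ⟨⟨⟨i, a⟩, hij⟩, ?_, rfl⟩)
    intro h
    exact ha (by simpa using h)

variable [IsAlgClosed L]

/-- The coefficients of a generic form that vanishes at `x` are algebraically independent. -/
lemma IsPoint.ind_onPerp {x : Fin (n i + 1) → L} {s : Fin (n i + 1)}
    (hx : IsPoint (k := k) l i x s) (hij : i ≠ j) (hi : Ind k (∅ : Set L) (offGroup l i))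
    (hj : Ind k (∅ : Set L) (offGroup l j)) {d : ℕ} (hd : d ≠ 0) {b' : Fin (n j + 1) → L}
    (hb' : Ind k (range l) b') {T : Expo (n i) d → L} (hT : Ind k (range l ∪ range b') T) :
    Ind k (range (offGroups l i j)) (onPerp (vero d x) (expoSingle d s) T) := by
  set β₀ : Expo (n i) d := expoSingle d s
  set U := onPerp (vero d x) β₀ T
  set a := range (offGroups l i j)
  have hal : a ⊆ range l := by
    rintro _ ⟨p, rfl⟩
    exact ⟨p, rfl⟩
  have hgl : range (group l j) ⊆ range l := by
    rintro _ ⟨p, rfl⟩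
    exact ⟨⟨j, p⟩, rfl⟩
  let T' : {β // β ≠ β₀} → L := fun β => T β
  have hT' : Ind k (range l ∪ range b') T' := hT.comp _ Subtype.val_injective
  have hUT : ∀ β : {β // β ≠ β₀}, U β = T' β := fun β => onPerp_of_ne β.2 T
  have hUs : ∑ β, vero d x β * U β = 0 :=
    sum_mul_onPerp (by rw [vero_expoSingle, hx.pivot, one_pow]) T
  have hg := ind_group hij hi
  have hT'a : ∀ {A : Set L}, A ⊆ range l ∪ range b' → Ind k A T' := fun h =>
    hT'.anti (h.trans (subset_acl _))
  have hb'a : ∀ {A : Set L}, A ⊆ range l → Ind k A b' := fun h =>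
    hb'.anti (h.trans (subset_acl _))
  -- If the dependent coefficient were algebraic over `a` and the others, an embedding fixing all of
  -- these and moving `l_j` to the independent copy `b'` would send `x` to a second zero `y` of the
  -- same form.
  have hnot : U β₀ ∉ acl k (a ∪ range T') := by
    intro h
    have hb : Ind k (a ∪ range T') (group l j) :=
      hg.comm (hT'a ((union_subset hal hgl).trans subset_union_left))
    have hbb : Ind k (a ∪ range T') b' := (hb'a hal).comm
      (hT'a (union_subset_union_left _ hal))
    obtain ⟨σ, h1, h2⟩ := hb.exists_algHom hbb
    have hxg : ∀ r, x r ∈ acl k (a ∪ range (group l j)) := fun r => by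
      rw [← offGroup_eq l hij]
      exact hx.mem r
    have hxK : ∀ r, x r ∈ acl k (a ∪ range T' ∪ range (group l j)) := fun r =>
      acl_mono (union_subset_union_left _ subset_union_left) (hxg r)
    have hUS : ∀ β, U β ∈ acl k (a ∪ range T') := fun β => by
      by_cases hβ : β = β₀
      · rw [hβ]; exact h
      · rw [show U β = T' ⟨β, hβ⟩ from hUT ⟨β, hβ⟩]
        exact subset_acl _ (Or.inr ⟨_, rfl⟩)
    let xK : Fin (n i + 1) → acl k (a ∪ range T' ∪ range (group l j)) := fun r => ⟨x r, hxK r⟩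
    let y : Fin (n i + 1) → L := fun r => σ (xK r)
    have hy : ∀ r, y r ∈ acl k (a ∪ range b') := fun r =>
      h2 a (subset_union_left.trans (subset_acl _)) _ (hxg r) _
    have hys : y s = 1 := by
      have : xK s = 1 := Subtype.ext hx.pivot
      simp only [y, this, map_one]
    have hyU : ∑ β, vero d y β * U β = 0 := by
      have h3 : ∑ β, vero d xK β * ⟨U β, acl_mono subset_union_left (hUS β)⟩ = 0 := by
        apply Subtype.val_injective
        have h4 := map_vero (algebraMap (acl k (a ∪ range T' ∪ range (group l j))) L) d xK
        have h5 : ∀ β, ((vero d xK β : acl k (a ∪ range T' ∪ range (group l j))) : L) =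
            vero d x β := fun β => (congrFun h4 β).symm
        push_cast
        simp only [h5]
        exact hUs
      have h4 := congrArg σ h3
      rw [map_sum, map_zero] at h4
      rw [← h4]
      refine Finset.sum_congr rfl fun β _ => ?_
      rw [map_mul, h1 _ (hUS β)]
      congr 1
      exact congrFun (map_vero (σ : _ →+* L) d xK) β
    -- The difference of the two equations is a linear relation between the independent `T'`, so all
    -- monomials take equal values at `x` and `y`. Those of degree one in `x r`, with pivot 1, give
    -- `x = y`.
    have hdiff : ∑ β : {β // β ≠ β₀}, (vero d x β - vero d y β) * T' β = 0 := by
      have h3 : ∑ β, (vero d x β - vero d y β) * U β = 0 := by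
        simp only [sub_mul, Finset.sum_sub_distrib, hUs, hyU, sub_zero]
      rw [← Finset.add_sum_erase _ _ (Finset.mem_univ β₀), vero_expoSingle, vero_expoSingle,
        hx.pivot, hys, sub_self, zero_mul, zero_add] at h3
      rw [← h3]
      symm
      rw [Finset.sum_subtype _ (p := fun β => β ≠ β₀) (by simp)]
      exact Finset.sum_congr rfl fun β _ => by rw [hUT]
    have hmem : ∀ β : {β // β ≠ β₀}, vero d x β - vero d y β ∈ acl k (range l ∪ range b') := by
      intro β
      refine sub_mem (vero_mem (fun r => acl_mono ?_ (hx.mem r)) _)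
        (vero_mem (fun r => acl_mono ?_ (hy r)) _)
      · exact (range_offGroup_subset l i).trans subset_union_left
      · exact union_subset_union_left _ hal
    have hxy : ∀ r, x r = y r := by
      intro r
      by_cases hr : r = s
      · rw [hr, hx.pivot, hys]
      have h3 : expoPair d s r ⟨1, by omega⟩ ≠ β₀ := by
        intro h
        have := DFunLike.congr_fun (congrArg Subtype.val h) r
        simp [expoPair, expoSingle, β₀, Ne.symm hr] at this
      have h4 := hT'.eq_zero_of_sum hmem hdiff ⟨_, h3⟩
      simp only [vero_expoPair, hx.pivot, hys] at h4
      simpa [sub_eq_zero] using h4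
    -- Now `x` is algebraic over `a ∪ l_j` and over `a ∪ b'`, hence over `a`: a contradiction.
    obtain ⟨r, hr⟩ := hx.exists_notMem hij hj
    have h5 : Ind k (a ∪ range b') (group l j) := hg.comm (hb'a (union_subset hal hgl))
    exact hr (h5.mem_acl_of_mem (hxg r) (by rw [hxy]; exact hy r))
  have h1 : Ind k a (Sum.elim T' fun _ : Unit => U β₀) := by
    refine ind_sumElim_iff.2 ⟨hT'a (hal.trans subset_union_left), ind_of_notMem fun v => ?_⟩
    have : ({v}ᶜ : Set Unit) = ∅ := by ext; simp
    rwa [this, image_empty, union_empty]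
  refine h1.of_card_le ?_ ?_
  · rintro (β | _)
    · exact subset_acl _ (Or.inr ⟨β, hUT β⟩)
    · exact subset_acl _ (Or.inr ⟨β₀, rfl⟩)
  · rw [Fintype.card_sum, Fintype.card_unit, Fintype.card_subtype_compl, Fintype.card_subtype_eq]
    omega

end Forms

/-! ### Points given by the splitting of a wedge -/

section WedgePoint

open Set

variable {k : Type u} {L : Type v} [Field k] [Field L] [Algebra k L] [IsAlgClosed L]
  {ι : Type w} [DecidableEq ι] {n : ι → ℕ} {l : Vars n → L} {i j : ι} {d Di : ℕ}
  {R : MvPolynomial (Vars n) k} {w : MvPolynomial (Vars n) (MvPolynomial (Expo (n i) d) k)}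

/-- The value of the wedge with a generic form. -/
lemma value_wedge_genericForm (hsi : IsSplittable Di (asPolyHom k n i R))
    (hw : IsWedgeAt i d Di (genericForm k (n i) d) (map C R) w) (T : Expo (n i) d → L)
    (c : Vars n → L) {y : L} {x : Fin Di → Fin (n i + 1) → L}
    (hs : map (eval₂Hom (algebraMap k L) c) (asPolyHom k n i R) = C y * ∏ t, lin (x t)) :
    eval₂Hom (eval₂Hom (algebraMap k L) T) c w = y ^ d * ∏ t, ∑ β, vero d (x t) β * T β := by
  have h1 : (eval₂Hom (eval₂Hom (algebraMap k L) T) c).comp (map C) =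
      eval₂Hom (algebraMap k L) c :=
    ringHom_ext (fun a => by simp) fun p => by simp
  have h2 := IsWedge.value hw (by
      rw [← asPolyHom_apply, asPolyHom_map]
      exact hsi.map _) ((genericForm_isHomogeneous k (n i) d).map C)
    (eval₂Hom (eval₂Hom (algebraMap k L) T) c) (y := y) (x := x) (by
      rw [← asPolyHom_apply, asPolyHom_map, map_map, h1, hs])
  rw [h2]
  refine congrArg _ (Finset.prod_congr rfl fun t _ => ?_)
  rw [map_map, eval_map_genericForm]
  refine Finset.sum_congr rfl fun β _ => ?_
  simp

/-- A point at which the group `j` vanishes, algebraic over the coefficients of a form that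
vanishes at a point of the group `i`. -/
lemma exists_point_of_wedge [Fintype ι] (hL : Cardinal.aleph0 ≤ Algebra.trdeg k L)
    (hij : i ≠ j) (hR : R ≠ 0) (hd : d ≠ 0)
    (hi : Ind k (∅ : Set L) (offGroup l i)) (hsi : IsSplittable Di (asPolyHom k n i R))
    (hw : IsWedgeAt i d Di (genericForm k (n i) d) (map C R) w) {E : ℕ}
    (hws : IsSplittable E (asPolyHom _ n j w)) {T : Expo (n i) d → L}
    (hT : Ind k (range (offGroups l i j)) T) {x : Fin (n i + 1) → L}
    (hxT : ∑ β, vero d x β * T β = 0) {y : L} {x' : Fin Di → Fin (n i + 1) → L} {t : Fin Di} {c : L}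
    (hs : map (eval₂Hom (algebraMap k L) l) (asPolyHom k n i R) = C y * ∏ t, lin (x' t))
    (ht : x' t = c • x) :
    ∃ (z : Fin (n j + 1) → L) (s : Fin (n j + 1)), z s = 1 ∧
      (∀ r, z r ∈ acl k (range (offGroups l i j) ∪ range T)) ∧ ∑ r, z r * l ⟨j, r⟩ = 0 := by
  set a := range (offGroups l i j)
  -- With zeros in both groups, the coefficients of the wedge as a polynomial in group `j` are
  -- algebraic over `a ∪ T`.
  let c₀ : Vars n → L := setGroup (setGroup l i 0) j 0
  have hc₀i : ∀ r, c₀ ⟨i, r⟩ = 0 := fun r => by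
    simp only [c₀]
    rw [setGroup_of_ne (p := ⟨i, r⟩) _ _ hij, setGroup_self, Pi.zero_apply]
  have hc₀j : ∀ r, c₀ ⟨j, r⟩ = 0 := fun r => by
    simp only [c₀]
    rw [setGroup_self, Pi.zero_apply]
  have hc₀ : ∀ p : Vars n, p.1 ≠ i → p.1 ≠ j → c₀ p = l p := fun p hp hp' => by
    simp only [c₀]
    rw [setGroup_of_ne _ _ hp', setGroup_of_ne _ _ hp]
  have hc₀a : ∀ p, c₀ p ∈ acl k a := by
    rintro ⟨b, r⟩
    by_cases hb : b = i
    · subst hb; rw [hc₀i]; exact zero_mem _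
    by_cases hb' : b = j
    · subst hb'; rw [hc₀j]; exact zero_mem _
    rw [hc₀ _ hb hb']
    exact subset_acl _ (mem_range_offGroups (p := ⟨b, r⟩) hb hb')
  have hset : ∀ (μ : Fin (n j + 1) → L) (p : Vars n), p.1 ≠ i →
      setGroup c₀ j μ p = setGroup l j μ p := by
    rintro μ ⟨b, r⟩ hb
    by_cases hb' : b = j
    · subst hb'; rw [setGroup_self, setGroup_self]
    · rw [setGroup_of_ne (p := ⟨b, r⟩) _ _ hb', setGroup_of_ne (p := ⟨b, r⟩) _ _ hb',
        hc₀ _ hb hb']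
  let ψ := eval₂Hom (eval₂Hom (algebraMap k L) T) c₀
  have hψ : ∀ Q, ψ Q ∈ acl k (a ∪ range T) := eval₂Hom_mem
    (eval₂Hom_mem (fun a => (acl k _).algebraMap_mem a)
      fun β => subset_acl _ (Or.inr ⟨β, rfl⟩)) fun p => acl_mono subset_union_left (hc₀a p)
  have hg := ind_group hij hi
  have hai : Ind k (∅ : Set L) (offGroups l i j) :=
    hi.comp (fun p : {p : Vars n // p.1 ≠ i ∧ p.1 ≠ j} => (⟨p.1, p.2.1⟩ : {p : Vars n // p.1 ≠ i}))
      fun p q h => Subtype.ext (congrArg (fun q : {p : Vars n // p.1 ≠ i} => q.1) h)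
  -- At values `μ` independent over `a ∪ T`, the wedge is a nonzero constant times values of the
  -- form `T` at nonzero points algebraic over `a ∪ μ`; these are nonzero since `T` is independent
  -- over `a ∪ μ`.
  have hne : map ψ (asPolyHom _ n j w) ≠ 0 := by
    intro h0
    obtain ⟨μ, hμ⟩ := exists_ind hL (S := a ∪ range T)
      ((finite_range _).union (finite_range _)) (Fin (n j + 1))
    have hTμ : Ind k (a ∪ range μ) T := hT.comm hμ
    have hμa : Ind k a μ := hμ.anti (subset_union_left.trans (subset_acl _))
    have hiμ : Ind k (∅ : Set L) (offGroup (setGroup l j μ) i) := by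
      refine (ind_sumElim_iff.2 ⟨hai, by rwa [empty_union]⟩ :
        Ind k ∅ (Sum.elim (offGroups l i j) μ)).of_card_le ?_ ?_
      · rintro (⟨p, hp, hp'⟩ | r)
        · refine subset_acl _ (Or.inr ⟨⟨p, hp⟩, ?_⟩)
          exact setGroup_of_ne l μ hp'
        · exact subset_acl _ (Or.inr ⟨⟨⟨j, r⟩, hij.symm⟩, setGroup_self l j μ r⟩)
      · rw [Fintype.card_sum, Fintype.card_fin, card_ne_ne_add hij]
    obtain ⟨y₁, x₁, hx₁, hs₁⟩ := IsSplittable.exists_splitting_acl hsi (S := a ∪ range μ)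
      (eval₂Hom (algebraMap k L) (setGroup c₀ j μ))
      (eval₂Hom_mem (fun a => (acl k _).algebraMap_mem a) (by
        rintro ⟨b, r⟩
        by_cases hb : b = j
        · subst hb; rw [setGroup_self]; exact subset_acl _ (Or.inr ⟨r, rfl⟩)
        · rw [setGroup_of_ne (p := ⟨b, r⟩) _ _ hb]
          exact acl_mono subset_union_left (hc₀a _)))
    have h1 := value_wedge_genericForm hsi hw T _ hs₁
    rw [← eval_map_asPolyHom, h0, map_zero] at h1
    rw [map_asPolyHom_eq _ (hset μ)] at hs₁
    have h2 := map_asPolyHom_ne_zero hL hR hiμ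
    rw [hs₁] at h2
    have hy₁ : y₁ ≠ 0 := by rintro rfl; simp at h2
    rcases mul_eq_zero.1 h1.symm with h3 | h3
    · exact hy₁ (pow_eq_zero_iff hd |>.1 h3)
    · obtain ⟨u, -, hu⟩ := Finset.prod_eq_zero_iff.1 h3
      have h4 := hTμ.eq_zero_of_sum (fun β => vero_mem (hx₁ u) β) hu
      apply h2
      rw [Finset.prod_eq_zero (Finset.mem_univ u), mul_zero]
      rw [lin_eq_zero]
      funext r
      have := h4 (expoSingle d r)
      rw [vero_expoSingle] at this
      exact pow_eq_zero_iff hd |>.1 this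
  obtain ⟨y₂, x₂, hx₂, hs₂⟩ := IsSplittable.exists_splitting_acl hws ψ hψ
  -- At `l_j` one of the factors is a multiple of the value of the form `T` at `x`, which is zero.
  have hzero : eval (group l j) (map ψ (asPolyHom _ n j w)) = 0 := by
    have hl : map (eval₂Hom (algebraMap k L) (setGroup c₀ j (group l j))) (asPolyHom k n i R) =
        C y * ∏ t, lin (x' t) := by
      rw [map_asPolyHom_eq _ (hset _), setGroup_group, hs]
    rw [eval_map_asPolyHom, value_wedge_genericForm hsi hw T _ hl,
      Finset.prod_eq_zero (Finset.mem_univ t), mul_zero]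
    rw [ht, vero_smul]
    simp only [Pi.smul_apply, smul_eq_mul, mul_assoc, ← Finset.mul_sum, hxT, mul_zero]
  rw [hs₂] at hne hzero
  obtain ⟨z, s, -, -, h1, -, h3, h4⟩ := exists_point_of_eval_eq_zero hx₂ hne hzero
  exact ⟨z, s, h1, h3, h4⟩

end WedgePoint

/-! ### Parameter counts for a form vanishing at a point -/

section Descent

open Set

variable {k : Type u} {L : Type v} [Field k] [Field L] [Algebra k L]
  {ι : Type w} [DecidableEq ι] {n : ι → ℕ} {l : Vars n → L} {i j : ι} {d : ℕ}
  [IsAlgClosed L]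

/-- The values of the indeterminates in the group `i` except one. -/
def groupNe (l : Vars n → L) (i : ι) (s : Fin (n i + 1)) : {r : Fin (n i + 1) // r ≠ s} → L :=
  fun r => l ⟨i, r⟩

lemma group_mem {M : IntermediateField k L} {z : Fin (n i + 1) → L} {s : Fin (n i + 1)}
    (hz : ∀ a, z a ∈ M) (hs : z s = 1) (h0 : ∑ a, z a * l ⟨i, a⟩ = 0)
    (h : range (groupNe l i s) ⊆ M) (r : Fin (n i + 1)) : l ⟨i, r⟩ ∈ M := by
  by_cases hr : r = s
  · subst hr
    exact mem_of_sum_mul_eq_zero (μ := group l i) hz hs (fun a ha => h ⟨⟨a, ha⟩, rfl⟩) h0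
  · exact h ⟨⟨r, hr⟩, rfl⟩

/-- A count. Through `z` the missing coordinate of `l_j` is recovered, so the independent family
formed by the values outside `i` and the coefficients other than `β₀` is algebraic over `a`, the
modified form and `l_j` without `s`. The cardinalities agree: one coefficient is gained, one
coordinate of `l_j` is lost. -/
lemma ind_groupNe_of_point [Fintype ι] (hij : i ≠ j)
    (hi : Ind k (∅ : Set L) (offGroup l i)) {v : Expo (n i) d → L} {β₀ : Expo (n i) d}
    {T : Expo (n i) d → L} (hT : Ind k (range l) T) {z : Fin (n j + 1) → L} {s : Fin (n j + 1)}
    (hzs : z s = 1) (hz : ∀ r, z r ∈ acl k (range (offGroups l i j) ∪ range (onPerp v β₀ T)))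
    (hz0 : ∑ r, z r * l ⟨j, r⟩ = 0) :
    Ind k (range (offGroups l i j) ∪ range (onPerp v β₀ T)) (groupNe l j s) := by
  set U := onPerp v β₀ T
  let T' : {β // β ≠ β₀} → L := fun β => T β
  have hT' : Ind k (range l) T' := hT.comp _ Subtype.val_injective
  have h1 : Ind k (∅ : Set L) (Sum.elim (offGroup l i) T') := by
    refine ind_sumElim_iff.2 ⟨hi, hT'.anti ?_⟩
    rw [empty_union]
    exact (range_offGroup_subset l i).trans (subset_acl _)
  have h2 : Ind k (∅ : Set L) (Sum.elim (Sum.elim (offGroups l i j) U) (groupNe l j s)) := by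
    refine h1.of_card_le ?_ ?_
    · rw [empty_union, Sum.elim_range, Sum.elim_range]
      rintro (⟨⟨b, r⟩, hp⟩ | β)
      · by_cases hb : b = j
        · subst hb
          exact group_mem (fun a => acl_mono subset_union_left (hz a)) hzs hz0
            (subset_union_right.trans (subset_acl _)) r
        · exact subset_acl _ (Or.inl (Or.inl (mem_range_offGroups (p := ⟨b, r⟩) hp hb)))
      · exact subset_acl _ (Or.inl (Or.inr ⟨β, onPerp_of_ne β.2 T⟩))
    · rw [Fintype.card_sum, Fintype.card_sum, Fintype.card_sum, card_fin_ne,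
        ← card_ne_ne_add hij, Fintype.card_subtype_compl, Fintype.card_subtype_eq]
      have : 0 < Fintype.card (Expo (n i) d) := Fintype.card_pos_iff.2 ⟨β₀⟩
      omega
  have h3 := (ind_sumElim_iff.1 h2).2
  rwa [Sum.elim_range, empty_union] at h3

/-- A polynomial of degree at most `d` is recovered linearly, over `M`, from its values at `d + 1`
distinct elements of `M`. -/
lemma mem_of_vandermonde {M : IntermediateField k L} {d : ℕ} {v : Fin (d + 1) → L}
    (hv : Function.Injective v) (hvM : ∀ m, v m ∈ M) {u : Fin (d + 1) → L}
    (h : ∀ m, ∑ q, v m ^ q.1 * u q ∈ M) (q : Fin (d + 1)) : u q ∈ M := by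
  let V : Matrix (Fin (d + 1)) (Fin (d + 1)) M := Matrix.vandermonde fun m => ⟨v m, hvM m⟩
  have hV : IsUnit V.det := by
    rw [isUnit_iff_ne_zero, Matrix.det_vandermonde_ne_zero_iff]
    exact fun a b hab => hv (congrArg Subtype.val hab)
  let b : Fin (d + 1) → M := fun m => ⟨_, h m⟩
  obtain ⟨u', hu'⟩ : ∃ u', V.mulVec u' = b := ⟨V⁻¹.mulVec b, by
    rw [Matrix.mulVec_mulVec, Matrix.mul_nonsing_inv _ hV, Matrix.one_mulVec]⟩
  have h2 : ∀ m, ∑ q, v m ^ q.1 * (u q - (u' q : L)) = 0 := by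
    intro m
    have h3 : ∑ q, v m ^ q.1 * (u' q : L) = ∑ q, v m ^ q.1 * u q := by
      have h4 := congrArg (algebraMap M L) (congrFun hu' m)
      simp only [Matrix.mulVec, dotProduct, V, Matrix.vandermonde_apply, map_sum, map_mul,
        map_pow] at h4
      exact h4
    simp only [mul_sub, Finset.sum_sub_distrib, h3, sub_self]
  have h3 : (Matrix.vandermonde v).mulVec (fun q => u q - (u' q : L)) = 0 := by
    funext m
    simpa [Matrix.mulVec, dotProduct, Matrix.vandermonde_apply] using h2 m
  have h4 := Matrix.eq_zero_of_mulVec_eq_zero (Matrix.det_vandermonde_ne_zero_iff.2 hv) h3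
  rw [sub_eq_zero.1 (congrFun h4 q)]
  exact (u' q).2

/-- If a form with independent coefficients, of degree equal to the dimension of the space of a
point `z`, vanishes at `x`, and if `x` does not vary independently of the form, then `x` is
algebraic over `z`. -/
lemma IsPoint.mem_acl_of_form [Fintype ι] (hL : Cardinal.aleph0 ≤ Algebra.trdeg k L)
    {x : Fin (n i + 1) → L} {s : Fin (n i + 1)} (hx : IsPoint (k := k) l i x s) (hij : i ≠ j)
    (ha : Ind k (∅ : Set L) (offGroups l i j))
    {T : Expo (n i) (n j) → L} (hT : Ind k (range (offGroups l i j)) T)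
    (hxT : ∑ β, vero (n j) x β * T β = 0) {z : Fin (n j + 1) → L} {t : Fin (n j + 1)}
    (hzt : z t = 1) (hz : ∀ r, z r ∈ acl k (range (offGroups l i j) ∪ range T))
    (hz0 : ∑ r, z r * l ⟨j, r⟩ = 0)
    (hl : Ind k (range (offGroups l i j) ∪ range T) (groupNe l j t)) (r : Fin (n i + 1)) :
    x r ∈ acl k (range (offGroups l i j) ∪ range z) := by
  by_contra hr
  set a := range (offGroups l i j)
  set S := a ∪ range T
  set H := a ∪ range z
  have hHS : H ⊆ acl k S := by
    rintro _ (h | ⟨r, rfl⟩)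
    · exact subset_acl _ (Or.inl h)
    · exact hz r
  have hxH : ∀ r, x r ∈ acl k (H ∪ range (groupNe l j t)) := by
    intro r
    have h1 := hx.mem r
    rw [offGroup_eq l hij] at h1
    refine acl_le (union_subset ?_ ?_) h1
    · exact (subset_union_left.trans subset_union_left).trans (subset_acl _)
    · rintro _ ⟨b, rfl⟩
      have h2 : ∀ b, z b ∈ acl k (H ∪ range (groupNe l j t)) := fun b =>
        subset_acl _ (Or.inl (Or.inr ⟨b, rfl⟩))
      exact group_mem h2 hzt hz0
        (subset_union_right.trans (subset_acl _)) b
  have hxS : ∀ r, x r ∈ acl k (S ∪ range (groupNe l j t)) := fun r =>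
    acl_le (union_subset (hHS.trans (acl_mono subset_union_left))
      (subset_union_right.trans (subset_acl _))) (hxH r)
  -- One independent copy of `l_j` without its pivot coordinate for each of `n j + 1` indices.
  -- Embeddings fixing the form `T` move `x` to as many zeros `y m` of `T`.
  obtain ⟨Λ, hΛ⟩ := exists_ind hL (S := S) ((finite_range _).union (finite_range _))
    (Fin (n j + 1) × {r : Fin (n j + 1) // r ≠ t})
  let Λm : Fin (n j + 1) → {r : Fin (n j + 1) // r ≠ t} → L := fun m r => Λ (m, r)
  have hΛm : ∀ m, Ind k S (Λm m) := fun m => hΛ.comp (fun r => (m, r)) fun p q h =>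
    (Prod.ext_iff.1 h).2
  choose σ hσ1 hσ2 using fun m => hl.exists_algHom (hΛm m)
  let xK : Fin (n i + 1) → acl k (S ∪ range (groupNe l j t)) := fun r => ⟨x r, hxS r⟩
  let y : Fin (n j + 1) → Fin (n i + 1) → L := fun m r => σ m (xK r)
  have hy : ∀ m r, y m r ∈ acl k (H ∪ range (Λm m)) := fun m r => hσ2 m H hHS _ (hxH r) _
  have hys : ∀ m, y m s = 1 := fun m => by
    have : xK s = 1 := Subtype.ext hx.pivot
    simp only [y, this, map_one]
  have hTS : ∀ β, T β ∈ acl k S := fun β => subset_acl _ (Or.inr ⟨β, rfl⟩)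
  have hyT : ∀ m, ∑ β, vero (n j) (y m) β * T β = 0 := by
    intro m
    have h3 : ∑ β, vero (n j) xK β * ⟨T β, acl_mono subset_union_left (hTS β)⟩ = 0 := by
      apply Subtype.val_injective
      have h4 := map_vero (algebraMap (acl k (S ∪ range (groupNe l j t))) L) (n j) xK
      have h5 : ∀ β, ((vero (n j) xK β : acl k (S ∪ range (groupNe l j t))) : L) =
          vero (n j) x β := fun β => (congrFun h4 β).symm
      push_cast
      simp only [h5]
      exact hxT
    have h4 := congrArg (σ m) h3
    rw [map_sum, map_zero] at h4
    rw [← h4]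
    refine Finset.sum_congr rfl fun β _ => ?_
    rw [map_mul, hσ1 m _ (hTS β)]
    congr 1
    exact congrFun (map_vero (σ m : _ →+* L) (n j) xK) β
  -- If two of these coordinates coincided, the common value would be algebraic over `H` and thus
  -- fixed by the embedding, making `x r` algebraic over `H`.
  have hinj : Function.Injective fun m => y m r := by
    intro m m' hmm
    by_contra hne
    have h1 : Ind k (H ∪ range (Λm m')) (Λm m) := by
      refine ind_of_notMem fun b hb => hΛ.notMem (v := (m, b)) (s := {p | p ≠ (m, b)}) (by simp)
        (acl_le ?_ hb)
      refine union_subset (union_subset (hHS.trans (acl_mono subset_union_left)) ?_) ?_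
      · rintro _ ⟨c, rfl⟩
        refine subset_acl _ (Or.inr ⟨(m', c), ?_, rfl⟩)
        rintro h
        exact hne (Prod.ext_iff.1 h).1.symm
      · rintro _ ⟨c, hc, rfl⟩
        refine subset_acl _ (Or.inr ⟨(m, c), ?_, rfl⟩)
        intro h
        exact hc (Prod.ext_iff.1 h).2
    have h2 := h1.mem_acl_of_mem (hy m r) (by
      have := hy m' r
      have hmm' : y m r = y m' r := hmm
      rwa [← hmm'] at this)
    have h3 : y m r ∈ acl k S := acl_le hHS h2
    have h4 := hσ1 m _ h3
    have h5 := congrArg Subtype.val ((σ m).injective h4)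
    exact hr (by rw [← show y m r = x r from h5]; exact h2)
  have hrs : r ≠ s := by
    rintro rfl
    exact hr (by rw [hx.pivot]; exact one_mem _)
  let ε := expoPair (n j) s r
  have hε : Function.Injective ε := expoPair_injective hrs
  let z' : {r : Fin (n j + 1) // r ≠ t} → L := fun r => z r
  let T'' : {β // β ∉ range ε} → L := fun β => T β
  let g := Sum.elim (Sum.elim (offGroups l i j) z') (Sum.elim Λ T'')
  have hg : range g = (a ∪ range z') ∪ (range Λ ∪ range T'') := by
    simp only [g, Sum.elim_range]
    rfl
  set M := acl k (range g)
  have hzM : ∀ r, z r ∈ M := by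
    intro r
    by_cases hr : r = t
    · rw [hr, hzt]; exact one_mem _
    · refine subset_acl _ ?_
      rw [hg]
      exact Or.inl (Or.inr ⟨⟨r, hr⟩, rfl⟩)
  have haM : a ⊆ M := by
    refine Subset.trans ?_ (subset_acl _)
    rw [hg]
    exact subset_union_left.trans subset_union_left
  have hΛM : ∀ p, Λ p ∈ M := fun p => subset_acl _ (by rw [hg]; exact Or.inr (Or.inl ⟨p, rfl⟩))
  have hyM : ∀ m r, y m r ∈ M := by
    intro m r
    refine acl_le (union_subset (union_subset haM ?_) ?_) (hy m r)
    · rintro _ ⟨r, rfl⟩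
      exact hzM r
    · rintro _ ⟨r, rfl⟩
      exact hΛM _
  -- The `n j + 1` coefficients of the monomials in `x s` and `x r` alone are recovered from the
  -- other coefficients and the `n j + 1` distinct values `y m r`.
  have hTM : ∀ β, T β ∈ M := by
    intro β
    by_cases hβ : β ∈ range ε
    · obtain ⟨q, rfl⟩ := hβ
      refine mem_of_vandermonde (u := fun q => T (ε q)) hinj (fun m => hyM m r) (fun m => ?_) q
      have h1 := hyT m
      rw [← Fintype.sum_subtype_add_sum_subtype (fun β => β ∈ range ε)] at h1
      have h2 : ∑ β : {β // β ∈ range ε}, vero (n j) (y m) β * T β =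
          ∑ q, y m r ^ q.1 * T (ε q) := by
        rw [← Equiv.sum_comp (Equiv.ofInjective ε hε)]
        refine Finset.sum_congr rfl fun q _ => ?_
        rw [Equiv.ofInjective_apply, vero_expoPair, hys, one_pow, one_mul]
      have h3 : (∑ β : {β // β ∈ range ε}, vero (n j) (y m) β * T β) +
          ∑ β : {β // β ∉ range ε}, vero (n j) (y m) β * T β = 0 := by
        convert h1
      rw [← h2, eq_neg_of_add_eq_zero_left h3]
      refine neg_mem (sum_mem fun β _ => mul_mem (vero_mem (hyM m) _) (subset_acl _ ?_))
      rw [hg]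
      exact Or.inr (Or.inr ⟨β, rfl⟩)
    · refine subset_acl _ ?_
      rw [hg]
      exact Or.inr (Or.inr ⟨⟨β, hβ⟩, rfl⟩)
  have hf : Ind k (∅ : Set L) (Sum.elim (Sum.elim (offGroups l i j) T) Λ) := by
    refine ind_sumElim_iff.2 ⟨ind_sumElim_iff.2 ⟨ha, by rwa [empty_union]⟩, ?_⟩
    rwa [empty_union, Sum.elim_range]
  -- In the list `g`, the form has lost `n j + 1` coefficients and `z` has added only its `n j`
  -- non-pivot coordinates. It is too short to generate the independent family `a, T, Λ`.
  have hcard := hf.card_le (c := g) (by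
    rw [empty_union]
    rintro ((p | β) | p)
    · exact haM ⟨p, rfl⟩
    · exact hTM β
    · exact hΛM p)
  simp only [Fintype.card_sum, card_fin_ne] at hcard
  have h1 : Fintype.card {β // β ∉ range ε} + (n j + 1) = Fintype.card (Expo (n i) (n j)) := by
    rw [← Fintype.card_congr (Equiv.sumCompl fun β => β ∈ range ε), Fintype.card_sum, add_comm]
    refine congrArg (· + _) ?_
    rw [← Fintype.card_congr (Equiv.ofInjective ε hε), Fintype.card_fin]
  omega

end Descent

/-! ### The points depend on no single form -/

section Descent

open Set

variable {k : Type u} {L : Type v} [Field k] [Field L] [Algebra k L] [IsAlgClosed L]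
  {ι : Type w} [DecidableEq ι] {n : ι → ℕ} {l : Vars n → L} {i j : ι}

/-- Two points at which the same values of a group vanish agree, if these values are independent
except for one of them. -/
lemma eq_smul_of_sum_eq_zero {m : ℕ} {S : Set L} {μ z x : Fin (m + 1) → L} {s : Fin (m + 1)}
    (hμ : Ind k S fun r : {r // r ≠ s} => μ r) (hz : ∀ r, z r ∈ acl k S) (hx : ∀ r, x r ∈ acl k S)
    (hs : x s = 1) (h0 : ∑ r, z r * μ r = 0) (h1 : ∑ r, x r * μ r = 0) : z = z s • x := by
  have h2 : ∑ r, (z r - z s * x r) * μ r = 0 := by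
    simp only [sub_mul, Finset.sum_sub_distrib, mul_assoc, ← Finset.mul_sum, h0, h1, mul_zero,
      sub_zero]
  rw [← Finset.add_sum_erase _ _ (Finset.mem_univ s), hs, mul_one, sub_self, zero_mul, zero_add,
    Finset.sum_subtype _ (p := fun r => r ≠ s) (by simp)] at h2
  have h3 := hμ.eq_zero_of_sum (c := fun r => z r - z s * x r)
    (fun r => sub_mem (hz r) (mul_mem (hz s) (hx r))) h2
  funext r
  by_cases hr : r = s
  · rw [hr, Pi.smul_apply, hs, smul_eq_mul, mul_one]
  · exact sub_eq_zero.1 (h3 ⟨r, hr⟩)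

/-- A generic form through `x` leads, by the splittable wedge, to a point `z` at which `l_j`
vanishes. Two counts show that `x` is algebraic over `z`, and that `z` represents the same
projective point as `x₁`. Then the form is eliminated, its free coefficients being independent of
`l`. -/
lemma IsPoint.mem_acl_offGroup [Fintype ι] (hL : Cardinal.aleph0 ≤ Algebra.trdeg k L)
    {R : MvPolynomial (Vars n) k} (hR : R ≠ 0) (hij : i ≠ j)
    (hi : Ind k (∅ : Set L) (offGroup l i)) (hj : Ind k (∅ : Set L) (offGroup l j)) {Di E : ℕ}
    (hsi : IsSplittable Di (asPolyHom k n i R))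
    {w : MvPolynomial (Vars n) (MvPolynomial (Expo (n i) (n j)) k)}
    (hw : IsWedgeAt i (n j) Di (genericForm k (n i) (n j)) (map C R) w)
    (hws : IsSplittable E (asPolyHom _ n j w)) {x : Fin (n i + 1) → L} {s : Fin (n i + 1)}
    (hx : IsPoint (k := k) l i x s) {y : L} {x' : Fin Di → Fin (n i + 1) → L} {t : Fin Di} {c : L}
    (hs : map (eval₂Hom (algebraMap k L) l) (asPolyHom k n i R) = C y * ∏ t, lin (x' t))
    (ht : x' t = c • x) {x₁ : Fin (n j + 1) → L} {s₁ : Fin (n j + 1)}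
    (hx₁ : IsPoint (k := k) l j x₁ s₁)
    (hl : Ind k (∅ : Set L) fun p : {p : Vars n // p ≠ ⟨j, s₁⟩} => l p) (r : Fin (n j + 1)) :
    x₁ r ∈ acl k (range (offGroup l i)) := by
  -- A space of dimension zero has a single point, and forms of degree zero would carry no
  -- information.
  by_cases hd : n j = 0
  · have : Subsingleton (Fin (n j + 1)) := ⟨fun a b => Fin.ext (by omega)⟩
    rw [Subsingleton.elim r s₁, hx₁.pivot]
    exact one_mem _
  obtain ⟨b', hb'⟩ := exists_ind hL (S := range l) (finite_range _) (Fin (n j + 1))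
  obtain ⟨T₀, hT₀⟩ := exists_ind hL (S := range l ∪ range b')
    ((finite_range _).union (finite_range _)) (Expo (n i) (n j))
  set v := vero (n j) x
  set β₀ : Expo (n i) (n j) := expoSingle (n j) s
  have hT₀l : Ind k (range l) T₀ := hT₀.anti (subset_union_left.trans (subset_acl _))
  have hT := hx.ind_onPerp hij hi hj hd hb' hT₀
  have hxT : ∑ β, vero (n j) x β * onPerp v β₀ T₀ β = 0 :=
    sum_mul_onPerp (by rw [vero_expoSingle, hx.pivot, one_pow]) T₀
  obtain ⟨z, t, hzt, hz, hz0⟩ := exists_point_of_wedge hL hij hR hd hi hsi hw hws hT hxT hs ht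
  set a := range (offGroups l i j)
  set T := onPerp v β₀ T₀
  have h5 := ind_groupNe_of_point hij hi hT₀l hzt hz hz0
  have ha : Ind k (∅ : Set L) (offGroups l i j) :=
    hi.comp (fun p : {p : Vars n // p.1 ≠ i ∧ p.1 ≠ j} => (⟨p.1, p.2.1⟩ : {p : Vars n // p.1 ≠ i}))
      fun p q h => Subtype.ext (congrArg (fun q : {p : Vars n // p.1 ≠ i} => q.1) h)
  have hxa : ∀ r, x r ∈ acl k (a ∪ range T) := fun r => by
    refine acl_le ?_ (hx.mem_acl_of_form hL hij ha hT hxT hzt hz hz0 h5 r)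
    rintro _ (h | ⟨r, rfl⟩)
    · exact subset_acl _ (Or.inl h)
    · exact hz r
  let T' : {β // β ≠ β₀} → L := fun β => T₀ β
  have hT' : Ind k (range l) T' := hT₀l.comp _ Subtype.val_injective
  have hTT' : ∀ β : {β // β ≠ β₀}, T β = T' β := fun β => onPerp_of_ne β.2 _
  set S := a ∪ range T ∪ range (groupNe l i s)
  have hli : ∀ r, l ⟨i, r⟩ ∈ acl k S := fun r =>
    group_mem (fun b => acl_mono subset_union_left (hxa b)) hx.pivot hx.sum_eq_zero
      (subset_union_right.trans (subset_acl _)) r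
  -- A count: the values of `l` other than `⟨j, s₁⟩` and the free coefficients of the form are
  -- independent, and are algebraic over a family with the same number of members, namely `S` with
  -- `l_j` deprived of `s₁`.
  have h7 : Ind k S (groupNe l j s₁) := by
    have h1 : Ind k (∅ : Set L) (Sum.elim (fun p : {p : Vars n // p ≠ ⟨j, s₁⟩} => l p) T') := by
      refine ind_sumElim_iff.2 ⟨hl, hT'.anti ?_⟩
      rw [empty_union]
      rintro _ ⟨p, rfl⟩
      exact subset_acl _ ⟨p, rfl⟩
    have h2 : Ind k (∅ : Set L) (Sum.elim (Sum.elim (Sum.elim (offGroups l i j) T)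
        (groupNe l i s)) (groupNe l j s₁)) := by
      refine h1.of_card_le ?_ ?_
      · rw [empty_union, Sum.elim_range, Sum.elim_range, Sum.elim_range]
        rintro (⟨⟨b, q⟩, hp⟩ | β)
        · by_cases hb : b = i
          · subst hb
            exact acl_mono subset_union_left (hli q)
          · by_cases hb' : b = j
            · subst hb'
              refine subset_acl _ (Or.inr ⟨⟨q, fun hq => hp (by rw [hq])⟩, rfl⟩)
            · exact subset_acl _ (Or.inl (Or.inl (Or.inl
                (mem_range_offGroups (p := ⟨b, q⟩) hb hb'))))
        · exact subset_acl _ (Or.inl (Or.inl (Or.inr ⟨β, hTT' β⟩)))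
      · have h3 := card_ne_ne_add (n := n) hij
        have h4 := card_ne_add (n := n) i
        have h6 : 0 < Fintype.card (Expo (n i) (n j)) := Fintype.card_pos_iff.2 ⟨β₀⟩
        have h8 : Fintype.card {p : Vars n // p ≠ ⟨j, s₁⟩} = Fintype.card (Vars n) - 1 := by
          rw [Fintype.card_subtype_compl, Fintype.card_subtype_eq]
        have h9 : Fintype.card {β // β ≠ β₀} = Fintype.card (Expo (n i) (n j)) - 1 := by
          rw [Fintype.card_subtype_compl, Fintype.card_subtype_eq]
        simp only [Fintype.card_sum, card_fin_ne, h8, h9]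
        omega
    have h3 := (ind_sumElim_iff.1 h2).2
    rwa [Sum.elim_range, Sum.elim_range, empty_union] at h3
  -- Both `z` and `x₁` are algebraic over `S` and annihilate `l_j`, so the independence just proved
  -- makes them proportional.
  have hzx : z = z s₁ • x₁ := by
    refine eq_smul_of_sum_eq_zero (μ := group l j) h7 (fun r => acl_mono subset_union_left (hz r))
      (fun r => acl_le ?_ (hx₁.mem r)) hx₁.pivot hz0 hx₁.sum_eq_zero
    rintro _ ⟨⟨⟨b, q⟩, hb⟩, rfl⟩
    by_cases hb' : b = i
    · subst hb'
      exact hli q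
    · exact subset_acl _ (Or.inl (Or.inl (mem_range_offGroups (p := ⟨b, q⟩) hb' hb)))
  have hz₁ : z s₁ ≠ 0 := by
    intro h
    have := congrFun hzx t
    rw [h, hzt, zero_smul] at this
    exact one_ne_zero this
  -- The dependent coefficient of the form is a polynomial in `x` and the free coefficients, so `x₁`
  -- is algebraic over these and the values outside `i`. The free coefficients are independent over
  -- `l` and drop out.
  have h8 : x₁ r ∈ acl k (range (offGroup l i) ∪ range T') := by
    have h1 : x₁ r = z r / z s₁ := by
      rw [eq_div_iff hz₁, mul_comm]
      exact (congrFun hzx r).symm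
    have h2 : a ∪ range T ⊆ acl k (range (offGroup l i) ∪ range T') := by
      have hT'' : ∀ β, β ≠ β₀ → T₀ β ∈ acl k (range (offGroup l i) ∪ range T') := fun β hβ =>
        subset_acl _ (Or.inr ⟨⟨β, hβ⟩, rfl⟩)
      rintro _ (⟨p, rfl⟩ | ⟨β, rfl⟩)
      · exact subset_acl _ (Or.inl ⟨⟨p, p.2.1⟩, rfl⟩)
      · by_cases hβ : β = β₀
        · subst hβ
          simp only [T, onPerp, if_pos]
          refine neg_mem (sum_mem fun e he => mul_mem (vero_mem (fun r => ?_) _)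
            (hT'' e (Finset.ne_of_mem_erase he)))
          exact acl_mono subset_union_left (hx.mem r)
        · rw [show T β = T₀ β from onPerp_of_ne hβ _]
          exact hT'' β hβ
    rw [h1]
    exact div_mem (acl_le h2 (hz r)) (acl_le h2 (hz s₁))
  have h9 : Ind k (range (offGroup l i) ∪ range l) T' := by
    refine hT'.anti ?_
    exact (union_subset (range_offGroup_subset l i) subset_rfl).trans (subset_acl _)
  exact h9.mem_acl_of_mem h8 (acl_mono ((range_offGroup_subset l j).trans subset_union_right)
    (hx₁.mem r))

end Descent

/-! ### Generic families and generic zeros -/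

section Generic

open Set

variable {k : Type u} {L : Type v} [Field k] [Field L] [Algebra k L] {ι : Type w} {n : ι → ℕ}

/-- Proportional vectors of homogeneous coordinates. -/
lemma mem_dualVariety_iff {ξ : ∀ i, ℙ L (Fin (n i + 1) → L)} {y : ∀ i, Fin (n i + 1) → L}
    (hξ : ∀ i, ∃ c : L, c ≠ 0 ∧ ∀ a, (ξ i).rep a = c * y i a) {l : Vars n → L} :
    l ∈ dualVariety ξ ↔ ∀ i, ∑ a, y i a * l ⟨i, a⟩ = 0 := by
  refine forall_congr' fun i => ?_
  obtain ⟨c, hc, h⟩ := hξ i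
  have : ∑ a, l ⟨i, a⟩ * (ξ i).rep a = c * ∑ a, y i a * l ⟨i, a⟩ := by
    rw [Finset.mul_sum]
    refine Finset.sum_congr rfl fun a _ => ?_
    rw [h]
    ring
  rw [this, mul_eq_zero, or_iff_right hc]

lemma fieldOf_le {ξ : ∀ i, ℙ L (Fin (n i + 1) → L)} {y : ∀ i, Fin (n i + 1) → L}
    (hξ : ∀ i, ∃ c : L, c ≠ 0 ∧ ∀ a, (ξ i).rep a = c * y i a) {M : IntermediateField k L}
    (hM : ∀ i a, y i a ∈ M) : fieldOf k ξ ≤ M := by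
  refine IntermediateField.adjoin_le_iff.2 ?_
  rintro _ ⟨i, a, b, -, rfl⟩
  obtain ⟨c, hc, h⟩ := hξ i
  rw [h, h, mul_div_mul_left _ _ hc]
  exact div_mem (hM i a) (hM i b)

/-- The coordinates of `m` at the pivots are determined by the others. -/
lemma aeval_eq_of_sum_eq_zero [DecidableEq ι] {M : IntermediateField k L}
    {y : ∀ i, Fin (n i + 1) → L} {s : ∀ i, Fin (n i + 1)} (hs : ∀ i, y i (s i) = 1)
    (hM : ∀ i a, y i a ∈ M) (P : MvPolynomial (Vars n) M) :
    ∃ P' : MvPolynomial {p : Vars n // p.2 ≠ s p.1} M, ∀ m : Vars n → L,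
      (∀ i, ∑ a, y i a * m ⟨i, a⟩ = 0) → aeval m P = aeval (fun p => m p.1) P' := by
  let θ : Vars n → MvPolynomial {p : Vars n // p.2 ≠ s p.1} M := fun p =>
    if h : p.2 ≠ s p.1 then X ⟨p, h⟩
    else -∑ a : {a // a ≠ s p.1}, C ⟨y p.1 a, hM _ _⟩ * X ⟨⟨p.1, a⟩, a.2⟩
  refine ⟨aeval θ P, fun m hm => ?_⟩
  rw [← AlgHom.comp_apply]
  refine DFunLike.congr_fun (algHom_ext (fun p => ?_) : aeval m = _) P
  rw [aeval_X, AlgHom.comp_apply, aeval_X]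
  by_cases h : p.2 ≠ s p.1
  · simp only [θ, dif_pos h, aeval_X]
  · obtain ⟨i, a⟩ := p
    have h' : a = s i := not_not.1 h
    subst h'
    have h1 := hm i
    rw [← Finset.add_sum_erase _ _ (Finset.mem_univ (s i)), hs, one_mul,
      Finset.sum_subtype _ (p := fun a => a ≠ s i) (by simp)] at h1
    simp only [θ, dif_neg h, map_neg, map_sum, map_mul, aeval_C, aeval_X]
    exact eq_neg_of_add_eq_zero_left h1

/-- Linear forms that vanish at given points, with coefficients that are independent over these
points except for one coefficient of each form, are generic. -/
lemma isGenericDual_of_ind {ξ : ∀ i, ℙ L (Fin (n i + 1) → L)} {y : ∀ i, Fin (n i + 1) → L}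
    (hξ : ∀ i, ∃ c : L, c ≠ 0 ∧ ∀ a, (ξ i).rep a = c * y i a) {s : ∀ i, Fin (n i + 1)}
    (hs : ∀ i, y i (s i) = 1) {S : Set L} (hS : ∀ i a, y i a ∈ acl k S) {l : Vars n → L}
    (hl : ∀ i, ∑ a, y i a * l ⟨i, a⟩ = 0)
    (hind : Ind k S fun p : {p : Vars n // p.2 ≠ s p.1} => l p) : IsGenericDual k ξ l := by
  classical
  refine ⟨(mem_dualVariety_iff hξ).2 hl, fun P hP m hm => ?_⟩
  have hle := fieldOf_le hξ hS
  let f : fieldOf k ξ →+* acl k S := (IntermediateField.inclusion hle).toRingHom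
  have hf : ∀ m : Vars n → L, aeval m P = aeval m (map f P) := fun m => by
    rw [aeval_def, aeval_def, eval₂_map]
    rfl
  obtain ⟨P', hP'⟩ := aeval_eq_of_sum_eq_zero hs hS (map f P)
  rw [hf, hP' l hl] at hP
  rw [hf, hP' m ((mem_dualVariety_iff hξ).1 hm),
    (injective_iff_map_eq_zero _).1 hind.algebraicIndependent_acl P' hP, map_zero]

lemma exists_rep_mk {m : ℕ} {x : Fin (m + 1) → L} (hx : x ≠ 0) :
    ∃ c : L, c ≠ 0 ∧ ∀ a, (Projectivization.mk L x hx).rep a = c * x a := by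
  obtain ⟨c, hc⟩ := Projectivization.exists_smul_eq_mk_rep L x hx
  refine ⟨c, c.ne_zero, fun a => ?_⟩
  rw [← hc]
  rfl

/-- The generator of the kernel of an evaluation. -/
lemma exists_aeval_eq_zero_iff_dvd [IsAlgClosed L] (hL : Cardinal.aleph0 ≤ Algebra.trdeg k L)
    {V : Type*} [Finite V] {P : MvPolynomial V k} (hP : Irreducible P) :
    ∃ (l : V → L) (v : V), (Ind k (∅ : Set L) fun p : {p // p ≠ v} => l p) ∧
      ∀ Q : MvPolynomial V k, aeval l Q = 0 ↔ P ∣ Q := by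
  classical
  obtain ⟨v, hv⟩ : ∃ v, v ∈ P.vars := by
    by_contra! hc
    have hc' := vars_eq_empty_iff_eq_C.1 (Finset.eq_empty_of_forall_notMem hc)
    generalize coeff 0 P = c at hc'
    have hc0 : c ≠ 0 := by
      rintro rfl
      exact hP.ne_zero (by rw [hc', C_0])
    exact hP.not_isUnit (by rw [hc']; exact (isUnit_iff_ne_zero.2 hc0).map C)
  -- Independent values outside one variable `v` of `P`, and a root of `P` at `v`. No nonzero
  -- relation is then free of `v`, so the prime `P` generates all relations.
  obtain ⟨b, hb⟩ := exists_ind hL (S := ∅) finite_empty {p // p ≠ v}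
  have hb' := ind_empty_iff.1 hb
  let e : MvPolynomial V k ≃ₐ[k] Polynomial (MvPolynomial {p // p ≠ v} k) :=
    (renameEquiv k (Equiv.optionSubtypeNe v).symm).trans (optionEquivLeft k _)
  have hev : e (X v) = Polynomial.X := by
    simp only [e, AlgEquiv.trans_apply, renameEquiv_apply, rename_X]
    rw [Equiv.optionSubtypeNe_symm_self, optionEquivLeft_X_none]
  have hep : ∀ p : {p // p ≠ v}, e (X p.1) = Polynomial.C (X p) := fun p => by
    simp only [e, AlgEquiv.trans_apply, renameEquiv_apply, rename_X]
    rw [Equiv.optionSubtypeNe_symm_of_ne p.2, optionEquivLeft_X_some]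
  let β : MvPolynomial {p // p ≠ v} k →+* L := ((aeval b : _ →ₐ[k] L) : _ →+* L)
  have hβ : Function.Injective β := hb'
  have hβC : ∀ c, β (C c) = algebraMap k L c := aeval_C b
  have hβX : ∀ p, β (X p) = b p := aeval_X b
  have hdeg : ((e P).map β).natDegree ≠ 0 := by
    rw [Polynomial.natDegree_map_eq_of_injective hβ]
    intro h0
    obtain ⟨q, hq⟩ := Polynomial.natDegree_eq_zero.1 h0
    have h1 : e.toAlgHom.comp (rename Subtype.val) =
        (Algebra.ofId (MvPolynomial {p // p ≠ v} k) _).restrictScalars k := by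
      refine algHom_ext fun p => ?_
      rw [AlgHom.comp_apply, rename_X]
      exact hep p
    have h2 : P = rename Subtype.val q := e.injective (hq.symm.trans (DFunLike.congr_fun h1 q).symm)
    rw [h2] at hv
    obtain ⟨p, -, hp⟩ := Finset.mem_image.1 (vars_rename _ _ hv)
    exact p.2 hp
  obtain ⟨t, ht⟩ := IsAlgClosed.exists_root _ (Polynomial.degree_ne_of_natDegree_ne hdeg)
  let l : V → L := fun p => if h : p ≠ v then b ⟨p, h⟩ else t
  have hlb : (fun p : {p // p ≠ v} => l p) = b := by
    funext p
    simp only [l, dif_pos p.2]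
  have hl : ∀ Q, aeval l Q = ((e Q).map β).eval t := by
    have h1 : ((aeval l : MvPolynomial V k →ₐ[k] L) : _ →+* L) =
        (Polynomial.evalRingHom t).comp ((Polynomial.mapRingHom
          β).comp e.toRingEquiv.toRingHom) := by
      refine ringHom_ext (fun c => ?_) fun p => ?_
      · have : e (C c) = Polynomial.C (C c) := e.commutes c
        simp [this, hβC]
      · by_cases hp : p = v
        · subst hp
          simp [hev, l]
        · have := hep ⟨p, hp⟩
          simp only at this
          simp [this, l, hp, hβX]
    exact fun Q => DFunLike.congr_fun h1 Q
  have hlP : aeval l P = 0 := by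
    rw [hl]
    exact ht
  refine ⟨l, v, by rwa [hlb], fun Q => ⟨fun hQ => ?_, ?_⟩⟩
  · refine dvd_of_mem_of_forall_vars (𝔭 := RingHom.ker (aeval (R := k) l)) v ?_ hP.prime hlP hQ
    intro Q hQ hvQ
    obtain ⟨Q', rfl⟩ := exists_rename_eq_of_vars_subset_range Q (Subtype.val : {p // p ≠ v} → V)
      Subtype.val_injective fun p hp => ⟨⟨p, by rintro rfl; exact hvQ hp⟩, rfl⟩
    rw [RingHom.mem_ker, aeval_rename] at hQ
    rw [(injective_iff_map_eq_zero _).1 hb' Q' (by rw [← hlb]; exact hQ), map_zero]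
  · rintro ⟨Q', rfl⟩
    rw [map_mul, hlP, zero_mul]

end Generic

/-! ### From weak resultants to minimally constrained families -/

section Weak

open Set

variable {k : Type u} {L : Type v} [Field k] [Field L] [Algebra k L] {ι : Type w} {n : ι → ℕ}

lemma irreducible_of_rename {σ τ : Type*} {f : σ → τ} (hf : Function.Injective f)
    {Q : MvPolynomial σ k} (h : Irreducible (rename f Q)) : Irreducible Q := by
  have hu : ∀ a : MvPolynomial σ k, IsUnit (rename f a) → IsUnit a := fun a ha => by
    have := ha.map (killCompl hf)
    rwa [killCompl_rename_app] at this
  refine ⟨fun hQ => h.not_isUnit (hQ.map _), fun a b hab => ?_⟩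
  exact (h.isUnit_or_isUnit (by rw [hab, map_mul])).imp (hu a) (hu b)

lemma dvd_of_rename_dvd {σ τ : Type*} {f : σ → τ} (hf : Function.Injective f)
    {P Q : MvPolynomial σ k} (h : rename f P ∣ rename f Q) : P ∣ Q := by
  have := map_dvd (killCompl hf) h
  rwa [killCompl_rename_app, killCompl_rename_app] at this

/-- The indeterminates of a family of groups. -/
def inclMap {κ : Type*} (f : κ → ι) : Vars (fun c => n (f c)) → Vars n := fun p => ⟨f p.1, p.2⟩

lemma inclMap_injective {κ : Type*} {f : κ → ι} (hf : Function.Injective f) :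
    Function.Injective (inclMap (n := n) f) := by
  rintro ⟨c, a⟩ ⟨c', a'⟩ h
  obtain ⟨h1, h2⟩ := Sigma.mk.inj_iff.1 h
  obtain rfl := hf h1
  obtain rfl := eq_of_heq h2
  rfl

/-- A family of linear forms is generic over the points at which it vanishes if these points do
not depend on any one of the forms. -/
lemma isGenericDual_of_isPoint [DecidableEq ι] [IsAlgClosed L] {l : Vars n → L} {κ : Type*}
    {f : κ → ι} (hf : Function.Injective f) {x : ∀ c, Fin (n (f c) + 1) → L}
    {s : ∀ c, Fin (n (f c) + 1)} (hx : ∀ c, IsPoint (k := k) l (f c) (x c) (s c))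
    (h0 : ∀ c, x c ≠ 0) (hxl : ∀ c c' a, x c a ∈ acl k (range (offGroup l (f c'))))
    (hl : ∀ c, Ind k (∅ : Set L) fun p : {p : Vars n // p ≠ ⟨f c, s c⟩} => l p) :
    IsGenericDual k (n := fun c => n (f c)) (fun c => Projectivization.mk L (x c) (h0 c))
      (l ∘ inclMap f) := by
  refine isGenericDual_of_ind (n := fun c => n (f c)) (y := x) (s := s)
    (S := {z | ∃ c a, z = x c a}) (fun c => exists_rep_mk (h0 c)) (fun c => (hx c).pivot)
    (fun c a => subset_acl _ ⟨c, a, rfl⟩) (fun c => (hx c).sum_eq_zero) ?_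
  refine ind_of_notMem ?_
  -- The points are algebraic over the values outside the group of `c`. A dependent non-pivot
  -- coordinate in that group would thus be algebraic over values other than itself and the pivot,
  -- against `hl c`.
  rintro ⟨⟨c, a⟩, ha⟩ hc
  refine (hl c).notMem (v := ⟨⟨f c, a⟩, fun h => ha (by simpa using h)⟩)
    (s := {p | p.1 ≠ ⟨f c, a⟩}) (by simp) (acl_le ?_ hc)
  rintro _ (⟨c', b, rfl⟩ | ⟨⟨⟨c', b⟩, hb⟩, hne, rfl⟩)
  · refine acl_mono ?_ (hxl c' c b)
    rintro _ ⟨⟨p, hp⟩, rfl⟩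
    refine Or.inr ⟨⟨p, ?_⟩, ?_, rfl⟩
    · rintro rfl
      exact hp rfl
    · rintro rfl
      exact hp rfl
  · by_cases hbs : (⟨f c', b⟩ : Vars n) = ⟨f c, s c⟩
    · exfalso
      obtain ⟨h1, h2⟩ := Sigma.mk.inj_iff.1 hbs
      obtain rfl := hf h1
      exact hb (eq_of_heq h2)
    · refine subset_acl _ (Or.inr ⟨⟨⟨f c', b⟩, hbs⟩, ?_, rfl⟩)
      intro h
      apply hne
      have := inclMap_injective (n := n) hf (a₁ := ⟨c', b⟩) (a₂ := ⟨c, a⟩) h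
      exact Subtype.ext this

/-- A relation between values outside group `i` is a multiple of `P`, but `P` involves a variable of
group `i`. -/
lemma ind_of_forall_dvd {l : Vars n → L} {P : MvPolynomial (Vars n) k}
    (hl : ∀ Q, aeval l Q = 0 → P ∣ Q) {i : ι} {a : Fin (n i + 1)} (ha : ⟨i, a⟩ ∈ P.vars)
    {W : Type*} {g : W → Vars n} (hg : Function.Injective g) (hgi : ∀ b, (g b).1 ≠ i) :
    Ind k (∅ : Set L) (l ∘ g) := by
  rw [ind_empty_iff]
  refine (injective_iff_map_eq_zero (aeval (R := k) (l ∘ g))).2 fun Q hQ => ?_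
  rw [← aeval_rename] at hQ
  by_contra hQ0
  have h1 := vars_subset_of_dvd (hl _ hQ)
    (fun h => hQ0 (rename_injective _ hg (h.trans (map_zero _).symm))) ha
  obtain ⟨b, -, hb⟩ := mem_vars_rename _ _ h1
  exact hgi b (by rw [hb])

theorem IsWeakResultant.exists_isMinimallyConstrained [DecidableEq ι] [Fintype ι] [IsAlgClosed L]
    (hL : Cardinal.aleph0 ≤ Algebra.trdeg k L) {R P : MvPolynomial (Vars n) k}
    (h : IsWeakResultant R) (hR : R ≠ 0) (hP : Irreducible P) (hPR : P ∣ R) :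
    ∃ (J : Set ι) (ξ : ∀ j : J, ℙ L (Fin (n j + 1) → L))
      (Q : MvPolynomial (Vars (fun j : J => n j)) k),
      IsMinimallyConstrained k (n := fun j : J => n j) ξ ∧
      IsResultantOf k (n := fun j : J => n j) ξ Q ∧ inclVars (n := n) J Q = P := by
  obtain ⟨D, hD⟩ := h
  obtain ⟨l, v, hv, hl⟩ := exists_aeval_eq_zero_iff_dvd hL hP
  have hlR := (hl R).2 hPR
  let J : Set ι := {i | ∃ a, ⟨i, a⟩ ∈ P.vars}
  have hi : ∀ i : J, Ind k (∅ : Set L) (offGroup l i) := by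
    rintro ⟨i, a, ha⟩
    exact ind_of_forall_dvd (fun Q => (hl Q).1) ha (g := fun p : {p : Vars n // p.1 ≠ i} => p.1)
      Subtype.val_injective fun p => p.2
  have hsi : ∀ i, IsSplittable (D i) (asPolyHom k n i R) := fun i => by
    rw [asPolyHom_apply]
    exact (hD i).1
  choose x s hx y x' t c hs ht using fun i : J => exists_isPoint hL hR hlR (hi i) (hsi i)
  -- The pivot coordinate of `l_i` is determined by `x i` and the other coordinates, so all values
  -- but this one have full rank, as do all values but the one at `v`.
  have hli : ∀ i : J, Ind k (∅ : Set L) fun p : {p : Vars n // p ≠ ⟨i, s i⟩} => l p := by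
    intro i
    classical
    refine hv.of_card_le ?_ (by simp)
    rintro ⟨p, -⟩
    rw [empty_union]
    have h1 : ∀ q : Vars n, q ≠ ⟨i, s i⟩ →
        l q ∈ acl k (range fun p : {p : Vars n // p ≠ ⟨i, s i⟩} => l p) := fun q hq =>
      subset_acl _ ⟨⟨q, hq⟩, rfl⟩
    by_cases hp : p = ⟨i, s i⟩
    · subst hp
      refine mem_of_sum_mul_eq_zero (μ := group l i) (z := x i) (fun a => acl_le ?_ ((hx i).mem a))
        (hx i).pivot (fun a ha => h1 _ ?_) (hx i).sum_eq_zero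
      · rintro _ ⟨⟨q, hq⟩, rfl⟩
        refine h1 q ?_
        rintro rfl
        exact hq rfl
      · intro h
        exact ha (by simpa using h)
    · exact h1 p hp
  -- For distinct groups this is the only place where the wedge condition of a weak resultant is
  -- used.
  have hxl : ∀ (i i' : J) a, x i a ∈ acl k (range (offGroup l i')) := by
    intro i i' a
    by_cases hii : (i' : ι) = i
    · rw [hii]
      exact (hx i).mem a
    · obtain ⟨w, hw, hws⟩ := (hD i').2 i (Ne.symm hii)
      rw [← asPolyHom_apply] at hws
      exact (hx i').mem_acl_offGroup hL hR hii (hi i') (hi i) (hsi i') hw hws (hs i') (ht i')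
        (hx i) (hli i) a
  have h0 : ∀ i, x i ≠ 0 := fun i h => by
    have := (hx i).pivot
    rw [h] at this
    exact zero_ne_one this
  obtain ⟨Q, hQ⟩ := exists_rename_eq_of_vars_subset_range P (inclMap (n := n) (Subtype.val : J → ι))
    (inclMap_injective Subtype.val_injective) fun ⟨i, a⟩ hp => ⟨⟨⟨i, a, hp⟩, a⟩, rfl⟩
  have hinj := inclMap_injective (n := n) (f := (Subtype.val : J → ι)) Subtype.val_injective
  have hgen := isGenericDual_of_isPoint (k := k) Subtype.val_injective hx h0 hxl hli
  have hirr : Irreducible Q := irreducible_of_rename hinj (by rwa [hQ])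
  have hQl : aeval (l ∘ inclMap (Subtype.val : J → ι)) Q = 0 := by
    rw [← aeval_rename, hQ]
    exact (hl P).2 dvd_rfl
  refine ⟨J, fun i => Projectivization.mk L (x i) (h0 i), Q, ⟨⟨_, hgen, fun hind => ?_⟩,
    fun S hS => ?_⟩, ⟨_, hgen, hirr, hQl, fun Q' hQ' h' => ?_⟩, hQ⟩
  · exact hirr.ne_zero ((injective_iff_map_eq_zero _).1 hind Q hQl)
  -- A proper subfamily omits a group that `P` involves, so the remaining values of `l` satisfy no
  -- relation.
  · obtain ⟨⟨i, a, ha⟩, hiS⟩ := (ne_univ_iff_exists_notMem S).1 hS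
    have hfinj : Function.Injective fun b : S => (b.1 : ι) :=
      Subtype.val_injective.comp Subtype.val_injective
    refine ⟨_, isGenericDual_of_isPoint (k := k) (f := fun b : S => (b.1 : ι)) hfinj
      (x := fun b : S => x b) (s := fun b : S => s b) (fun b => hx b) (fun b => h0 b)
      (fun b b' => hxl b b') (fun b => hli b), ind_empty_iff.1 ?_⟩
    refine ind_of_forall_dvd (fun Q => (hl Q).1) ha (inclMap_injective hfinj) ?_
    rintro ⟨b, r⟩ hb
    exact hiS (by rw [← show b.1 = ⟨i, a, ha⟩ from Subtype.ext hb]; exact b.2)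
  · rw [← aeval_rename] at h'
    have h1 := (hl _).1 h'
    rw [← hQ] at h1
    exact (hirr.associated_of_dvd hQ' (dvd_of_rename_dvd hinj h1)).symm

end Weak

/-! ### Extension to singly constrained families -/

section Extend

open Set

variable {k : Type u} {L : Type v} [Field k] [Field L] [Algebra k L] {ι : Type w} {n : ι → ℕ}

lemma isGen_singleton_iff {V : Type*} {l : V → L} {Q : MvPolynomial V k} :
    IsGen {l} Q ↔ Q ≠ 0 ∧ ∀ P, Q ∣ P ↔ aeval l P = 0 := by
  constructor
  · rintro ⟨h1, h2⟩
    exact ⟨h1, fun P => by simpa using h2 P⟩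
  · rintro ⟨h1, h2⟩
    exact ⟨h1, fun P => by simpa using h2 P⟩

lemma IsGen.isResultantOf {ξ : ∀ i, ℙ L (Fin (n i + 1) → L)} {l : Vars n → L}
    {Q : MvPolynomial (Vars n) k} (h : IsGen {l} Q) (hl : IsGenericDual k ξ l) :
    IsResultantOf k ξ Q := by
  obtain ⟨h0, h1⟩ := isGen_singleton_iff.1 h
  have hp : Prime Q := by
    refine ⟨h0, fun hu => ?_, fun a b hab => ?_⟩
    · have := (h1 1).1 hu.dvd
      rw [map_one] at this
      exact one_ne_zero this
    · rw [h1, h1, ← mul_eq_zero, ← map_mul, ← h1]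
      exact hab
  exact ⟨l, hl, hp.irreducible, (h1 Q).1 dvd_rfl, fun P hP hPl =>
    (hp.irreducible.associated_of_dvd hP ((h1 P).2 hPl)).symm⟩

/-- A polynomial relation satisfied by independent values holds for all values. -/
lemma aeval_eq_zero_of_ind {V W : Type*} {f : W → V} {l : V → L}
    (h : Ind k (range (l ∘ f)) fun v : {v // v ∉ range f} => l v) {P : MvPolynomial V k}
    (hP : aeval l P = 0) {m : V → L} (hm : m ∘ f = l ∘ f) : aeval m P = 0 := by
  classical
  set F := IntermediateField.adjoin k (range (l ∘ f))
  have hF : ∀ v ∈ range f, l v ∈ F := by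
    rintro _ ⟨w, rfl⟩
    exact IntermediateField.subset_adjoin _ _ ⟨w, rfl⟩
  let θ : V → MvPolynomial {v // v ∉ range f} F := fun v =>
    if hv : v ∈ range f then C ⟨l v, hF v hv⟩ else X ⟨v, hv⟩
  have key : ∀ m : V → L, m ∘ f = l ∘ f →
      aeval m P = aeval (fun v : {v // v ∉ range f} => m v) (aeval (R := k) θ P) := by
    intro m hm
    have h1 : aeval (R := k) m = ((aeval (R := F) fun v : {v // v ∉ range f} => m v).restrictScalars
        k).comp (aeval (R := k) θ) := by
      refine algHom_ext fun v => ?_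
      rw [aeval_X, AlgHom.comp_apply, aeval_X]
      by_cases hv : v ∈ range f
      · simp only [θ, dif_pos hv, AlgHom.restrictScalars_apply, aeval_C]
        obtain ⟨w, rfl⟩ := hv
        exact congrFun hm w
      · simp only [θ, dif_neg hv, AlgHom.restrictScalars_apply, aeval_X]
    exact DFunLike.congr_fun h1 P
  rw [key l rfl] at hP
  rw [key m hm, (injective_iff_map_eq_zero _).1 h _ hP, map_zero]

/-- Outside `J` the added point is (q, 0, …, 0, 1) with `q` a new independent element. Eliminating
`q` imposes no condition on the form of that group, so the only relations of the whole family come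
from `J`. The first and last coordinates must differ, whence `n i ≠ 0`. -/
theorem exists_isResultantOf [Fintype ι] [IsAlgClosed L] (hL : Cardinal.aleph0 ≤ Algebra.trdeg k L)
    (hn : ∀ i, n i ≠ 0) (J : Set ι) (ξ : ∀ j : J, ℙ L (Fin (n j + 1) → L))
    {Q : MvPolynomial (Vars (fun j : J => n j)) k}
    (hQ : IsResultantOf k (n := fun j : J => n j) ξ Q) :
    ∃ ζ : ∀ i, ℙ L (Fin (n i + 1) → L), (∀ j : J, ζ j = ξ j) ∧
      IsResultantOf k ζ (inclVars (n := n) J Q) := by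
  classical
  choose x c hc hxs hx using fun j => exists_normalized (ξ j)
  choose s' hs' using hxs
  let s : ∀ i, Fin (n i + 1) := fun i => if h : i ∈ J then s' ⟨i, h⟩ else Fin.last (n i)
  let S : Set L := range fun p : Vars (fun j : J => n j) => x p.1 p.2
  -- One parameter per group, used only outside `J`, and all non-pivot coefficients of the linear
  -- forms, independent over the given points.
  obtain ⟨e, he⟩ := exists_ind hL (S := S) (finite_range _) (ι ⊕ {p : Vars n // p.2 ≠ s p.1})
  let q : ι → L := fun i => e (Sum.inl i)
  let b : {p : Vars n // p.2 ≠ s p.1} → L := fun p => e (Sum.inr p)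
  have hqb : Sum.elim q b = e := by ext (_ | _) <;> rfl
  rw [← hqb, ind_sumElim_iff] at he
  let y : ∀ i, Fin (n i + 1) → L := fun i => if h : i ∈ J then x ⟨i, h⟩ else
    Function.update (Pi.single 0 (q i)) (Fin.last (n i)) 1
  have hyJ : ∀ j : J, y j = x j := fun j => dif_pos j.2
  have hy : ∀ i, i ∉ J → y i = Function.update (Pi.single 0 (q i)) (Fin.last (n i)) 1 :=
    fun i hi => dif_neg hi
  have hsJ : ∀ j : J, s j = s' j := fun j => dif_pos j.2
  have hsn : ∀ i, i ∉ J → s i = Fin.last (n i) := fun i hi => dif_neg hi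
  have hys : ∀ i, y i (s i) = 1 := fun i => by
    by_cases hi : i ∈ J
    · rw [hyJ ⟨i, hi⟩, hsJ ⟨i, hi⟩, hs']
    · rw [hy i hi, hsn i hi, Function.update_self]
  have hy0 : ∀ i, y i ≠ 0 := fun i h => by
    have := hys i
    rw [h] at this
    exact zero_ne_one this
  have hymem : ∀ i a, y i a ∈ acl k (S ∪ range q) := by
    intro i a
    by_cases hi : i ∈ J
    · rw [hyJ ⟨i, hi⟩]
      exact subset_acl _ (Or.inl ⟨⟨⟨i, hi⟩, a⟩, rfl⟩)
    · rw [hy i hi, Function.update_apply]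
      split_ifs
      · exact one_mem _
      · rw [Pi.single_apply]
        split_ifs
        · exact subset_acl _ (Or.inr ⟨i, rfl⟩)
        · exact zero_mem _
  let l : Vars n → L := fun p => if h : p.2 ≠ s p.1 then b ⟨p, h⟩ else
    -∑ a : {a // a ≠ s p.1}, y p.1 a * b ⟨⟨p.1, a⟩, a.2⟩
  have hlb : (fun p : {p : Vars n // p.2 ≠ s p.1} => l p) = b := by
    funext p
    exact dif_pos p.2
  have hlb' : ∀ p (hp : p.2 ≠ s p.1), l p = b ⟨p, hp⟩ := fun p hp => dif_pos hp
  have hl : ∀ i, ∑ a, y i a * l ⟨i, a⟩ = 0 := by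
    intro i
    have h1 : l ⟨i, s i⟩ = -∑ a : {a // a ≠ s i}, y i a * b ⟨⟨i, a⟩, a.2⟩ := dif_neg (by simp)
    rw [← Finset.add_sum_erase _ _ (Finset.mem_univ (s i)), hys, one_mul, h1,
      Finset.sum_subtype _ (p := fun a => a ≠ s i) (by simp), neg_add_eq_zero]
    exact Finset.sum_congr rfl fun a _ => by rw [hlb' ⟨i, a⟩ a.2]
  let ζ : ∀ i, ℙ L (Fin (n i + 1) → L) := fun i =>
    if h : i ∈ J then ξ ⟨i, h⟩ else Projectivization.mk L (y i) (hy0 i)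
  have hζJ : ∀ j : J, ζ j = ξ j := fun j => dif_pos j.2
  have hrep : ∀ j : J, ∃ c : L, c ≠ 0 ∧ ∀ a, (ξ j).rep a = c * x j a := fun j =>
    ⟨(c j)⁻¹, inv_ne_zero (hc j), fun a => by
      rw [hx, mul_left_comm, inv_mul_cancel₀ (hc j), mul_one]⟩
  have hζ : ∀ i, ∃ c : L, c ≠ 0 ∧ ∀ a, (ζ i).rep a = c * y i a := by
    intro i
    by_cases hi : i ∈ J
    · rw [hζJ ⟨i, hi⟩, hyJ ⟨i, hi⟩]
      exact hrep ⟨i, hi⟩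
    · rw [show ζ i = _ from dif_neg hi]
      exact exists_rep_mk (hy0 i)
  have hgen : IsGenericDual k ζ l := isGenericDual_of_ind hζ hys hymem hl (by
    rw [hlb]
    exact he.2)
  let f := inclMap (n := n) (Subtype.val : J → ι)
  have hf : Function.Injective f := inclMap_injective Subtype.val_injective
  have hfr : ∀ p : Vars n, p ∉ range f ↔ p.1 ∉ J := fun p =>
    not_congr ⟨by rintro ⟨p, rfl⟩; exact p.1.2, fun h => ⟨⟨⟨p.1, h⟩, p.2⟩, rfl⟩⟩
  have hgenJ : IsGenericDual k (n := fun j : J => n j) ξ (l ∘ f) := by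
    refine isGenericDual_of_ind (n := fun j : J => n j) hrep (s := fun j => s j)
      (fun j => by rw [hsJ, hs']) (S := S) (fun j a => subset_acl _ ⟨⟨j, a⟩, rfl⟩)
      (fun j => by rw [← hyJ]; exact hl j) ?_
    have h1 : Ind k S fun p : {p : Vars n // p.2 ≠ s p.1} => l p := by
      rw [hlb]
      exact he.2.anti (subset_union_left.trans (subset_acl _))
    exact h1.comp (fun p : {p : Vars (fun j : J => n j) // p.2 ≠ s p.1} => ⟨f p, p.2⟩)
      fun p p' h => Subtype.ext (hf (congrArg Subtype.val h))
  -- A count: the coefficients outside `J` generate both their non-pivot part and the parameters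
  -- `q`, and there are no more of them than these.
  have hoff : Ind k (range (l ∘ f)) fun p : {p // p ∉ range f} => l p := by
    let g : {p : {p : Vars n // p.2 ≠ s p.1} // p.1.1 ∉ J} ⊕ {i // i ∉ J} →
      ι ⊕ {p : Vars n // p.2 ≠ s p.1} := Sum.elim (fun p => Sum.inr p) fun i => Sum.inl i
    have hg : Function.Injective g := by
      rintro (p | p) (p' | p') h
      · exact congrArg Sum.inl (Subtype.ext (Sum.inr_injective h))
      · exact absurd h (by simp [g])
      · exact absurd h (by simp [g])
      · exact congrArg Sum.inr (Subtype.ext (Sum.inl_injective h))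
    set B := S ∪ b '' {p | p.1.1 ∈ J}
    have h1 : Ind k B (Sum.elim q b ∘ g) := by
      refine ind_of_notMem fun v hv => (ind_sumElim_iff.2 he).notMem (v := g v)
        (s := {v' | v' ≠ g v}) (by simp) (acl_mono ?_ hv)
      rintro _ ((h | ⟨p, hp, rfl⟩) | ⟨v', hv', rfl⟩)
      · exact Or.inl h
      · refine Or.inr ⟨Sum.inr p, ?_, rfl⟩
        rintro h
        rcases v with v | v
        · have := Sum.inr_injective h
          rw [this] at hp
          exact v.2 hp
        · exact absurd h (by simp [g])
      · exact Or.inr ⟨g v', fun h => hv' (hg h), rfl⟩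
    have h2 : range (l ∘ f) ⊆ acl k B := by
      rintro _ ⟨⟨j, a⟩, rfl⟩
      have h3 : ∀ (a : Fin (n j + 1)) (ha : a ≠ s j), l ⟨j, a⟩ ∈ acl k B := fun a ha => by
        rw [hlb' ⟨j, a⟩ ha]
        exact subset_acl _ (Or.inr ⟨⟨⟨j, a⟩, ha⟩, j.2, rfl⟩)
      by_cases ha : a = s j
      · subst ha
        exact mem_of_sum_mul_eq_zero (μ := fun a => l ⟨j, a⟩) (z := x j)
          (fun a => subset_acl _ (Or.inl ⟨⟨j, a⟩, rfl⟩)) (by rw [hsJ, hs']) h3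
          (by rw [← hyJ]; exact hl j)
      · exact h3 a ha
    refine (h1.anti h2).of_card_le ?_ ?_
    · have h3 : ∀ p : Vars n, p.1 ∉ J →
          l p ∈ acl k (range (l ∘ f) ∪ range fun p : {p // p ∉ range f} => l p) := fun p hp =>
        subset_acl _ (Or.inr ⟨⟨p, (hfr p).2 hp⟩, rfl⟩)
      rintro (⟨p, hp⟩ | ⟨i, hi⟩)
      · change b p ∈ _
        rw [← hlb' p.1 p.2]
        exact h3 _ hp
      · change q i ∈ _
        have hne : (0 : Fin (n i + 1)) ≠ s i := by
          rw [hsn i hi]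
          intro h
          exact hn i (by simpa using (congrArg Fin.val h).symm)
        have hb0 : l ⟨i, 0⟩ ≠ 0 := by
          rw [hlb' ⟨i, 0⟩ hne]
          exact he.2.ne_zero _
        have h4 := hl i
        rw [← Finset.add_sum_erase _ _ (Finset.mem_univ (s i)), hys, one_mul,
          Finset.sum_eq_single (0 : Fin (n i + 1))] at h4
        · rw [hy i hi, Function.update_of_ne (by rwa [← hsn i hi]), Pi.single_eq_same] at h4
          -- At the added point the vanishing condition has only two terms, so `q` is minus a ratio
          -- of two coefficients of the form.
          have h5 : q i = -(l ⟨i, s i⟩ / l ⟨i, 0⟩) := by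
            field_simp
            exact (eq_neg_of_add_eq_zero_right h4)
          rw [h5]
          exact neg_mem (div_mem (h3 ⟨i, _⟩ hi) (h3 ⟨i, _⟩ hi))
        · intro a ha ha0
          rw [hy i hi, Function.update_of_ne (by rw [← hsn i hi]; exact Finset.ne_of_mem_erase ha),
            Pi.single_eq_of_ne ha0, zero_mul]
        · intro h
          exact absurd (Finset.mem_erase.2 ⟨hne, Finset.mem_univ _⟩) h
    · refine Fintype.card_le_of_injective (fun p : {p // p ∉ range f} =>
        if h : p.1.2 ≠ s p.1.1 then Sum.inl ⟨⟨p.1, h⟩, (hfr p).1 p.2⟩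
        else Sum.inr ⟨p.1.1, (hfr p).1 p.2⟩) ?_
      rintro ⟨⟨i, a⟩, hp⟩ ⟨⟨i', a'⟩, hp'⟩ h
      by_cases h1 : a ≠ s i <;> by_cases h2 : a' ≠ s i'
      · simpa [h1, h2] using h
      · simp [h1, h2] at h
      · simp [h1, h2] at h
      · have h3 : i = i' := by simpa [h1, h2] using h
        subst h3
        rw [not_not] at h1 h2
        subst h1 h2
        rfl
  refine ⟨ζ, hζJ, IsGen.isResultantOf (l := l) ?_ hgen⟩
  have hQl : IsGen {l ∘ f} Q := isGen_singleton_iff.2 ⟨hQ.isGen.ne_zero, fun P => by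
    rw [hQ.isGen.dvd_iff, hgenJ.aeval_eq_zero_iff]⟩
  have hQ' := hQl.rename hf
  refine isGen_singleton_iff.2 ⟨hQ'.ne_zero, fun P => ⟨fun h => ?_, fun h => ?_⟩⟩
  · exact (hQ'.dvd_iff P).1 h l rfl
  · exact (hQ'.dvd_iff P).2 fun m hm => aeval_eq_zero_of_ind hoff h hm

end Extend

/-! ### Resultants are weak resultants -/

section Equivalence

variable {k : Type u} [Field k] {ι : Type w} [Fintype ι] [DecidableEq ι] {n : ι → ℕ}

lemma IsResultant.isWeakResultant {R : MvPolynomial (Vars n) k} (h : IsResultant R) :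
    IsWeakResultant R := by
  obtain ⟨D, hD⟩ := h
  rw [isResultantOfDegree_iff] at hD
  refine ⟨D, fun i => ⟨(hD i (Finset.mem_univ i)).1, fun j hj => ?_⟩⟩
  obtain ⟨⟨w, hw, hw'⟩, -⟩ := (hD i (Finset.mem_univ i)).2 (MvPolynomial (Expo (n i) (n j)) k)
    (n j) (genericForm k (n i) (n j)) (genericForm_isHomogeneous k (n i) (n j))
  rw [isResultantOfDegree_iff] at hw'
  refine ⟨w, hw, ?_⟩
  rw [← asPolyHom_apply]
  exact (hw' j (Finset.mem_erase.2 ⟨hj, Finset.mem_univ j⟩)).1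

end Equivalence

end AbstractResultant

end

open AbstractResultant
theorem mainTheorem1 {k : Type*} {L : Type*} [Field k] [Field L] [Algebra k L]
    [IsAlgClosed L] (hL : Cardinal.aleph0 ≤ Algebra.trdeg k L)
    {ι : Type*} [Fintype ι] [DecidableEq ι] (n : ι → ℕ) :
    (∀ R : MvPolynomial (Vars n) k,
      [ IsResultant R,
        IsWeakResultant R,
        R ≠ 0 → ∀ P : MvPolynomial (Vars n) k, Irreducible P → P ∣ R →
          ∃ (J : Set ι) (ξ : ∀ j : J, ℙ L (Fin (n j + 1) → L))
            (Q : MvPolynomial (Vars (fun j : J => n j)) k),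
            IsMinimallyConstrained k (n := fun j : J => n j) ξ ∧
            IsResultantOf k (n := fun j : J => n j) ξ Q ∧
            inclVars (n := n) J Q = P ].TFAE) ∧
    ((∀ i, n i ≠ 0) →
      ∀ (J : Set ι) (ξ : ∀ j : J, ℙ L (Fin (n j + 1) → L))
        (Q : MvPolynomial (Vars (fun j : J => n j)) k),
        IsMinimallyConstrained k (n := fun j : J => n j) ξ →
        IsResultantOf k (n := fun j : J => n j) ξ Q →
        ∃ ζ : ∀ i, ℙ L (Fin (n i + 1) → L),
          (∀ j : J, ζ j = ξ j) ∧
          IsSinglyConstrained k ζ ∧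
          IsResultantOf k ζ (inclVars (n := n) J Q)) := by
  refine ⟨fun R => ?_, fun hn J ξ Q _ hQ => ?_⟩
  · tfae_have 1 → 2 := IsResultant.isWeakResultant
    tfae_have 2 → 3 := fun h hR P hP hPR => h.exists_isMinimallyConstrained hL hR hP hPR
    tfae_have 3 → 1 := fun h => isResultant_of_forall_irreducible R fun hR P hP hPR => by
      obtain ⟨J, ξ, Q, h1, h2, rfl⟩ := h hR P hP hPR
      exact h1.exists_isResultantOfDegree h2 Finset.univ
    tfae_finish
  · obtain ⟨ζ, h1, h2⟩ := exists_isResultantOf hL hn J ξ hQ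
    exact ⟨ζ, h1, ⟨_, h2⟩, h2⟩
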